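/- Let $M$ be a connected smooth manifold of dimension $m>2$ with a smooth symmetric $(0,2)$-tensor field $g=\langle\cdot,\cdot\rangle$ that is degenerate exactly on a non-empty set $\Sigma\subset M$. Assume that $(M,g)$ is a *transverse Riemann–Lorentz space with tangent radical*: in every local coordinate system $\det(g_{ab})$ has non-zero differential at the points of $\Sigma$ (so $\Sigma$ is a smooth hypersurface with one-dimensional radical $\mathrm{Rad}_p=\{v\in T_pM:\langle v,\cdot\rangle=0\}$, $p\in\Sigma$); $\mathrm{Rad}_p\subset T_p\Sigma$ for all $p\in\Sigma$; and the signature of $g$ changes from Riemannian to Lorentzian across $\Sigma$. Let $\square_{A}B(C)$ be the dual connection, i.e. half of $$A\langle B,C\rangle+B\langle C,A\rangle-C\langle A,B\rangle+\langle[A,B],C\rangle-\langle[B,C],A\rangle+\langle[C,A],B\rangle .$$ Near each point of $\Sigma$ let $N,R$ be the main normal and the main radical vector field along $\Sigma$: $N$ is orthogonal to $\Sigma$, $\langle N,N\rangle=1$, $\square_NN(R)=0$, $R$ is in the radical and $\mathcal H(R,R)=-1$, where $\mathcal H(X,Y)=-\square_XN(Y)$ for $X,Y$ tangent to $\Sigma$.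 They exist locally; $N$ is unique and $R$ is unique up to sign. Put $II(A,B)=\square_AB(R)$, $\nu(A)=\langle A,N\rangle$, $\rho(A)=-\mathcal H(A-\nu(A)N,R)$, and let $S_p=\{v\in T_p\Sigma:\mathcal H(v,R)=0\}$ be the canonical screen distribution. $\Sigma$ is *$II$-flat* if $II(v,w)=0$ for all $p\in\Sigma$ and $v,w\in S_p$. On $M\setminus\Sigma$ let $\nabla$ be the Levi-Civita connection, $R(A,B)C=\nabla_A\nabla_BC-\nabla_B\nabla_AC-\nabla_{[A,B]}C$, and $$K_{A\wedge B}=\frac{\langle R(A,B)A,B\rangle}{\langle A,A\rangle\langle B,B\rangle-\langle A,B\rangle^2}.$$ Extend $N,R$ smoothly to a neighbourhood in $M$ and put $\tau=\langle R,R\rangle$. For smooth vector fields $A,B,C,D$ the function $\tau\,\langle R(A,B)C,D\rangle$ on the complement of $\Sigma$ extends smoothly across $\Sigma$; $\Upsilon(A,B,C,D)$ denotes the extension. (Its values on $\Sigma$ do not depend on the choices made.) Let $U$ range over the open subsets of $M$, and $(A,B)$ over the pairs of smooth vector fields on $U$ such that the Gram matrix of $g$ on $A,B$ has rank $2$ at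 every point of $U$. **(a)** For every such $U,A,B$: $K_{A\wedge B}$, defined on $U\setminus\Sigma$, extends to a smooth function on $U$ if and only if $\Upsilon(A,B,A,B)=0$ on $U\cap\Sigma$. **(b)** Consider the assertions: 1. for all such $U,A,B$: if $\det\begin{pmatrix}\nu(A)&\nu(B)\\ \rho(A)&\rho(B)\end{pmatrix}=0$ on $U\cap\Sigma$, then $\Upsilon(A,B,A,B)=0$ on $U\cap\Sigma$; 2. $\Sigma$ is $II$-flat; 3. for all such $U,A,B$: if $\Upsilon(A,B,A,B)=0$ on $U\cap\Sigma$, then $\det\begin{pmatrix}\nu(A)&\nu(B)\\ \rho(A)&\rho(B)\end{pmatrix}=0$ on $U\cap\Sigma$. Then $(1)\Leftrightarrow(2)$ and $(2)\Rightarrow(3)$. -/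

import Mathlib

open Set Filter Topology Bundle VectorField
open scoped Manifold ContDiff

noncomputable section

/-- A smooth symmetric `(0,2)`-tensor field `g` (of arbitrary, possibly varying, rank) on an
`m`-dimensional manifold `M`. -/
structure SymmTensorField (m : ℕ) (M : Type*) [TopologicalSpace M]
    [ChartedSpace (EuclideanSpace ℝ (Fin m)) M] [IsManifold (𝓡 m) ∞ M] where
  /-- The bilinear form at each point. -/
  form (p : M) : TangentSpace (𝓡 m) p →L[ℝ] TangentSpace (𝓡 m) p →L[ℝ] ℝ
  symm (p : M) (v w : TangentSpace (𝓡 m) p) : form p v w = form p w v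
  contMDiff : ContMDiff (𝓡 m)
    ((𝓡 m).prod 𝓘(ℝ, EuclideanSpace ℝ (Fin m) →L[ℝ] EuclideanSpace ℝ (Fin m) →L[ℝ] ℝ)) ∞
    (fun p : M ↦ TotalSpace.mk'
      (EuclideanSpace ℝ (Fin m) →L[ℝ] EuclideanSpace ℝ (Fin m) →L[ℝ] ℝ) p (form p))

section Definitions

variable {m : ℕ} {M : Type*} [TopologicalSpace M]
  [ChartedSpace (EuclideanSpace ℝ (Fin m)) M] [IsManifold (𝓡 m) ∞ M]

/-- The vector field `A` is smooth on `U`. -/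
def SmoothFieldOn (A : (p : M) → TangentSpace (𝓡 m) p) (U : Set M) : Prop :=
  ContMDiffOn (𝓡 m) (𝓡 m).tangent ∞ (fun p ↦ (⟨p, A p⟩ : TangentBundle (𝓡 m) M)) U

/-- The vector field `A` is smooth at `p`. -/
def SmoothFieldAt (A : (p : M) → TangentSpace (𝓡 m) p) (p : M) : Prop :=
  ContMDiffAt (𝓡 m) (𝓡 m).tangent ∞ (fun p ↦ (⟨p, A p⟩ : TangentBundle (𝓡 m) M)) p

namespace SymmTensorField

variable (g : SymmTensorField m M)

/-- The radical of `g` at `p`: the vectors orthogonal to the whole tangent space. -/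
def radical (p : M) : Set (TangentSpace (𝓡 m) p) :=
  {v | ∀ w, g.form p v w = 0}

/-- The singular set `Σ`: the points at which `g` is degenerate. -/
def singularSet : Set M := {p | ∃ v ∈ g.radical p, v ≠ 0}

/-- The function `det (g_ab)` of the local coordinate system `e`, as a function of the
coordinates. -/
def coordDet (e : OpenPartialHomeomorph M (EuclideanSpace ℝ (Fin m)))
    (y : EuclideanSpace ℝ (Fin m)) : ℝ :=
  Matrix.det (Matrix.of fun a b : Fin m ↦
    g.form (e.symm y)
      (mfderiv (𝓡 m) (𝓡 m) e.symm y (EuclideanSpace.single a (1 : ℝ)))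
      (mfderiv (𝓡 m) (𝓡 m) e.symm y (EuclideanSpace.single b (1 : ℝ))))

/-- `(M, g)` is a transverse singular space: `Σ` is non-void and, in every smooth local coordinate
system, `det (g_ab)` has non-zero differential at the points of `Σ`. -/
def IsTransverseSingular : Prop :=
  g.singularSet.Nonempty ∧
    ∀ e ∈ IsManifold.maximalAtlas (𝓡 m) ∞ M, ∀ p ∈ e.source ∩ g.singularSet,
      fderiv ℝ (g.coordDet e) (e p) ≠ 0

/-- `v` is tangent to `Σ` at `p`: it is annihilated by the differential of every function that is
smooth at `p` and vanishes on `Σ` near `p`. -/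
def IsTangent (p : M) (v : TangentSpace (𝓡 m) p) : Prop :=
  ∀ f : M → ℝ, ContMDiffAt (𝓡 m) 𝓘(ℝ) ∞ f p → (∀ᶠ q in 𝓝[g.singularSet] p, f q = 0) →
    mvfderiv (𝓡 m) f p v = 0

/-- `g` has tangent radical. -/
def HasTangentRadical : Prop :=
  ∀ p ∈ g.singularSet, ∀ v ∈ g.radical p, g.IsTangent p v

/-- `g` is positive definite at `p`. -/
def IsRiemannAt (p : M) : Prop :=
  ∀ v : TangentSpace (𝓡 m) p, v ≠ 0 → 0 < g.form p v v

/-- `g` has signature `(m - 1, 1)` at `p`: it is negative on some vector and positive definite on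
the orthogonal complement of that vector. -/
def IsLorentzAt (p : M) : Prop :=
  ∃ u : TangentSpace (𝓡 m) p, g.form p u u < 0 ∧
    ∀ v, g.form p u v = 0 → v ≠ 0 → 0 < g.form p v v

/-- The signature of `g` changes from Riemann to Lorentz across `Σ`. -/
def ChangesRiemannToLorentz : Prop :=
  (∀ p ∉ g.singularSet, g.IsRiemannAt p ∨ g.IsLorentzAt p) ∧
    ∀ p ∈ g.singularSet, p ∈ closure {q | g.IsRiemannAt q} ∧ p ∈ closure {q | g.IsLorentzAt q}

/-- `(M, g)` is a transverse Riemann-Lorentz space with tangent radical. -/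
structure IsTransverseRiemannLorentzTangent : Prop where
  transverse : g.IsTransverseSingular
  signature : g.ChangesRiemannToLorentz
  tangentRadical : g.HasTangentRadical

/-- The function `⟨A, B⟩`. -/
def pair (A B : (p : M) → TangentSpace (𝓡 m) p) (p : M) : ℝ := g.form p (A p) (B p)

/-- The dual connection `□_A B (C)`, given by the Koszul formula. -/
def dualConn (A B C : (p : M) → TangentSpace (𝓡 m) p) (p : M) : ℝ :=
  (mvfderiv (𝓡 m) (g.pair B C) p (A p) + mvfderiv (𝓡 m) (g.pair C A) p (B p)
    - mvfderiv (𝓡 m) (g.pair A B) p (C p)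
    + g.pair (mlieBracket (𝓡 m) A B) C p - g.pair (mlieBracket (𝓡 m) B C) A p
    + g.pair (mlieBracket (𝓡 m) C A) B p) / 2

/-- The Levi-Civita derivative `∇_A B`, at the points where `g` is non-degenerate: the vector
representing the linear form `□_A B`. (At other points the value is meaningless and unused.) -/
def leviCivita (A B : (p : M) → TangentSpace (𝓡 m) p) (p : M) : TangentSpace (𝓡 m) p :=
  Classical.epsilon fun v ↦ ∀ C : (q : M) → TangentSpace (𝓡 m) q, SmoothFieldAt C p →
    g.form p v (C p) = g.dualConn A B C p

/-- The covariant curvature `⟨R(A, B) C, D⟩` of the Levi-Civita connection off `Σ`, where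
`R(A, B) C = ∇_A ∇_B C - ∇_B ∇_A C - ∇_[A, B] C`. -/
def curvature (A B C D : (p : M) → TangentSpace (𝓡 m) p) (p : M) : ℝ :=
  g.form p
    (g.leviCivita A (g.leviCivita B C) p - g.leviCivita B (g.leviCivita A C) p
      - g.leviCivita (mlieBracket (𝓡 m) A B) C p) (D p)

/-- The Gram matrix of `g` on the plane `A ∧ B`. -/
def planeGram (A B : (p : M) → TangentSpace (𝓡 m) p) (p : M) : Matrix (Fin 2) (Fin 2) ℝ :=
  !![g.pair A A p, g.pair A B p; g.pair B A p, g.pair B B p]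

/-- The sectional curvature `K_{A ∧ B} = ⟨R(A, B) A, B⟩ / det (g_{A ∧ B})` off `Σ`. -/
def sectionalCurvature (A B : (p : M) → TangentSpace (𝓡 m) p) (p : M) : ℝ :=
  g.curvature A B A B p / (g.planeGram A B p).det

/-- The function `f`, considered on `U - Σ`, has a good limit on `Σ` (`f ≅ 0`): it extends to a
smooth function on the whole of `U`. -/
def ExtendsSmoothly (f : M → ℝ) (U : Set M) : Prop :=
  ∃ F : M → ℝ, ContMDiffOn (𝓡 m) 𝓘(ℝ) ∞ F U ∧ ∀ q ∈ U \ g.singularSet, F q = f q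

/-- The second fundamental form `ℋ(X, Y) = - □_X N (Y)` of `Σ` with respect to `N`. -/
def formH (N X Y : (p : M) → TangentSpace (𝓡 m) p) (p : M) : ℝ := - g.dualConn X N Y p

/-- The form `II(A, B) = □_A B (R)`. -/
def formII (R A B : (p : M) → TangentSpace (𝓡 m) p) (p : M) : ℝ := g.dualConn A B R p

/-- `N` and `R` are smooth vector fields on the open set `V` which extend the main normal and the
main radical vector field of `V ∩ Σ`: at the points of `Σ`, `N` is orthogonal to `Σ`, unitary
and `II`-isotropic, and `R` is in the radical, with `ℋ(R, R) = -1`. -/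
structure IsMainPair (V : Set M) (N R : (p : M) → TangentSpace (𝓡 m) p) : Prop where
  isOpen : IsOpen V
  smooth_normal : SmoothFieldOn N V
  smooth_radical : SmoothFieldOn R V
  normal_orthogonal : ∀ p ∈ V ∩ g.singularSet, ∀ v, g.IsTangent p v → g.form p (N p) v = 0
  normal_unitary : ∀ p ∈ V ∩ g.singularSet, g.pair N N p = 1
  normal_isotropic : ∀ p ∈ V ∩ g.singularSet, g.formII R N N p = 0
  radical_mem : ∀ p ∈ V ∩ g.singularSet, R p ∈ g.radical p
  radical_unitary : ∀ p ∈ V ∩ g.singularSet, g.formH N R R p = -1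

/-- The normal component `ν(A) = ⟨A, N⟩`. -/
def nu (N A : (p : M) → TangentSpace (𝓡 m) p) (p : M) : ℝ := g.pair A N p

/-- The radical component `ρ(A) = - ℋ(A - ν(A) N, R)`. -/
def rho (N R A : (p : M) → TangentSpace (𝓡 m) p) (p : M) : ℝ :=
  - g.formH N (fun q ↦ A q - g.nu N A q • N q) R p

/-- The determinant with rows `ν(A), ν(B)` and `ρ(A), ρ(B)`. -/
def nuRhoDet (N R A B : (p : M) → TangentSpace (𝓡 m) p) (p : M) : ℝ :=
  Matrix.det !![g.nu N A p, g.nu N B p; g.rho N R A p, g.rho N R B p]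

/-- `X p` belongs to the fibre at `p ∈ Σ` of the canonical screen distribution. -/
def IsScreenAt (N R X : (p : M) → TangentSpace (𝓡 m) p) (p : M) : Prop :=
  g.IsTangent p (X p) ∧ g.formH N X R p = 0

/-- `Σ` is `II`-flat: `II(X, Y) = 0` at every `p ∈ Σ`, for all `X`, `Y` in the screen
distribution. -/
def IsIIFlat : Prop :=
  ∀ p ∈ g.singularSet, ∀ (V : Set M) (N R : (p : M) → TangentSpace (𝓡 m) p),
    g.IsMainPair V N R → p ∈ V →
      ∀ X Y : (p : M) → TangentSpace (𝓡 m) p, SmoothFieldAt X p → SmoothFieldAt Y p →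
        g.IsScreenAt N R X p → g.IsScreenAt N R Y p → g.formII R X Y p = 0

/-- The tensor field `Υ`: the extension by continuity across `Σ` of `τ ⟨R(A, B) C, D⟩`, where
`τ = ⟨R, R⟩` and `R` extends the main radical vector field. -/
def upsilon (R A B C D : (p : M) → TangentSpace (𝓡 m) p) (p : M) : ℝ :=
  limUnder (𝓝[g.singularSetᶜ] p) fun q ↦ g.pair R R q * g.curvature A B C D q

/-- `Υ(A, B, A, B) = 0` along `U ∩ Σ`. The values of `Υ` on `Σ` do not depend on the local choice
of `(N, R)`. -/
def UpsilonVanishes (U : Set M) (A B : (p : M) → TangentSpace (𝓡 m) p) : Prop :=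
  ∀ p ∈ U ∩ g.singularSet, ∀ (V : Set M) (N R : (p : M) → TangentSpace (𝓡 m) p),
    g.IsMainPair V N R → p ∈ V → g.upsilon R A B A B p = 0

/-- The `(ν, ρ)`-determinant of `A, B` vanishes along `U ∩ Σ`. Up to sign it does not depend on the
local choice of `(N, R)`. -/
def NuRhoDetVanishes (U : Set M) (A B : (p : M) → TangentSpace (𝓡 m) p) : Prop :=
  ∀ p ∈ U ∩ g.singularSet, ∀ (V : Set M) (N R : (p : M) → TangentSpace (𝓡 m) p),
    g.IsMainPair V N R → p ∈ V → g.nuRhoDet N R A B p = 0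

/-- `A` and `B` are smooth vector fields on the open set `U` with `rank (g_{A ∧ B}) = 2` at every
point of `U`. -/
structure IsRankTwoPlane (U : Set M) (A B : (p : M) → TangentSpace (𝓡 m) p) : Prop where
  isOpen : IsOpen U
  smooth_left : SmoothFieldOn A U
  smooth_right : SmoothFieldOn B U
  rank_eq : ∀ p ∈ U, (g.planeGram A B p).rank = 2

end SymmTensorField

end Definitions

end

/-! In a chart, let `G` be the matrix field of the metric and Γ its Christoffel symbols of the first
kind, which stay smooth across Σ. The curvature consists of first derivatives of Γ and of products
of two Γ contracted with the inverse of `G`, so only that inverse is singular. Transversality forces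
a one-dimensional radical. For a covector θ that is non-zero on it, Ĝ = G + θ⊗θ is invertible
nearby. With u = Ĝ⁻¹θ and σ = 1 − θ(u) one has G(u, ·) = σθ and det G = σ det Ĝ. Hence σ is a
regular equation of Σ, and u spans the radical there. The rank-one update formula `inverse_apply`
reads G⁻¹ = Ĝ⁻¹ + σ⁻¹ u⊗u, so the curvature has at most a simple pole along Σ. By Hadamard's lemma τ
= ⟨R, R⟩ = σk, with k = θ(R)² ≠ 0 on Σ. Thus τ times the curvature extends smoothly, and on Σ
Υ(A,B,C,D) = II(A,C) II(B,D) − II(B,C) II(A,D), where II = Γ(·, ·, R).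

(a) The Gram determinant of the plane is a smooth unit. If K extends, then τ times the curvature
tends to zero on Σ, because τ does. Conversely, if Υ(A,B,A,B) vanishes on Σ, Hadamard's lemma
divides it by σ, and division by k then gives the smooth extension of the curvature.

(b) Split a vector at a point of Σ into its N, R and screen components. Tangency of the radical and
the normalisations of N and R give II(N,N) = II(R,R) = 0 and II(N,R) = 1, while N and R are
II-orthogonal to the screen. So II(A,B) = ν(A)ρ(B) + ρ(A)ν(B) + II(screen parts), as in
`christoffel_eq`. If the screen term vanishes, Υ(A,B,A,B) is minus the square of the (ν,
ρ)-determinant, which gives (2) ⇒ (1) and (2) ⇒ (3). For (1) ⇒ (2), the plane of N + R and a screen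
vector v has zero determinant and Υ = 2 II(v,v). Polarisation finishes the argument. -/

set_option synthInstance.maxHeartbeats 400000

/-! ### Hadamard's lemma and straightening of a regular hypersurface. -/

section Calculus

variable {E : Type*} [NormedAddCommGroup E] [NormedSpace ℝ E]

/-- A parametric integral over `[0, 1]` of a smooth function is smooth. -/
theorem contDiff_parametric_intervalIntegral {f : E × ℝ → ℝ} (hf : ContDiff ℝ ∞ f) :
    ContDiff ℝ ∞ fun x ↦ ∫ s in (0 : ℝ)..1, f (x, s) := by
  obtain ⟨χ, hχs, hχc, hχ, -, hχ1⟩ : ∃ χ : ℝ → ℝ, tsupport χ ⊆ univ ∧ HasCompactSupport χ ∧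
      ContDiff ℝ ∞ χ ∧ True ∧ ∀ x ∈ Icc (-1 : ℝ) 0, χ x = 1 := by
    let b : ContDiffBump (0 : ℝ) := ⟨1, 2, one_pos, one_lt_two⟩
    refine ⟨b, subset_univ _, b.hasCompactSupport, b.contDiff, trivial, fun x hx ↦ ?_⟩
    apply b.one_of_mem_closedBall
    simp only [Metric.mem_closedBall, dist_zero_right, Real.norm_eq_abs, b, abs_le]
    constructor <;> linarith [hx.1, hx.2]
  -- The integral is the convolution of the indicator of (0, 1] with x ↦ χ(x) f(p, −x), evaluated at
  -- 0. The cutoff supplies compact support and equals 1 on [−1, 0], the only place where it is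
  -- seen.
  have key := MeasureTheory.contDiffOn_convolution_right_with_param_comp (𝕜 := ℝ) (n := ⊤)
    (μ := MeasureTheory.volume)
    (ContinuousLinearMap.mul ℝ ℝ) (s := (univ : Set E)) (v := fun _ ↦ (0 : ℝ)) contDiffOn_const
    (f := (Ioc (0 : ℝ) 1).indicator fun _ ↦ (1 : ℝ)) (g := fun p x ↦ χ x * f (p, -x))
    (k := tsupport χ) isOpen_univ hχc
    (fun p x _ hx ↦ by simp [image_eq_zero_of_notMem_tsupport hx])
    ((MeasureTheory.locallyIntegrable_const _).indicator measurableSet_Ioc)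
    (by
      apply ContDiff.contDiffOn
      exact (hχ.comp contDiff_snd).mul (hf.comp (contDiff_fst.prodMk contDiff_snd.neg)))
  rw [contDiffOn_univ] at key
  convert key using 2 with x
  rw [MeasureTheory.convolution, intervalIntegral.integral_of_le zero_le_one,
    ← MeasureTheory.integral_indicator measurableSet_Ioc]
  congr 1 with t
  by_cases ht : t ∈ Ioc (0 : ℝ) 1
  · have : χ (-t) = 1 := hχ1 _ ⟨by linarith [ht.2], by linarith [ht.1]⟩
    simp [ht, this]
  · simp [ht]

/-- A smooth function that vanishes on the hyperplane `ℓ = 0` is divisible by `ℓ`, up to its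
values along the projection to the hyperplane. -/
theorem exists_contDiff_sub_eq_mul {F : E → ℝ} (hF : ContDiff ℝ ∞ F) (l : E →L[ℝ] ℝ) (n : E) :
    ∃ K : E → ℝ, ContDiff ℝ ∞ K ∧ ∀ z, F z - F (z - l z • n) = l z * K z := by
  refine ⟨fun z ↦ ∫ s in (0 : ℝ)..1, fderiv ℝ F (z - (s * l z) • n) n, ?_, fun z ↦ ?_⟩
  · refine contDiff_parametric_intervalIntegral
      (f := fun q : E × ℝ ↦ fderiv ℝ F (q.1 - (q.2 * l q.1) • n) n) ?_
    refine ContDiff.clm_apply ?_ contDiff_const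
    refine (hF.fderiv_right (m := ∞) (by simp)).comp ?_
    fun_prop
  · have hd : ∀ s ∈ uIcc (0 : ℝ) 1, HasDerivAt (fun s : ℝ ↦ F (z - (s * l z) • n))
        (-(l z * fderiv ℝ F (z - (s * l z) • n) n)) s := by
      intro s _
      have h1 : HasDerivAt (fun s : ℝ ↦ z - (s * l z) • n) (-(l z • n)) s := by
        have := (((hasDerivAt_id s).mul_const (l z)).smul_const n).const_sub z
        simpa using this
      have h2 := ((hF.differentiable (by simp)) (z - (s * l z) • n)).hasFDerivAt.comp_hasDerivAt s
        h1
      simpa using! h2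
    have := intervalIntegral.integral_eq_sub_of_hasDerivAt hd (by
      apply Continuous.intervalIntegrable
      have : Continuous (fderiv ℝ F) := hF.continuous_fderiv (by simp)
      fun_prop)
    rw [intervalIntegral.integral_neg, intervalIntegral.integral_const_mul] at this
    simp only [one_mul, zero_mul, zero_smul, sub_zero] at this
    linarith

variable [FiniteDimensional ℝ E]

/-- Near a regular point `p` of `h` with `h p = 0`, the function `h` is the linear form `fderiv h p`
in suitable smooth coordinates. -/
theorem exists_straightening {Ω : Set E} (hΩ : IsOpen Ω) {h : E → ℝ} (hh : ContDiffOn ℝ ∞ h Ω)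
    {p : E} (hp : p ∈ Ω) (hd : fderiv ℝ h p ≠ 0) :
    ∃ Φ : OpenPartialHomeomorph E E, p ∈ Φ.source ∧ Φ.source ⊆ Ω ∧
      ContDiffOn ℝ ∞ Φ Φ.source ∧ ContDiffOn ℝ ∞ Φ.symm Φ.target ∧
      HasFDerivAt Φ (ContinuousLinearMap.id ℝ E) p ∧
      ∀ y, fderiv ℝ h p (Φ y) = h y := by
  set l := fderiv ℝ h p with hl
  obtain ⟨n, hn⟩ : ∃ n, l n = 1 := by
    obtain ⟨v, hv⟩ : ∃ v, l v ≠ 0 := by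
      by_contra! H
      exact hd (by ext v; simp [H])
    exact ⟨(l v)⁻¹ • v, by simp [hv]⟩
  -- Since `l n = 1`, `l ∘ ψ = h` identically; since `l` is the differential of `h` at `p`, ψ has
  -- identity derivative at `p`.
  let ψ : E → E := fun y ↦ y + (h y - l y) • n
  have hψ : ContDiffOn ℝ ∞ ψ Ω :=
    contDiffOn_id.add ((hh.sub l.contDiff.contDiffOn).smul contDiffOn_const)
  have hψat : ∀ y ∈ Ω, ContDiffAt ℝ ∞ ψ y := fun y hy ↦ hψ.contDiffAt (hΩ.mem_nhds hy)
  have hder : HasFDerivAt ψ (ContinuousLinearMap.id ℝ E) p := by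
    have h1 : HasFDerivAt h l p :=
      ((hh.contDiffAt (hΩ.mem_nhds hp)).differentiableAt (by simp)).hasFDerivAt
    have := (hasFDerivAt_id p).add ((h1.sub l.hasFDerivAt).smul_const n)
    convert! this using 1
    simp
  let Φ₀ := (hψat p hp).toOpenPartialHomeomorph ψ
    (f' := ContinuousLinearEquiv.refl ℝ E) hder (by simp)
  have hΦ₀ : (Φ₀ : E → E) = ψ := rfl
  -- Invertibility of the derivative near `p`, not only at `p`, makes the inverse smooth on the
  -- whole target after shrinking.
  have hinv : ∀ᶠ y in 𝓝 p, fderiv ℝ ψ y ∈ range ((↑) : (E ≃L[ℝ] E) → E →L[ℝ] E) := by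
    have hc : ContinuousAt (fderiv ℝ ψ) p :=
      ((hψat p hp).fderiv_right (m := ∞) (by simp)).continuousAt
    apply hc
    rw [hder.fderiv]
    exact ContinuousLinearEquiv.nhds (ContinuousLinearEquiv.refl ℝ E)
  obtain ⟨W, hWs, hWo, hpW⟩ := mem_nhds_iff.1 (hinv.and (hΩ.mem_nhds hp))
  refine ⟨Φ₀.restrOpen W hWo, ?_, ?_, ?_, ?_, ?_, ?_⟩
  · simp only [OpenPartialHomeomorph.restrOpen_source]
    exact ⟨(hψat p hp).mem_toOpenPartialHomeomorph_source
      (f' := ContinuousLinearEquiv.refl ℝ E) hder (by simp), hpW⟩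
  · intro y hy
    simp only [OpenPartialHomeomorph.restrOpen_source] at hy
    exact (hWs hy.2).2
  · intro y hy
    simp only [OpenPartialHomeomorph.restrOpen_source] at hy
    exact (hψat y (hWs hy.2).2).contDiffWithinAt
  · intro z hz
    set Φ := Φ₀.restrOpen W hWo with hΦ
    have hs : Φ.symm z ∈ Φ.source := Φ.map_target hz
    simp only [hΦ, OpenPartialHomeomorph.restrOpen_source] at hs
    obtain ⟨⟨e, he⟩, hΩ'⟩ := hWs hs.2
    refine (Φ.contDiffAt_symm (f₀' := e) hz ?_ ?_).contDiffWithinAt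
    · rw [he]
      exact ((hψat _ hΩ').differentiableAt (by simp)).hasFDerivAt
    · exact hψat _ hΩ'
  · exact hder
  · intro y
    change l (y + (h y - l y) • n) = h y
    simp [hn]

/-- Hadamard's lemma: a smooth function that vanishes on a regular level hypersurface `h = 0` is
locally a smooth multiple of `h`. -/
theorem exists_eq_mul_of_eq_zero {Ω : Set E} (hΩ : IsOpen Ω) {f h : E → ℝ}
    (hf : ContDiffOn ℝ ∞ f Ω) (hh : ContDiffOn ℝ ∞ h Ω) {p : E} (hp : p ∈ Ω)
    (hd : fderiv ℝ h p ≠ 0) (hfh : ∀ y ∈ Ω, h y = 0 → f y = 0) :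
    ∃ W ⊆ Ω, IsOpen W ∧ p ∈ W ∧ ∃ k : E → ℝ, ContDiffOn ℝ ∞ k W ∧ ∀ y ∈ W, f y = h y * k y := by
  obtain ⟨Φ, hpΦ, hΦΩ, hΦ, hΦs, -, hΦl⟩ := exists_straightening hΩ hh hp hd
  set l := fderiv ℝ h p with hl
  obtain ⟨n, hn⟩ : ∃ n, l n = 1 := by
    obtain ⟨v, hv⟩ : ∃ v, l v ≠ 0 := by
      by_contra! H
      exact hd (by ext v; simp [H])
    exact ⟨(l v)⁻¹ • v, by simp [hv]⟩
  have hz0 : Φ p ∈ Φ.target := Φ.map_source hpΦ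
  -- The linear division lemma needs a globally defined function, so the transported `f` is cut off
  -- inside the target; the cutoff is divided out again where it is non-zero.
  obtain ⟨χ, hχs, -, hχ, -, hχ1⟩ :=
    exists_contDiff_tsupport_subset (n := ⊤) (Φ.open_target.mem_nhds hz0)
  have hfΦ : ContDiffOn ℝ ∞ (fun z ↦ f (Φ.symm z)) Φ.target :=
    hf.comp hΦs fun z hz ↦ hΦΩ (Φ.map_target hz)
  have hF : ContDiff ℝ ∞ fun z ↦ χ z * f (Φ.symm z) := by
    rw [contDiff_iff_contDiffAt]
    intro z
    by_cases hz : z ∈ Φ.target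
    · exact hχ.contDiffAt.mul (hfΦ.contDiffAt (Φ.open_target.mem_nhds hz))
    · have hz' : (tsupport χ)ᶜ ∈ 𝓝 z :=
        (isClosed_tsupport χ).isOpen_compl.mem_nhds fun h ↦ hz (hχs h)
      refine (contDiffAt_const (c := (0 : ℝ))).congr_of_eventuallyEq ?_
      filter_upwards [hz'] with w hw
      rw [image_eq_zero_of_notMem_tsupport hw, zero_mul]
  obtain ⟨K, hK, hKeq⟩ := exists_contDiff_sub_eq_mul hF l n
  have hzero : ∀ z, l z = 0 → χ z * f (Φ.symm z) = 0 := by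
    intro z hz
    by_cases hzt : z ∈ Φ.target
    · have := hΦl (Φ.symm z)
      rw [Φ.right_inv hzt, hz] at this
      rw [hfh _ (hΦΩ (Φ.map_target hzt)) this.symm, mul_zero]
    · rw [image_eq_zero_of_notMem_tsupport fun h ↦ hzt (hχs h), zero_mul]
  refine ⟨Φ.source ∩ Φ ⁻¹' {z | χ z ≠ 0}, fun y hy ↦ hΦΩ hy.1,
    Φ.continuousOn.isOpen_inter_preimage Φ.open_source
      (isOpen_ne_fun hχ.continuous continuous_const), ⟨hpΦ, by simp [hχ1]⟩,
    fun y ↦ K (Φ y) / χ (Φ y), ?_, ?_⟩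
  · have hΦ' := hΦ.mono (inter_subset_left (t := Φ ⁻¹' {z | χ z ≠ 0}))
    exact (hK.comp_contDiffOn hΦ').div (hχ.comp_contDiffOn hΦ') fun y hy ↦ hy.2
  · rintro y ⟨hy, hy'⟩
    have hy' : χ (Φ y) ≠ 0 := hy'
    have := hKeq (Φ y)
    rw [hzero (Φ y - l (Φ y) • n) (by simp [hn]), Φ.left_inv hy, hΦl] at this
    field_simp
    linarith

/-- A function that vanishes on a regular level hypersurface has zero derivative in the directions
tangent to it. -/
theorem fderiv_eq_zero_of_eventually_eq_zero {Ω : Set E} (hΩ : IsOpen Ω) {f h : E → ℝ}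
    (hh : ContDiffOn ℝ ∞ h Ω) {p : E} (hp : p ∈ Ω) (h0 : h p = 0) (hd : fderiv ℝ h p ≠ 0)
    (hf : DifferentiableAt ℝ f p) (hfh : ∀ᶠ y in 𝓝 p, h y = 0 → f y = 0) {v : E}
    (hv : fderiv ℝ h p v = 0) : fderiv ℝ f p v = 0 := by
  obtain ⟨Φ, hpΦ, hΦΩ, -, -, hΦd, hΦl⟩ := exists_straightening hΩ hh hp hd
  have hz0 : Φ p ∈ Φ.target := Φ.map_source hpΦ
  have hsd : HasFDerivAt Φ.symm (ContinuousLinearMap.id ℝ E) (Φ p) := by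
    refine Φ.hasFDerivAt_symm (f' := ContinuousLinearEquiv.refl ℝ E) hz0 ?_
    rw [Φ.left_inv hpΦ]
    exact hΦd
  -- The straight line through `Φ p` in the direction `v` lies in the hyperplane, so its preimage is
  -- a curve in `h = 0` with velocity `v`, along which `f` vanishes.
  have hc : HasDerivAt (fun t : ℝ ↦ Φ p + t • v) v 0 := by
    simpa using ((hasDerivAt_id (0 : ℝ)).smul_const v).const_add (Φ p)
  have hsc : HasDerivAt (fun t : ℝ ↦ Φ.symm (Φ p + t • v)) v 0 := by
    have h1 : HasFDerivAt Φ.symm (ContinuousLinearMap.id ℝ E) (Φ p + (0 : ℝ) • v) := by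
      simpa using hsd
    simpa using! h1.comp_hasDerivAt (0 : ℝ) hc
  have hp0 : Φ.symm (Φ p + (0 : ℝ) • v) = p := by simp [Φ.left_inv hpΦ]
  have hfc : HasDerivAt (fun t : ℝ ↦ f (Φ.symm (Φ p + t • v))) (fderiv ℝ f p v) 0 := by
    have h1 : HasFDerivAt f (fderiv ℝ f p) (Φ.symm (Φ p + (0 : ℝ) • v)) := by
      rw [hp0]; exact hf.hasFDerivAt
    exact h1.comp_hasDerivAt (0 : ℝ) hsc
  have hev : (fun t : ℝ ↦ f (Φ.symm (Φ p + t • v))) =ᶠ[𝓝 0] fun _ ↦ 0 := by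
    have h1 : Tendsto (fun t : ℝ ↦ Φ.symm (Φ p + t • v)) (𝓝 0) (𝓝 p) := by
      have := hsc.continuousAt.tendsto
      rwa [hp0] at this
    have h2 : Tendsto (fun t : ℝ ↦ Φ p + t • v) (𝓝 0) (𝓝 (Φ p)) := by
      have := hc.continuousAt.tendsto
      simpa using this
    filter_upwards [h1.eventually hfh, h2.eventually (Φ.open_target.mem_nhds hz0)] with t ht ht'
    apply ht
    rw [← hΦl, Φ.right_inv ht', map_add, hΦl, h0, map_smul, hv]
    simp
  exact hfc.unique ((hasDerivAt_const (0 : ℝ) (0 : ℝ)).congr_of_eventuallyEq hev)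

end Calculus

/-! ### Levi-Civita connection and curvature of a metric on a vector space. -/

noncomputable section Koszul

variable {E : Type*} [NormedAddCommGroup E] [NormedSpace ℝ E]

instance dualNormedAddCommGroup : NormedAddCommGroup (E →L[ℝ] ℝ) := inferInstance

instance dualNormedSpace : NormedSpace ℝ (E →L[ℝ] ℝ) := inferInstance

instance dualAddCommGroup : AddCommGroup (E →L[ℝ] ℝ) := inferInstance

instance dualModule : Module ℝ (E →L[ℝ] ℝ) := inferInstance

instance bilinNormedAddCommGroup : NormedAddCommGroup (E →L[ℝ] E →L[ℝ] ℝ) := inferInstance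

instance bilinNormedSpace : NormedSpace ℝ (E →L[ℝ] E →L[ℝ] ℝ) := inferInstance

instance bilinAddCommGroup : AddCommGroup (E →L[ℝ] E →L[ℝ] ℝ) := inferInstance

instance bilinModule : Module ℝ (E →L[ℝ] E →L[ℝ] ℝ) := inferInstance

instance trilinNormedAddCommGroup : NormedAddCommGroup (E →L[ℝ] E →L[ℝ] E →L[ℝ] ℝ) := inferInstance

instance trilinNormedSpace : NormedSpace ℝ (E →L[ℝ] E →L[ℝ] E →L[ℝ] ℝ) := inferInstance

instance trilinAddCommGroup : AddCommGroup (E →L[ℝ] E →L[ℝ] E →L[ℝ] ℝ) := inferInstance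

instance trilinModule : Module ℝ (E →L[ℝ] E →L[ℝ] E →L[ℝ] ℝ) := inferInstance

/-- The Christoffel symbols of the first kind of a field `G` of bilinear forms on a vector space,
as a trilinear form. -/
def christoffel (G : E → E →L[ℝ] E →L[ℝ] ℝ) (y : E) : E →L[ℝ] E →L[ℝ] E →L[ℝ] ℝ :=
  (2⁻¹ : ℝ) • (fderiv ℝ G y +
    ((ContinuousLinearMap.flipₗᵢ ℝ E E ℝ).toContinuousLinearEquiv.toContinuousLinearMap ∘L
      fderiv ℝ G y).flip -
    (ContinuousLinearMap.flipₗᵢ ℝ E E ℝ).toContinuousLinearEquiv.toContinuousLinearMap ∘L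
      (fderiv ℝ G y).flip)

variable {G : E → E →L[ℝ] E →L[ℝ] ℝ}

theorem christoffel_apply (G : E → E →L[ℝ] E →L[ℝ] ℝ) (y a b c : E) :
    christoffel G y a b c =
      (fderiv ℝ G y a b c + fderiv ℝ G y b c a - fderiv ℝ G y c a b) / 2 := by
  simp [christoffel]
  ring

theorem hasFDerivAt_bilin_apply {y : E} (hG : DifferentiableAt ℝ G y) {V W : E → E}
    (hV : DifferentiableAt ℝ V y) (hW : DifferentiableAt ℝ W y) :
    HasFDerivAt (fun z ↦ G z (V z) (W z)) ((G y (V y)).comp (fderiv ℝ W y)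
      + (((G y).comp (fderiv ℝ V y) + (fderiv ℝ G y).flip (V y)).flip (W y))) y :=
  (hG.hasFDerivAt.clm_apply hV.hasFDerivAt).clm_apply hW.hasFDerivAt

theorem fderiv_bilin_apply {y : E} (hG : DifferentiableAt ℝ G y) {V W : E → E}
    (hV : DifferentiableAt ℝ V y) (hW : DifferentiableAt ℝ W y) (a : E) :
    fderiv ℝ (fun z ↦ G z (V z) (W z)) y a =
      fderiv ℝ G y a (V y) (W y) + G y (fderiv ℝ V y a) (W y) + G y (V y) (fderiv ℝ W y a) := by
  rw [(hasFDerivAt_bilin_apply hG hV hW).fderiv]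
  simp
  ring

theorem fderiv_bilin_symm (hsymm : ∀ z v w, G z v w = G z w v) {y : E}
    (hG : DifferentiableAt ℝ G y) (a b c : E) : fderiv ℝ G y a b c = fderiv ℝ G y a c b := by
  have h1 := fderiv_bilin_apply hG (differentiableAt_const b) (differentiableAt_const c) a
  have h2 := fderiv_bilin_apply hG (differentiableAt_const c) (differentiableAt_const b) a
  simp only [fderiv_fun_const, Pi.zero_apply, zero_apply, map_zero,
    add_zero] at h1 h2
  rw [← h1, ← h2]
  simp_rw [hsymm _ b c]

theorem christoffel_symm (hsymm : ∀ z v w, G z v w = G z w v) {y : E}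
    (hG : DifferentiableAt ℝ G y) (a b c : E) : christoffel G y a b c = christoffel G y b a c := by
  simp only [christoffel_apply, fderiv_bilin_symm hsymm hG c a b,
    fderiv_bilin_symm hsymm hG b c a, fderiv_bilin_symm hsymm hG a b c]
  ring

/-- Metric compatibility of the connection, in terms of symbols of the first kind. -/
theorem christoffel_add_swap (hsymm : ∀ z v w, G z v w = G z w v) {y : E}
    (hG : DifferentiableAt ℝ G y) (a b c : E) :
    christoffel G y a b c + christoffel G y a c b = fderiv ℝ G y a b c := by
  simp only [christoffel_apply, fderiv_bilin_symm hsymm hG a c b,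
    fderiv_bilin_symm hsymm hG b a c, fderiv_bilin_symm hsymm hG c b a]
  ring

/-- The Koszul formula on a vector space. -/
theorem koszul_eq (hsymm : ∀ z v w, G z v w = G z w v) {y : E} (hG : DifferentiableAt ℝ G y)
    {A B C : E → E} (hA : DifferentiableAt ℝ A y) (hB : DifferentiableAt ℝ B y)
    (hC : DifferentiableAt ℝ C y) :
    (fderiv ℝ (fun z ↦ G z (B z) (C z)) y (A y) + fderiv ℝ (fun z ↦ G z (C z) (A z)) y (B y)
      - fderiv ℝ (fun z ↦ G z (A z) (B z)) y (C y) + G y (lieBracket ℝ A B y) (C y)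
      - G y (lieBracket ℝ B C y) (A y) + G y (lieBracket ℝ C A y) (B y)) / 2 =
    G y (fderiv ℝ B y (A y)) (C y) + christoffel G y (A y) (B y) (C y) := by
  rw [fderiv_bilin_apply hG hB hC, fderiv_bilin_apply hG hC hA, fderiv_bilin_apply hG hA hB,
    christoffel_apply]
  simp only [lieBracket, map_sub, sub_apply]
  rw [hsymm y (C y) (fderiv ℝ A y (B y)), hsymm y (fderiv ℝ C y (B y)) (A y),
    hsymm y (B y) (fderiv ℝ C y (A y)), hsymm y (A y) (fderiv ℝ B y (C y))]
  ring

theorem IsInvertible.apply_inverse_apply {L : E →L[ℝ] E →L[ℝ] ℝ} (h : L.IsInvertible)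
    (α : E →L[ℝ] ℝ) : L (L.inverse α) = α := by
  obtain ⟨e, rfl⟩ := h
  simp

theorem IsInvertible.inverse_apply_apply {L : E →L[ℝ] E →L[ℝ] ℝ} (h : L.IsInvertible)
    (v : E) : L.inverse (L v) = v := by
  obtain ⟨e, rfl⟩ := h
  simp

variable [FiniteDimensional ℝ E]

theorem contDiffOn_christoffel {Ω : Set E} (hΩ : IsOpen Ω) (hG : ContDiffOn ℝ ∞ G Ω) :
    ContDiffOn ℝ ∞ (christoffel G) Ω := by
  have hD : ContDiffOn ℝ ∞ (fderiv ℝ G) Ω := hG.fderiv_of_isOpen hΩ (by simp)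
  rw [contDiffOn_clm_apply]
  intro a
  rw [contDiffOn_clm_apply]
  intro b
  rw [contDiffOn_clm_apply]
  intro c
  simp only [christoffel_apply]
  have h (a b c : E) : ContDiffOn ℝ ∞ (fun y ↦ fderiv ℝ G y a b c) Ω :=
    ((hD.clm_apply contDiffOn_const).clm_apply contDiffOn_const).clm_apply contDiffOn_const
  exact (((h a b c).add (h b c a)).sub (h c a b)).div_const 2

/-- A symmetric bilinear form with trivial radical is invertible as a map to the dual. -/
theorem isInvertible_of_forall_eq_zero {L : E →L[ℝ] E →L[ℝ] ℝ} (h : ∀ v, L v = 0 → v = 0) :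
    L.IsInvertible := by
  have hinj : Function.Injective L.toLinearMap := by
    rw [injective_iff_map_eq_zero]
    exact h
  have hfr : Module.finrank ℝ E = Module.finrank ℝ (E →L[ℝ] ℝ) := by
    rw [← (LinearMap.toContinuousLinearMap (𝕜 := ℝ) (E := E) (F' := ℝ)).finrank_eq]
    exact Subspace.dual_finrank_eq.symm
  refine ⟨(LinearEquiv.ofInjectiveOfFinrankEq L.toLinearMap hinj hfr).toContinuousLinearEquiv, ?_⟩
  ext v w
  rfl

theorem IsInvertible.eventually {y : E} (hG : ContinuousAt G y) (h : (G y).IsInvertible) :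
    ∀ᶠ z in 𝓝 y, (G z).IsInvertible := by
  obtain ⟨e, he⟩ := h
  have := e.nhds
  rw [he] at this
  filter_upwards [hG this] with z hz
  exact hz

theorem ContDiffAt.bilin_inverse {y : E} (hG : ContDiffAt ℝ ∞ G y) (h : (G y).IsInvertible) :
    ContDiffAt ℝ ∞ (fun z ↦ (G z).inverse) y := by
  obtain ⟨e, he⟩ := h
  have := contDiffAt_map_inverse (𝕜 := ℝ) (n := ∞) e
  rw [he] at this
  exact this.comp y hG

/-- The covariant derivative of the Levi-Civita connection of `G`. -/
def flatConn (G : E → E →L[ℝ] E →L[ℝ] ℝ) (A B : E → E) (y : E) : E :=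
  fderiv ℝ B y (A y) + (G y).inverse (christoffel G y (A y) (B y))

omit [FiniteDimensional ℝ E] in
theorem bilin_flatConn {A B : E → E} {y : E} (h : (G y).IsInvertible) (d : E) :
    G y (flatConn G A B y) d =
      G y (fderiv ℝ B y (A y)) d + christoffel G y (A y) (B y) d := by
  rw [flatConn, map_add, IsInvertible.apply_inverse_apply h, add_apply]

theorem ContDiffAt.flatConn {y : E} (hG : ∀ᶠ z in 𝓝 y, ContDiffAt ℝ ∞ G z)
    (h : (G y).IsInvertible) {A B : E → E} (hA : ContDiffAt ℝ ∞ A y) (hB : ContDiffAt ℝ ∞ B y) :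
    ContDiffAt ℝ ∞ (flatConn G A B) y := by
  obtain ⟨Ω, hΩ, hΩo, hy⟩ := mem_nhds_iff.1 hG
  have hc : ContDiffAt ℝ ∞ (christoffel G) y :=
    (contDiffOn_christoffel hΩo fun z hz ↦ ContDiffAt.contDiffWithinAt
      (hΩ hz : ContDiffAt ℝ ∞ G z)).contDiffAt (hΩo.mem_nhds hy)
  exact ((hB.fderiv_right (m := ∞) (by simp)).clm_apply hA).add
    ((ContDiffAt.bilin_inverse hG.self_of_nhds h).clm_apply ((hc.clm_apply hA).clm_apply hB))

/-- The covariant curvature tensor of `G`, in terms of the Christoffel symbols. -/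
def flatCurvature (G : E → E →L[ℝ] E →L[ℝ] ℝ) (y a b c d : E) : ℝ :=
  fderiv ℝ (christoffel G) y a b c d - fderiv ℝ (christoffel G) y b a c d
    + christoffel G y b d ((G y).inverse (christoffel G y a c))
    - christoffel G y a d ((G y).inverse (christoffel G y b c))

/-- By metric compatibility the left side is the A-derivative of `G(∇_B C, d)`, with `d` constant,
minus `Γ(A, d, ∇_B C)`. The function `G(∇_B C, d)` is free of the inverse of `G`, so that inverse is
never differentiated; this is why it enters the curvature only quadratically in Γ. -/
theorem bilin_flatConn_flatConn (hsymm : ∀ z v w, G z v w = G z w v) {y : E}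
    (hG : ∀ᶠ z in 𝓝 y, ContDiffAt ℝ ∞ G z) (h : (G y).IsInvertible) {A B C : E → E}
    (hB : ContDiffAt ℝ ∞ B y) (hC : ContDiffAt ℝ ∞ C y) (d : E) :
    G y (flatConn G A (flatConn G B C) y) d =
      G y (fderiv ℝ (fderiv ℝ C) y (A y) (B y)) d + G y (fderiv ℝ C y (fderiv ℝ B y (A y))) d
      + christoffel G y (A y) (fderiv ℝ C y (B y)) d
      + christoffel G y (B y) (fderiv ℝ C y (A y)) d
      + christoffel G y (fderiv ℝ B y (A y)) (C y) d
      + fderiv ℝ (christoffel G) y (A y) (B y) (C y) d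
      - christoffel G y (A y) d ((G y).inverse (christoffel G y (B y) (C y))) := by
  obtain ⟨Ω, hΩ, hΩo, hy⟩ := mem_nhds_iff.1 hG
  have hGy := hG.self_of_nhds
  have hGd : DifferentiableAt ℝ G y := hGy.differentiableAt (by simp)
  have hc : DifferentiableAt ℝ (christoffel G) y :=
    ((contDiffOn_christoffel hΩo fun z hz ↦ ContDiffAt.contDiffWithinAt
      (hΩ hz : ContDiffAt ℝ ∞ G z)).contDiffAt
      (hΩo.mem_nhds hy)).differentiableAt (by simp)
  have hBd : DifferentiableAt ℝ B y := hB.differentiableAt (by simp)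
  have hCd : DifferentiableAt ℝ C y := hC.differentiableAt (by simp)
  have hDC : DifferentiableAt ℝ (fderiv ℝ C) y :=
    (hC.fderiv_right (m := ∞) (by simp)).differentiableAt (by simp)
  have hW : DifferentiableAt ℝ (flatConn G B C) y :=
    (ContDiffAt.flatConn hG h hB hC).differentiableAt (by simp)
  have hDCB : HasFDerivAt (fun z ↦ fderiv ℝ C z (B z))
      ((fderiv ℝ C y).comp (fderiv ℝ B y) + (fderiv ℝ (fderiv ℝ C) y).flip (B y)) y :=
    hDC.hasFDerivAt.clm_apply hBd.hasFDerivAt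
  have e1 := fderiv_bilin_apply hGd hW (differentiableAt_const d) (A y)
  have e2 := fderiv_bilin_apply hGd hDCB.differentiableAt (differentiableAt_const d) (A y)
  have hch := ((hc.hasFDerivAt.clm_apply hBd.hasFDerivAt).clm_apply hCd.hasFDerivAt).clm_apply
    (hasFDerivAt_const d y)
  have e3 : (fun z ↦ G z (flatConn G B C z) d) =ᶠ[𝓝 y]
      fun z ↦ G z (fderiv ℝ C z (B z)) d + christoffel G z (B z) (C z) d := by
    filter_upwards [IsInvertible.eventually hGy.continuousAt h] with z hz
    exact bilin_flatConn hz d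
  rw [e3.fderiv_eq, fderiv_fun_add (hasFDerivAt_bilin_apply hGd hDCB.differentiableAt
    (differentiableAt_const d)).differentiableAt hch.differentiableAt,
    add_apply, e2, hch.fderiv, hDCB.fderiv] at e1
  simp only [fderiv_fun_const, Pi.zero_apply, zero_apply, map_zero,
    add_zero, add_apply, ContinuousLinearMap.comp_apply,
    ContinuousLinearMap.flip_apply, map_add, ContinuousLinearMap.comp_zero, zero_add] at e1
  have e4 := christoffel_add_swap hsymm hGd (A y) d (flatConn G B C y)
  have e5 := christoffel_add_swap hsymm hGd (A y) (fderiv ℝ C y (B y)) d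
  rw [fderiv_bilin_symm hsymm hGd] at e4
  have e6 : christoffel G y (A y) d (flatConn G B C y) =
      christoffel G y (A y) d (fderiv ℝ C y (B y)) +
        christoffel G y (A y) d ((G y).inverse (christoffel G y (B y) (C y))) := by
    rw [flatConn, map_add]
  rw [bilin_flatConn h]
  linarith

/-- The curvature of the Levi-Civita connection of `G` is a tensor. -/
theorem bilin_curvature (hsymm : ∀ z v w, G z v w = G z w v) {y : E}
    (hG : ∀ᶠ z in 𝓝 y, ContDiffAt ℝ ∞ G z) (h : (G y).IsInvertible) {A B C : E → E}
    (hA : ContDiffAt ℝ ∞ A y) (hB : ContDiffAt ℝ ∞ B y) (hC : ContDiffAt ℝ ∞ C y) (d : E) :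
    G y (flatConn G A (flatConn G B C) y - flatConn G B (flatConn G A C) y
      - flatConn G (lieBracket ℝ A B) C y) d = flatCurvature G y (A y) (B y) (C y) d := by
  have hs : fderiv ℝ (fderiv ℝ C) y (A y) (B y) = fderiv ℝ (fderiv ℝ C) y (B y) (A y) :=
    (hC.isSymmSndFDerivAt (by simpa using WithTop.coe_le_coe.2 (le_top : (2 : ℕ∞) ≤ ⊤))).eq _ _
  simp only [map_sub, sub_apply]
  rw [bilin_flatConn_flatConn hsymm hG h hB hC, bilin_flatConn_flatConn hsymm hG h hA hC,
    bilin_flatConn h, flatCurvature, hs]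
  simp only [lieBracket, map_sub, sub_apply]
  ring

end Koszul

/-! ### Rank-one regularisation of a degenerate metric. -/

noncomputable section Adapted

variable {E : Type*} [NormedAddCommGroup E] [NormedSpace ℝ E]

/-- The regularisation `G + θ ⊗ θ` of the field `G` of bilinear forms. -/
def regularization (G : E → E →L[ℝ] E →L[ℝ] ℝ) (θ : E →L[ℝ] ℝ) (y : E) : E →L[ℝ] E →L[ℝ] ℝ :=
  G y + θ.smulRight θ

/-- The vector field dual to `θ` with respect to `G + θ ⊗ θ`; it spans the radical of `G` wherever
`G` is degenerate. -/
def radicalField (G : E → E →L[ℝ] E →L[ℝ] ℝ) (θ : E →L[ℝ] ℝ) (y : E) : E :=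
  (regularization G θ y).inverse θ

/-- A defining function of the set where `G` is degenerate. -/
def definingFun (G : E → E →L[ℝ] E →L[ℝ] ℝ) (θ : E →L[ℝ] ℝ) (y : E) : ℝ :=
  1 - θ (radicalField G θ y)

/-- On the open set `W` the smooth field `G` of symmetric bilinear forms has radical of dimension
at most one, complementary to `ker θ`, and degenerates transversely. -/
structure IsAdapted (G : E → E →L[ℝ] E →L[ℝ] ℝ) (θ : E →L[ℝ] ℝ) (W : Set E) : Prop where
  isOpen : IsOpen W
  smooth : ContDiffOn ℝ ∞ G W
  symm : ∀ y v w, G y v w = G y w v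
  isInvertible : ∀ y ∈ W, (regularization G θ y).IsInvertible
  fderiv_ne_zero : ∀ y ∈ W, fderiv ℝ (definingFun G θ) y ≠ 0

namespace IsAdapted

variable {G : E → E →L[ℝ] E →L[ℝ] ℝ} {θ : E →L[ℝ] ℝ} {W : Set E} {y : E}

theorem regularization_apply (G : E → E →L[ℝ] E →L[ℝ] ℝ) (θ : E →L[ℝ] ℝ) (y v w : E) :
    regularization G θ y v w = G y v w + θ v * θ w := by
  simp [regularization]

theorem theta_radicalField (G : E → E →L[ℝ] E →L[ℝ] ℝ) (θ : E →L[ℝ] ℝ) (y : E) :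
    θ (radicalField G θ y) = 1 - definingFun G θ y := by
  simp [definingFun]

theorem radicalField_ne_zero (hσ : definingFun G θ y = 0) : radicalField G θ y ≠ 0 := by
  intro h0
  have := theta_radicalField G θ y
  rw [h0, hσ] at this
  simp at this

variable (h : IsAdapted G θ W) (hy : y ∈ W)
include h hy

theorem differentiableAt : DifferentiableAt ℝ G y :=
  (h.smooth.contDiffAt (h.isOpen.mem_nhds hy)).differentiableAt (by simp)

theorem regularization_radicalField (w : E) :
    regularization G θ y (radicalField G θ y) w = θ w := by
  rw [radicalField, IsInvertible.apply_inverse_apply (h.isInvertible y hy)]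

/-- Subtract `θ(u) θ = (1 − σ) θ` from `Ĝ(u, ·) = θ`. All later facts about the radical come from
this identity. -/
theorem apply_radicalField (w : E) :
    G y (radicalField G θ y) w = definingFun G θ y * θ w := by
  have := h.regularization_radicalField hy w
  rw [regularization_apply, theta_radicalField] at this
  linarith

/-- On a radical vector the regularisation acts as `θ(v) θ`, and inverting it leaves only multiples
of `u`. So the radical is at most a line. -/
theorem eq_smul_of_forall_eq_zero {v : E} (hv : ∀ w, G y v w = 0) :
    v = θ v • radicalField G θ y := by
  have h1 : regularization G θ y v = θ v • θ := by
    ext w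
    rw [regularization_apply, hv]
    simp
  have := congrArg (regularization G θ y).inverse h1
  rwa [IsInvertible.inverse_apply_apply (h.isInvertible y hy), map_smul] at this

theorem definingFun_eq_zero_of_forall_eq_zero {v : E} (hv : ∀ w, G y v w = 0) (hv0 : v ≠ 0) :
    definingFun G θ y = 0 := by
  have h1 := h.eq_smul_of_forall_eq_zero hy hv
  have h2 := congrArg θ h1
  rw [map_smul, theta_radicalField, smul_eq_mul] at h2
  have h3 : θ v ≠ 0 := fun h0 ↦ hv0 (by rw [h1, h0, zero_smul])
  have : θ v * definingFun G θ y = 0 := by linarith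
  exact (mul_eq_zero.1 this).resolve_left h3

theorem degenerate_iff : (∃ v, (∀ w, G y v w = 0) ∧ v ≠ 0) ↔ definingFun G θ y = 0 := by
  refine ⟨fun ⟨v, hv, hv0⟩ ↦ h.definingFun_eq_zero_of_forall_eq_zero hy hv hv0, fun hσ ↦ ?_⟩
  exact ⟨_, fun w ↦ by rw [h.apply_radicalField hy, hσ, zero_mul], radicalField_ne_zero hσ⟩

/-- Self-adjointness of the inverse: with `Ĝ` the regularisation and `u` the radical field, both
sides equal `Ĝ(u, Ĝ⁻¹ α)`. -/
theorem theta_inverse (α : E →L[ℝ] ℝ) :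
    θ ((regularization G θ y).inverse α) = α (radicalField G θ y) := by
  rw [← h.regularization_radicalField hy, regularization_apply, h.symm, mul_comm,
    ← regularization_apply, IsInvertible.apply_inverse_apply (h.isInvertible y hy)]

variable [FiniteDimensional ℝ E]

theorem isInvertible_bilin (hσ : definingFun G θ y ≠ 0) : (G y).IsInvertible := by
  refine isInvertible_of_forall_eq_zero fun v hv ↦ ?_
  by_contra hv0
  exact hσ (h.definingFun_eq_zero_of_forall_eq_zero hy (fun w ↦ by simp [hv]) hv0)

/-- The Sherman–Morrison formula for `G = Ĝ − θ⊗θ`. It isolates the singularity of the inverse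
metric as a simple pole in the radical direction. -/
theorem inverse_apply (hσ : definingFun G θ y ≠ 0) (α : E →L[ℝ] ℝ) :
    (G y).inverse α = (regularization G θ y).inverse α +
      (α (radicalField G θ y) / definingFun G θ y) • radicalField G θ y := by
  have hi := h.isInvertible_bilin hy hσ
  rw [← IsInvertible.inverse_apply_apply hi ((regularization G θ y).inverse α + _)]
  congr 1
  ext w
  have h1 : regularization G θ y ((regularization G θ y).inverse α) w = α w := by
    rw [IsInvertible.apply_inverse_apply (h.isInvertible y hy)]
  rw [regularization_apply, h.theta_inverse hy] at h1
  rw [map_add, map_smul, add_apply, smul_apply, h.apply_radicalField hy, smul_eq_mul]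
  field_simp
  linarith

theorem contDiffAt_regularization_inverse :
    ContDiffAt ℝ ∞ (fun z ↦ (regularization G θ z).inverse) y := by
  refine ContDiffAt.bilin_inverse ?_ (h.isInvertible y hy)
  exact (h.smooth.contDiffAt (h.isOpen.mem_nhds hy)).add contDiffAt_const

theorem contDiffAt_radicalField : ContDiffAt ℝ ∞ (radicalField G θ) y :=
  (h.contDiffAt_regularization_inverse hy).clm_apply contDiffAt_const

theorem contDiffAt_definingFun : ContDiffAt ℝ ∞ (definingFun G θ) y :=
  contDiffAt_const.sub (θ.contDiff.contDiffAt.comp y (h.contDiffAt_radicalField hy))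

/-- Differentiate `G(u, w) = σ θ(w)` with `w` frozen at the value of `u` at `y`. The derivative of
`u` drops out because `w` is radical, and `θ(w) = 1` there. -/
theorem fderiv_radicalField (hσ : definingFun G θ y = 0) (a : E) :
    fderiv ℝ G y a (radicalField G θ y) (radicalField G θ y) = fderiv ℝ (definingFun G θ) y a := by
  have hu := (h.contDiffAt_radicalField hy).differentiableAt (by simp)
  have hs := (h.contDiffAt_definingFun hy).differentiableAt (by simp)
  have h1 := fderiv_bilin_apply (h.differentiableAt hy) hu
    (differentiableAt_const (radicalField G θ y)) a
  have h2 : (fun z ↦ G z (radicalField G θ z) (radicalField G θ y)) =ᶠ[𝓝 y]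
      fun z ↦ definingFun G θ z * θ (radicalField G θ y) := by
    filter_upwards [h.isOpen.mem_nhds hy] with z hz
    exact h.apply_radicalField hz _
  rw [h2.fderiv_eq, fderiv_mul_const hs, h.symm, h.apply_radicalField hy, hσ,
    theta_radicalField, hσ] at h1
  simpa using h1.symm

theorem fderiv_of_forall_eq_zero (hσ : definingFun G θ y = 0) {r : E} (hr : ∀ w, G y r w = 0)
    (a : E) : fderiv ℝ G y a r r = θ r ^ 2 * fderiv ℝ (definingFun G θ) y a := by
  rw [← h.fderiv_radicalField hy hσ, h.eq_smul_of_forall_eq_zero hy hr]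
  simp only [map_smul, smul_apply, smul_eq_mul, theta_radicalField, hσ]
  ring

theorem christoffel_of_forall_eq_zero (hσ : definingFun G θ y = 0) {r : E}
    (hr : ∀ w, G y r w = 0) (a : E) :
    christoffel G y a r r = θ r ^ 2 * fderiv ℝ (definingFun G θ) y a / 2 := by
  rw [christoffel_apply, fderiv_bilin_symm h.symm (h.differentiableAt hy) r r a,
    h.fderiv_of_forall_eq_zero hy hσ hr]
  ring

/-- The derivative of `⟨R, R⟩` at the points where `R` is in the radical. -/
theorem fderiv_norm_radical (hσ : definingFun G θ y = 0) {R : E → E}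
    (hR : DifferentiableAt ℝ R y) (hr : ∀ w, G y (R y) w = 0) (a : E) :
    fderiv ℝ (fun z ↦ G z (R z) (R z)) y a =
      θ (R y) ^ 2 * fderiv ℝ (definingFun G θ) y a := by
  rw [fderiv_bilin_apply (h.differentiableAt hy) hR hR, h.fderiv_of_forall_eq_zero hy hσ hr, hr,
    h.symm, hr]
  ring

end IsAdapted

end Adapted

/-! ### Main pairs and the smooth extension of the curvature. -/

noncomputable section MainPair

variable {E : Type*} [NormedAddCommGroup E] [NormedSpace ℝ E]

/-- The values `n`, `r` of the main normal and the main radical vector field at a point `y` where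
`G` is degenerate. -/
structure IsMainPairAt (G : E → E →L[ℝ] E →L[ℝ] ℝ) (θ : E →L[ℝ] ℝ) (y n r : E) : Prop where
  orthogonal : ∀ v, fderiv ℝ (definingFun G θ) y v = 0 → G y n v = 0
  unitary : G y n n = 1
  isotropic : christoffel G y n n r = 0
  radical : ∀ w, G y r w = 0
  radical_unitary : christoffel G y r n r = 1

/-- The smooth extension of `⟨R, R⟩ ⟨R(a, b) c, d⟩`, where `⟨R, R⟩ = σ k` for the defining function
`σ`. -/
def upsilonExtension (G : E → E →L[ℝ] E →L[ℝ] ℝ) (θ : E →L[ℝ] ℝ) (k : E → ℝ) (y a b c d : E) : ℝ :=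
  definingFun G θ y * k y * (fderiv ℝ (christoffel G) y a b c d
    - fderiv ℝ (christoffel G) y b a c d
    + christoffel G y b d ((regularization G θ y).inverse (christoffel G y a c))
    - christoffel G y a d ((regularization G θ y).inverse (christoffel G y b c)))
  + k y * (christoffel G y a c (radicalField G θ y) * christoffel G y b d (radicalField G θ y)
    - christoffel G y b c (radicalField G θ y) * christoffel G y a d (radicalField G θ y))

namespace IsAdapted

variable {G : E → E →L[ℝ] E →L[ℝ] ℝ} {θ : E →L[ℝ] ℝ} {W : Set E} {y : E}
  [FiniteDimensional ℝ E] (h : IsAdapted G θ W)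
include h

theorem contDiffOn_definingFun : ContDiffOn ℝ ∞ (definingFun G θ) W :=
  fun _ hy ↦ (h.contDiffAt_definingFun hy).contDiffWithinAt

/-- Hadamard division of `⟨R, R⟩` by σ. The value of the quotient on σ = 0 is read off from `d⟨R, R⟩
= θ(R)² dσ` in a direction where dσ is non-zero. -/
theorem exists_norm_eq_mul {V : Set E} (hV : IsOpen V) {R : E → E} (hR : ContDiffOn ℝ ∞ R V)
    (hr : ∀ z ∈ V ∩ W, definingFun G θ z = 0 → ∀ w, G z (R z) w = 0) (hy : y ∈ V ∩ W) :
    ∃ W' ⊆ V ∩ W, IsOpen W' ∧ y ∈ W' ∧ ∃ k : E → ℝ, ContDiffOn ℝ ∞ k W' ∧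
      (∀ z ∈ W', G z (R z) (R z) = definingFun G θ z * k z) ∧
      ∀ z ∈ W', definingFun G θ z = 0 → k z = θ (R z) ^ 2 := by
  have hR' := hR.mono (inter_subset_left (t := W))
  have hG' := h.smooth.mono (inter_subset_right (s := V))
  have hf : ContDiffOn ℝ ∞ (fun z ↦ G z (R z) (R z)) (V ∩ W) :=
    (hG'.clm_apply hR').clm_apply hR'
  by_cases hσ : definingFun G θ y = 0
  · obtain ⟨W', hW', hW'o, hyW', k, hk, hfk⟩ := exists_eq_mul_of_eq_zero (hV.inter h.isOpen) hf
      (h.contDiffOn_definingFun.mono inter_subset_right) hy (h.fderiv_ne_zero y hy.2)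
      fun z hz hz0 ↦ hr z hz hz0 _
    refine ⟨W', hW', hW'o, hyW', k, hk, hfk, fun z hz hz0 ↦ ?_⟩
    have hzV := hW' hz
    obtain ⟨a, ha⟩ : ∃ a, fderiv ℝ (definingFun G θ) z a ≠ 0 := by
      by_contra! H
      exact h.fderiv_ne_zero z hzV.2 (by ext v; simp [H])
    have h1 := h.fderiv_norm_radical hzV.2 hz0
      ((hR.contDiffAt (hV.mem_nhds hzV.1)).differentiableAt (by simp)) (hr z hzV hz0) a
    have h2 : (fun z ↦ G z (R z) (R z)) =ᶠ[𝓝 z] fun z ↦ definingFun G θ z * k z := by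
      filter_upwards [hW'o.mem_nhds hz] with x hx using hfk x hx
    rw [h2.fderiv_eq, fderiv_fun_mul ((h.contDiffAt_definingFun hzV.2).differentiableAt (by simp))
      ((hk.contDiffAt (hW'o.mem_nhds hz)).differentiableAt (by simp)), hz0] at h1
    simp only [zero_smul, zero_add, smul_apply, smul_eq_mul] at h1
    exact mul_right_cancel₀ ha h1
  · have ho : IsOpen ((V ∩ W) ∩ definingFun G θ ⁻¹' {0}ᶜ) :=
      (h.contDiffOn_definingFun.mono inter_subset_right).continuousOn.isOpen_inter_preimage
        (hV.inter h.isOpen) isOpen_compl_singleton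
    refine ⟨_, inter_subset_left, ho, ⟨hy, hσ⟩, fun z ↦ G z (R z) (R z) / definingFun G θ z, ?_,
      fun z hz ↦ ?_, fun z hz hz0 ↦ absurd hz0 hz.2⟩
    · exact (hf.mono inter_subset_left).div
        ((h.contDiffOn_definingFun.mono inter_subset_right).mono inter_subset_left)
        fun z hz ↦ hz.2
    · have : definingFun G θ z ≠ 0 := hz.2
      field_simp

/-- Substituting `inverse_apply` into the curvature, the factor σ absorbs the simple pole; its
residue is the second summand of the extension. -/
theorem upsilonExtension_of_ne_zero (hy : y ∈ W) (hσ : definingFun G θ y ≠ 0) (k : E → ℝ)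
    (a b c d : E) : upsilonExtension G θ k y a b c d =
      definingFun G θ y * k y * flatCurvature G y a b c d := by
  rw [flatCurvature, h.inverse_apply hy hσ, h.inverse_apply hy hσ, upsilonExtension]
  simp only [map_add, map_smul, smul_eq_mul]
  field_simp
  ring

omit [FiniteDimensional ℝ E] in
theorem upsilonExtension_of_eq_zero (hy : y ∈ W) (hσ : definingFun G θ y = 0) {k : E → ℝ} {r : E}
    (hr : ∀ w, G y r w = 0) (hk : k y = θ r ^ 2)
    (a b c d : E) : upsilonExtension G θ k y a b c d =
      christoffel G y a c r * christoffel G y b d r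
        - christoffel G y b c r * christoffel G y a d r := by
  rw [upsilonExtension, h.eq_smul_of_forall_eq_zero hy hr, hσ, hk]
  simp only [map_smul, smul_eq_mul]
  ring

theorem contDiffAt_upsilonExtension (hy : y ∈ W) {k : E → ℝ} (hk : ContDiffAt ℝ ∞ k y)
    {A B C D : E → E} (hA : ContDiffAt ℝ ∞ A y) (hB : ContDiffAt ℝ ∞ B y)
    (hC : ContDiffAt ℝ ∞ C y) (hD : ContDiffAt ℝ ∞ D y) :
    ContDiffAt ℝ ∞ (fun z ↦ upsilonExtension G θ k z (A z) (B z) (C z) (D z)) y := by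
  have hc : ContDiffAt ℝ ∞ (christoffel G) y :=
    (contDiffOn_christoffel h.isOpen h.smooth).contDiffAt (h.isOpen.mem_nhds hy)
  have hdc : ContDiffAt ℝ ∞ (fderiv ℝ (christoffel G)) y := hc.fderiv_right (m := ∞) (by simp)
  have hσ := h.contDiffAt_definingFun hy
  have hu := h.contDiffAt_radicalField hy
  have hi := h.contDiffAt_regularization_inverse hy
  have hc3 {X Y Z : E → E} (hX : ContDiffAt ℝ ∞ X y) (hY : ContDiffAt ℝ ∞ Y y)
      (hZ : ContDiffAt ℝ ∞ Z y) : ContDiffAt ℝ ∞ (fun z ↦ christoffel G z (X z) (Y z) (Z z)) y :=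
    ((hc.clm_apply hX).clm_apply hY).clm_apply hZ
  have hd4 {X Y : E → E} (hX : ContDiffAt ℝ ∞ X y) (hY : ContDiffAt ℝ ∞ Y y) :
      ContDiffAt ℝ ∞ (fun z ↦ fderiv ℝ (christoffel G) z (X z) (Y z) (C z) (D z)) y :=
    (((hdc.clm_apply hX).clm_apply hY).clm_apply hC).clm_apply hD
  have hq {X Y : E → E} (hX : ContDiffAt ℝ ∞ X y) (hY : ContDiffAt ℝ ∞ Y y) :
      ContDiffAt ℝ ∞ (fun z ↦ (regularization G θ z).inverse (christoffel G z (X z) (Y z))) y :=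
    hi.clm_apply ((hc.clm_apply hX).clm_apply hY)
  exact ((hσ.mul hk).mul ((((hd4 hA hB).sub (hd4 hB hA)).add (hc3 hB hD (hq hA hC))).sub
    (hc3 hA hD (hq hB hC)))).add
    (hk.mul (((hc3 hA hC hu).mul (hc3 hB hD hu)).sub ((hc3 hB hC hu).mul (hc3 hA hD hu))))

omit [FiniteDimensional ℝ E] in
theorem exists_fderiv_ne_zero (hy : y ∈ W) : ∃ a, fderiv ℝ (definingFun G θ) y a ≠ 0 := by
  by_contra! H
  exact h.fderiv_ne_zero y hy (by ext v; simp [H])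

/-- Where `G` is positive semidefinite and degenerate with tangent radical, main pairs exist. -/
theorem exists_isMainPairAt (hy : y ∈ W) (hσ : definingFun G θ y = 0)
    (hpos : ∀ z ∈ W, definingFun G θ z = 0 → ∀ v, 0 ≤ G z v v)
    (ht : ∀ z ∈ W, definingFun G θ z = 0 →
      fderiv ℝ (definingFun G θ) z (radicalField G θ z) = 0) :
    ∃ V ⊆ W, IsOpen V ∧ y ∈ V ∧ ∃ N R : E → E, ContDiffOn ℝ ∞ N V ∧ ContDiffOn ℝ ∞ R V ∧
      ∀ z ∈ V, definingFun G θ z = 0 → IsMainPairAt G θ z (N z) (R z) := by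
  set σ := definingFun G θ with hσdef
  set u := radicalField G θ with hu
  have hdσ : ∀ z ∈ W, ContDiffAt ℝ ∞ (fderiv ℝ σ) z := fun z hz ↦
    (h.contDiffAt_definingFun hz).fderiv_right (m := ∞) (by simp)
  -- The gradient of σ for the regularised metric. Because the radical is tangent, it also
  -- represents dσ with respect to `G` itself on σ = 0.
  let N₀ : E → E := fun z ↦ (regularization G θ z).inverse (fderiv ℝ σ z)
  have hN₀ : ∀ z ∈ W, ContDiffAt ℝ ∞ N₀ z := fun z hz ↦
    (h.contDiffAt_regularization_inverse hz).clm_apply (hdσ z hz)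
  let κ : E → ℝ := fun z ↦ fderiv ℝ σ z (N₀ z)
  have hκ : ∀ z ∈ W, ContDiffAt ℝ ∞ κ z := fun z hz ↦ (hdσ z hz).clm_apply (hN₀ z hz)
  have hGN : ∀ z ∈ W, σ z = 0 → ∀ w, G z (N₀ z) w = fderiv ℝ σ z w := by
    intro z hz hz0 w
    have h1 : regularization G θ z (N₀ z) w = fderiv ℝ σ z w := by
      rw [IsInvertible.apply_inverse_apply (h.isInvertible z hz)]
    rwa [regularization_apply, h.theta_inverse hz, ht z hz hz0, zero_mul, add_zero] at h1
  have hκpos : ∀ z ∈ W, σ z = 0 → 0 < κ z := by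
    intro z hz hz0
    have h0 : 0 ≤ κ z := by
      have := hpos z hz hz0 (N₀ z)
      rwa [hGN z hz hz0] at this
    refine lt_of_le_of_ne h0 fun hκ0 ↦ ?_
    obtain ⟨a, ha⟩ := h.exists_fderiv_ne_zero hz
    -- If `N₀` were isotropic, semidefiniteness would bound this affine function of `t` from below,
    -- although its slope is non-zero; the value of `t` used next makes it equal to −1.
    have h2 (t : ℝ) : 0 ≤ 2 * t * fderiv ℝ σ z a + G z a a := by
      have := hpos z hz hz0 (t • N₀ z + a)
      simp only [map_add, map_smul, add_apply, smul_apply, smul_eq_mul] at this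
      rw [h.symm z a, hGN z hz hz0, hGN z hz hz0] at this
      have hκ0' : fderiv ℝ σ z (N₀ z) = 0 := hκ0.symm
      rw [hκ0'] at this
      linarith
    have h3 := h2 (-(G z a a + 1) / (2 * fderiv ℝ σ z a))
    have h4 : 2 * (-(G z a a + 1) / (2 * fderiv ℝ σ z a)) * fderiv ℝ σ z a = -(G z a a + 1) := by
      rw [← hσdef] at ha
      field_simp
    linarith
  have hVo : IsOpen (W ∩ κ ⁻¹' Ioi 0) :=
    ContinuousOn.isOpen_inter_preimage (fun z hz ↦ (hκ z hz).continuousAt.continuousWithinAt)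
      h.isOpen isOpen_Ioi
  let s : E → ℝ := fun z ↦ √(κ z)
  let N₁ : E → E := fun z ↦ (s z)⁻¹ • N₀ z
  -- Adding `c u` keeps orthogonality and unit length on σ = 0. There it changes `Γ(N₁, N₁, u)` by
  -- `2c Γ(N₁, u, u) = c s`, the quadratic term being zero by tangency; this determines `c`.
  let N : E → E := fun z ↦ N₁ z + (-christoffel G z (N₁ z) (N₁ z) (u z) / s z) • u z
  -- On σ = 0 one has `Γ(u, N, u) = s / 2`, so this scaling makes `Γ(R, N, R) = 1`.
  let R : E → E := fun z ↦ √(2 / s z) • u z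
  have hs : ∀ z ∈ W ∩ κ ⁻¹' Ioi 0, ContDiffAt ℝ ∞ s z := fun z hz ↦
    (hκ z hz.1).sqrt (ne_of_gt hz.2)
  have hspos : ∀ z ∈ W ∩ κ ⁻¹' Ioi 0, 0 < s z := fun z hz ↦ Real.sqrt_pos.2 hz.2
  have hN₁ : ∀ z ∈ W ∩ κ ⁻¹' Ioi 0, ContDiffAt ℝ ∞ N₁ z := fun z hz ↦
    ((hs z hz).inv (hspos z hz).ne').smul (hN₀ z hz.1)
  refine ⟨W ∩ κ ⁻¹' Ioi 0, inter_subset_left, hVo, ⟨hy, hκpos y hy hσ⟩, N, R, ?_, ?_, ?_⟩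
  · intro z hz
    have hc : ContDiffAt ℝ ∞ (christoffel G) z :=
      (contDiffOn_christoffel h.isOpen h.smooth).contDiffAt (h.isOpen.mem_nhds hz.1)
    have huz := h.contDiffAt_radicalField hz.1
    exact ((hN₁ z hz).add ((((((hc.clm_apply (hN₁ z hz)).clm_apply (hN₁ z hz)).clm_apply
      huz).neg).div (hs z hz) (hspos z hz).ne').smul huz)).contDiffWithinAt
  · intro z hz
    exact (((contDiffAt_const.div (hs z hz) (hspos z hz).ne').sqrt
      (div_pos two_pos (hspos z hz)).ne').smul (h.contDiffAt_radicalField hz.1)).contDiffWithinAt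
  · intro z hz hz0
    have hs0 := hspos z hz
    have hG0 : ∀ w, G z (u z) w = 0 := fun w ↦ by
      rw [h.apply_radicalField hz.1, ← hσdef, hz0, zero_mul]
    have hG0' : ∀ w, G z w (u z) = 0 := fun w ↦ by rw [h.symm, hG0]
    have hss : s z * s z = κ z := Real.mul_self_sqrt (le_of_lt hz.2)
    have hN : ∀ w, G z (N z) w = (s z)⁻¹ * fderiv ℝ σ z w := fun w ↦ by
      simp only [N, N₁, map_add, map_smul, add_apply, smul_apply, smul_eq_mul, hG0,
        hGN z hz.1 hz0, mul_zero, add_zero]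
    have hσN₁ : fderiv ℝ σ z (N₁ z) = s z := by
      change fderiv ℝ σ z ((s z)⁻¹ • N₀ z) = s z
      rw [map_smul, smul_eq_mul]
      change (s z)⁻¹ * κ z = s z
      rw [← hss]
      field_simp
    have hσN : fderiv ℝ σ z (N z) = s z := by
      simp only [N, map_add, map_smul, ht z hz.1 hz0, hσN₁, smul_zero, add_zero]
    have hγ : ∀ a, christoffel G z a (u z) (u z) = fderiv ℝ σ z a / 2 := fun a ↦ by
      rw [h.christoffel_of_forall_eq_zero hz.1 hz0 hG0, theta_radicalField, ← hσdef, hz0]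
      ring
    have hsym := christoffel_symm h.symm (h.differentiableAt hz.1)
    refine ⟨fun v hv ↦ by rw [hN, hv, mul_zero], ?_, ?_, fun w ↦ ?_, ?_⟩
    · rw [hN, hσN]
      field_simp
    · simp only [N, R, map_add, map_smul, add_apply, smul_apply, smul_eq_mul]
      rw [hsym (u z) (N₁ z), hγ, hγ, hσN₁, ht z hz.1 hz0]
      field_simp
      ring
    · simp only [R, map_smul, smul_apply, hG0, smul_zero]
    · simp only [R, map_smul, smul_apply, smul_eq_mul]
      rw [hsym (u z) (N z), hγ, hσN, ← mul_assoc, Real.mul_self_sqrt (by positivity)]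
      field_simp

end IsAdapted

end MainPair

/-! ### Pointwise algebra of II in the splitting into normal, radical and screen. -/

noncomputable section MainPairAlgebra

set_option linter.unusedSectionVars false

variable {E : Type*} [NormedAddCommGroup E] [NormedSpace ℝ E]

namespace IsMainPairAt

variable {G : E → E →L[ℝ] E →L[ℝ] ℝ} {θ : E →L[ℝ] ℝ} {W : Set E} {y n r n' r' : E}
  [FiniteDimensional ℝ E] (H : IsMainPairAt G θ y n r) (h : IsAdapted G θ W) (hy : y ∈ W)
  (hσ : definingFun G θ y = 0)
  (ht : fderiv ℝ (definingFun G θ) y (radicalField G θ y) = 0)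
include H h hy hσ

theorem christoffel_radical (a : E) :
    christoffel G y a r r = θ r ^ 2 * fderiv ℝ (definingFun G θ) y a / 2 :=
  h.christoffel_of_forall_eq_zero hy hσ H.radical a

theorem christoffel_normal : christoffel G y n r r = 1 := by
  rw [christoffel_symm h.symm (h.differentiableAt hy), H.radical_unitary]

theorem theta_ne_zero : θ r ≠ 0 := by
  intro h0
  have := H.christoffel_normal h hy hσ
  rw [H.christoffel_radical h hy hσ, h0] at this
  norm_num at this

theorem eq_smul_of_radical {v : E} (hv : ∀ w, G y v w = 0) : v = (θ v / θ r) • r := by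
  have h1 := h.eq_smul_of_forall_eq_zero hy hv
  have h2 := h.eq_smul_of_forall_eq_zero hy H.radical
  have h3 := H.theta_ne_zero h hy hσ
  calc v = θ v • radicalField G θ y := h1
    _ = (θ v / θ r) • θ r • radicalField G θ y := by rw [smul_smul, div_mul_cancel₀ _ h3]
    _ = (θ v / θ r) • r := by rw [← h2]

theorem fderiv_normal_ne_zero : fderiv ℝ (definingFun G θ) y n ≠ 0 := by
  intro h0
  have := H.christoffel_normal h hy hσ
  rw [H.christoffel_radical h hy hσ, h0] at this
  norm_num at this

/-- Removing from `v` the multiple of `n` that has the same value of dσ leaves a vector in ker dσ,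
which is orthogonal to the unit vector `n`. -/
theorem normal_apply (v : E) :
    fderiv ℝ (definingFun G θ) y v = G y v n * fderiv ℝ (definingFun G θ) y n := by
  have hn := H.fderiv_normal_ne_zero h hy hσ
  have h1 := H.orthogonal
    (v - (fderiv ℝ (definingFun G θ) y v / fderiv ℝ (definingFun G θ) y n) • n) (by
      simp only [map_sub, map_smul, smul_eq_mul]
      field_simp
      ring)
  rw [map_sub, map_smul, H.unitary, smul_eq_mul, mul_one, h.symm] at h1
  rw [sub_eq_zero.1 h1]
  field_simp

theorem bilin_normal_eq_zero_iff (v : E) :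
    G y v n = 0 ↔ fderiv ℝ (definingFun G θ) y v = 0 := by
  rw [H.normal_apply h hy hσ v]
  simp [H.fderiv_normal_ne_zero h hy hσ]

theorem bilin_radical (v : E) : G y v r = 0 := by rw [h.symm, H.radical]

include ht

theorem fderiv_radical : fderiv ℝ (definingFun G θ) y r = 0 := by
  rw [h.eq_smul_of_forall_eq_zero hy H.radical, map_smul, ht, smul_zero]

theorem christoffel_radical_radical : christoffel G y r r r = 0 := by
  rw [H.christoffel_radical h hy hσ, H.fderiv_radical h hy hσ ht]
  ring

/-- The screen component of a vector. -/
theorem screen_component (a : E) :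
    fderiv ℝ (definingFun G θ) y (a - G y a n • n - christoffel G y a n r • r) = 0 ∧
    christoffel G y (a - G y a n • n - christoffel G y a n r • r) n r = 0 := by
  constructor
  · simp only [map_sub, map_smul, smul_eq_mul, H.fderiv_radical h hy hσ ht,
      H.normal_apply h hy hσ a]
    ring
  · simp only [map_sub, map_smul, sub_apply, smul_apply, smul_eq_mul, H.isotropic,
      H.radical_unitary]
    ring

/-- In the splitting of `a` and `b`, the form `Γ(·, ·, r)` is a hyperbolic plane on `n`, `r`: both
are isotropic and their product is 1. The screen is orthogonal to `n` by definition and to `r`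
because `Γ(v, r, r)` is proportional to dσ(v). -/
theorem christoffel_eq (a b : E) :
    christoffel G y a b r = G y a n * christoffel G y b n r + christoffel G y a n r * G y b n +
      christoffel G y (a - G y a n • n - christoffel G y a n r • r)
        (b - G y b n • n - christoffel G y b n r • r) r := by
  have hs := christoffel_symm h.symm (h.differentiableAt hy)
  simp only [map_sub, map_smul, sub_apply, smul_apply, smul_eq_mul]
  rw [hs n b, hs r b, hs r n, H.isotropic, H.christoffel_normal h hy hσ,
    H.christoffel_radical_radical h hy hσ ht, H.christoffel_radical h hy hσ a,
    H.christoffel_radical h hy hσ b, H.normal_apply h hy hσ a, H.normal_apply h hy hσ b]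
  have := H.christoffel_normal h hy hσ
  rw [H.christoffel_radical h hy hσ] at this
  linear_combination (christoffel G y b n r * G y a n + christoffel G y a n r * G y b n) * this

/-- If the screen distribution is `II`-flat, the curvature form on a plane is minus the square of
the `(ν, ρ)`-determinant. -/
theorem upsilon_eq_neg_sq
    (hflat : ∀ v w, fderiv ℝ (definingFun G θ) y v = 0 → christoffel G y v n r = 0 →
      fderiv ℝ (definingFun G θ) y w = 0 → christoffel G y w n r = 0 →
      christoffel G y v w r = 0) (a b : E) :
    christoffel G y a a r * christoffel G y b b r - christoffel G y b a r * christoffel G y a b r =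
      -(G y a n * christoffel G y b n r - G y b n * christoffel G y a n r) ^ 2 := by
  have hs (a b : E) := hflat _ _ (H.screen_component h hy hσ ht a).1
    (H.screen_component h hy hσ ht a).2 (H.screen_component h hy hσ ht b).1
    (H.screen_component h hy hσ ht b).2
  rw [H.christoffel_eq h hy hσ ht a a, H.christoffel_eq h hy hσ ht b b,
    H.christoffel_eq h hy hσ ht a b, H.christoffel_eq h hy hσ ht b a, hs, hs, hs, hs]
  ring

/-- The main normal is unique, and the main radical vector is unique up to a factor. -/
theorem unique (H' : IsMainPairAt G θ y n' r') : n' = n ∧ ∃ f : ℝ, r' = f • r := by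
  have hr : r' = (θ r' / θ r) • r :=
    H.eq_smul_of_radical h hy hσ H'.radical
  set f := θ r' / θ r with hf
  refine ⟨?_, f, hr⟩
  have hs := christoffel_symm h.symm (h.differentiableAt hy)
  have hn := H.fderiv_normal_ne_zero h hy hσ
  have hn' := H'.fderiv_normal_ne_zero h hy hσ
  set a := G y n' n with ha
  set b := θ (n' - a • n) / θ r with hb
  -- Both normals represent multiples of dσ, so they are proportional modulo the radical.
  have hrad : ∀ w, G y (n' - a • n) w = 0 := by
    intro w
    have h1 := H.normal_apply h hy hσ w
    have h2 := H'.normal_apply h hy hσ w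
    have h3 := H.normal_apply h hy hσ n'
    rw [← ha] at h3
    have h4 : G y w n' * a = G y w n := by
      apply mul_right_cancel₀ hn
      rw [mul_assoc, ← h3, ← h2, ← h1]
    have h5 : a * a = 1 := by
      have := H'.normal_apply h hy hσ n
      rw [h3, h.symm y n n', ← ha, ← mul_assoc] at this
      exact (mul_right_cancel₀ hn (by rw [one_mul]; exact this)).symm
    rw [map_sub, map_smul, sub_apply, smul_apply, smul_eq_mul, h.symm y n' w, h.symm y n w]
    linear_combination -(G y w n') * h5 + a * h4
  have hdec : n' = a • n + b • r := by
    have h4 : n' - a • n = b • r := H.eq_smul_of_radical h hy hσ hrad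
    rw [← h4]
    abel
  have hiso := H'.isotropic
  have hun := H'.christoffel_normal h hy hσ
  have hunit := H'.unitary
  rw [hr, hdec] at hiso hun
  rw [hdec] at hunit
  simp only [map_add, map_smul, add_apply, smul_apply, smul_eq_mul, H.isotropic,
    H.christoffel_normal h hy hσ, H.christoffel_radical_radical h hy hσ ht, hs r n, H.unitary,
    H.radical, H.bilin_radical h hy hσ] at hiso hun hunit
  ring_nf at hiso hun hunit
  -- For `n' = a n + b r` and `r' = f r` the three normalisations now say `2abf = 0`, `a f² = 1` and
  -- `a² = 1`. The middle one excludes `a = −1`.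
  have hf0 : f ≠ 0 := by rintro h0; simp [h0] at hun
  have ha0 : a ≠ 0 := by rintro h0; simp [h0] at hun
  have hb0 : b = 0 := by
    have : a * f * b = 0 := by linarith
    exact (mul_eq_zero.1 this).resolve_left (mul_ne_zero ha0 hf0)
  have ha1 : a = 1 := by
    have hpos : 0 < a := by
      by_contra! hneg
      nlinarith [sq_nonneg f]
    nlinarith
  rw [hdec, hb0, ha1]
  simp

end IsMainPairAt

end MainPairAlgebra

/-! ### Transversality of the Gram determinant forces a one-dimensional radical. -/

section Determinant

open Matrix

variable {ι : Type*} [Fintype ι] [DecidableEq ι]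

/-- A two-dimensional kernel contains a non-zero vector with vanishing `i`-th coordinate. It is
still annihilated after some row is replaced by the `i`-th basis vector, and the adjugate entry is
the determinant of that matrix. -/
theorem adjugate_eq_zero_of_mulVec_eq_zero {A : Matrix ι ι ℝ} {u v : ι → ℝ} (hu : A *ᵥ u = 0)
    (hv : A *ᵥ v = 0) (huv : ∀ a b : ℝ, a • u + b • v = 0 → a = 0 ∧ b = 0) : A.adjugate = 0 := by
  ext i j
  rw [adjugate_apply, Matrix.zero_apply]
  obtain ⟨a, b, hab, hi⟩ : ∃ a b : ℝ, ¬(a = 0 ∧ b = 0) ∧ a * u i + b * v i = 0 := by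
    by_cases hui : u i = 0
    · exact ⟨1, 0, by simp, by simp [hui]⟩
    · exact ⟨v i, -u i, by simp [hui], by ring⟩
  refine exists_mulVec_eq_zero_iff.1 ⟨a • u + b • v, fun h ↦ hab (huv a b h), ?_⟩
  ext k
  by_cases hk : k = j
  · subst hk
    simp [mulVec, updateRow_self, single_dotProduct, hi]
  · have h1 := congrFun hu k
    have h2 := congrFun hv k
    simp only [mulVec, Pi.zero_apply] at h1 h2 ⊢
    rw [updateRow_ne hk, dotProduct_add, dotProduct_smul, dotProduct_smul, h1, h2]
    simp

variable {E : Type*} [NormedAddCommGroup E] [NormedSpace ℝ E]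

theorem differentiableAt_det {M : E → Matrix ι ι ℝ} {y : E}
    (hM : ∀ i j, DifferentiableAt ℝ (fun z ↦ M z i j) y) :
    DifferentiableAt ℝ (fun z ↦ (M z).det) y := by
  simp only [det_apply']
  refine DifferentiableAt.fun_sum fun σ _ ↦ (differentiableAt_const _).mul ?_
  exact (HasFDerivAt.finsetProd fun i _ ↦ (hM (σ i) i).hasFDerivAt).differentiableAt

/-- The function `det(M) u_i` is the sum over `k` of `adj(M)_{ik} (M u)_k`. Both factors vanish at
`y`, so each product vanishes to second order. -/
theorem fderiv_det_eq_zero {M : E → Matrix ι ι ℝ} {y : E}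
    (hM : ∀ i j, DifferentiableAt ℝ (fun z ↦ M z i j) y) (hadj : (M y).adjugate = 0)
    {u : ι → ℝ} (hu : M y *ᵥ u = 0) (hu0 : u ≠ 0) : fderiv ℝ (fun z ↦ (M z).det) y = 0 := by
  obtain ⟨i, hi⟩ : ∃ i, u i ≠ 0 := by
    by_contra! H
    exact hu0 (funext H)
  have hadjd (k : ι) : DifferentiableAt ℝ (fun z ↦ (M z).adjugate i k) y := by
    simp only [adjugate_apply]
    refine differentiableAt_det fun a b ↦ ?_
    by_cases ha : a = k
    · subst ha
      simp [updateRow_self]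
    · simp only [updateRow_ne ha]
      exact hM a b
  have hud (k : ι) : DifferentiableAt ℝ (fun z ↦ (M z *ᵥ u) k) y := by
    simp only [mulVec, dotProduct]
    exact DifferentiableAt.fun_sum fun j _ ↦ (hM k j).mul_const _
  have key : (fun z ↦ (M z).det * u i) =
      fun z ↦ ∑ k, (M z).adjugate i k * (M z *ᵥ u) k := by
    funext z
    have := congrFun (congrArg (· *ᵥ u) (adjugate_mul (M z))) i
    simp only [← mulVec_mulVec, smul_mulVec, one_mulVec, Pi.smul_apply, smul_eq_mul] at this
    rw [← this]
    rfl
  have h1 : HasFDerivAt (fun z ↦ ∑ k, (M z).adjugate i k * (M z *ᵥ u) k) (0 : E →L[ℝ] ℝ) y := by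
    have : ∀ k ∈ Finset.univ, HasFDerivAt (fun z ↦ (M z).adjugate i k * (M z *ᵥ u) k)
        (0 : E →L[ℝ] ℝ) y := by
      intro k _
      have := (hadjd k).hasFDerivAt.mul (hud k).hasFDerivAt
      simpa [hadj, hu] using! this
    simpa using HasFDerivAt.fun_sum this
  rw [← key] at h1
  have h2 : fderiv ℝ (fun z ↦ (M z).det * u i) y = u i • fderiv ℝ (fun z ↦ (M z).det) y := by
    rw [fderiv_mul_const (differentiableAt_det hM)]
  rw [h1.fderiv] at h2
  exact (smul_eq_zero.1 h2.symm).resolve_left hi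

/-- The Gram determinant of a bilinear form in a basis. -/
noncomputable def gramDet (b : Module.Basis ι ℝ E) (L : E →L[ℝ] E →L[ℝ] ℝ) : ℝ :=
  Matrix.det (Matrix.of fun i j ↦ L (b i) (b j))

omit [DecidableEq ι] in
theorem gram_mulVec (b : Module.Basis ι ℝ E) {L : E →L[ℝ] E →L[ℝ] ℝ}
    (hL : ∀ v w, L v w = L w v) (v : E) :
    (Matrix.of fun i j ↦ L (b i) (b j)) *ᵥ (b.repr v) = fun i ↦ L v (b i) := by
  funext i
  conv_rhs => rw [← b.sum_repr v]
  simp only [mulVec, dotProduct, of_apply, map_sum, map_smul, _root_.sum_apply,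
    _root_.smul_apply, smul_eq_mul]
  exact Finset.sum_congr rfl fun j _ ↦ by rw [hL, mul_comm]

/-- The matrix determinant lemma for `G = (G + θ ⊗ θ) - θ ⊗ θ`. -/
theorem gramDet_eq (b : Module.Basis ι ℝ E) {G : E → E →L[ℝ] E →L[ℝ] ℝ} {θ : E →L[ℝ] ℝ} {y : E}
    (hG : ∀ v w, G y v w = G y w v) (hi : (regularization G θ y).IsInvertible) :
    gramDet b (G y) = gramDet b (regularization G θ y) * definingFun G θ y := by
  set x : ι → ℝ := ⇑(b.repr (radicalField G θ y)) with hx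
  set t : ι → ℝ := fun i ↦ θ (b i) with ht
  have hMx : (Matrix.of fun i j ↦ regularization G θ y (b i) (b j)) *ᵥ x = t := by
    rw [hx, gram_mulVec b (fun v w ↦ by
      rw [IsAdapted.regularization_apply, IsAdapted.regularization_apply, hG, mul_comm (θ v)])]
    funext i
    rw [radicalField, IsInvertible.apply_inverse_apply hi]
  have hfac : (Matrix.of fun i j ↦ G y (b i) (b j)) =
      (Matrix.of fun i j ↦ regularization G θ y (b i) (b j)) *
        (1 + replicateCol Unit (-x) * replicateRow Unit t) := by
    rw [Matrix.mul_add, Matrix.mul_one, ← Matrix.mul_assoc, ← replicateCol_mulVec, mulVec_neg, hMx]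
    ext i j
    simp [ht, IsAdapted.regularization_apply, Matrix.mul_apply]
  rw [gramDet, gramDet, hfac, det_mul, det_one_add_replicateCol_mul_replicateRow, dotProduct_neg,
    definingFun, ← sub_eq_add_neg]
  congr 2
  have := congrArg θ (b.sum_repr (radicalField G θ y))
  rw [map_sum] at this
  rw [← this]
  simp only [dotProduct, ht, hx, map_smul, smul_eq_mul]
  exact Finset.sum_congr rfl fun i _ ↦ mul_comm _ _

/-- Near a point where `G` is degenerate and its Gram determinant has non-zero differential, `G` is
adapted to some covector. -/
theorem exists_isAdapted [FiniteDimensional ℝ E] (b : Module.Basis ι ℝ E)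
    {G : E → E →L[ℝ] E →L[ℝ] ℝ} (hsymm : ∀ y v w, G y v w = G y w v) {Ω : Set E} (hΩ : IsOpen Ω)
    (hG : ContDiffOn ℝ ∞ G Ω) {p : E} (hp : p ∈ Ω) {u₀ : E} (hu₀ : ∀ w, G p u₀ w = 0)
    (hu₀' : u₀ ≠ 0) (hd : fderiv ℝ (fun y ↦ gramDet b (G y)) p ≠ 0) :
    ∃ θ : E →L[ℝ] ℝ, ∃ W ⊆ Ω, p ∈ W ∧ IsAdapted G θ W := by
  have hGp : ContDiffAt ℝ ∞ G p := hG.contDiffAt (hΩ.mem_nhds hp)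
  have hentry (L : E → E →L[ℝ] E →L[ℝ] ℝ) (hL : ContDiffAt ℝ ∞ L p) (i j : ι) :
      DifferentiableAt ℝ (fun z ↦ (Matrix.of fun i j ↦ L z (b i) (b j)) i j) p :=
    ((hL.clm_apply contDiffAt_const).clm_apply contDiffAt_const).differentiableAt (by simp)
  have hvec (v : E) (hv : ∀ w, G p v w = 0) :
      (Matrix.of fun i j ↦ G p (b i) (b j)) *ᵥ (b.repr v) = 0 := by
    rw [gram_mulVec b (hsymm p)]
    funext i
    exact hv _
  -- A second independent radical vector would kill the adjugate, hence the differential of the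
  -- determinant.
  have hker (v : E) (hv : ∀ w, G p v w = 0) : ∃ c : ℝ, v = c • u₀ := by
    by_contra! H
    refine hd (fderiv_det_eq_zero (hentry G hGp) (adjugate_eq_zero_of_mulVec_eq_zero
      (hvec u₀ hu₀) (hvec v hv) fun a c hac ↦ ?_) (hvec u₀ hu₀) ?_)
    · have h1 : a • u₀ + c • v = 0 := by
        apply b.repr.injective
        ext i
        simpa using congrFun hac i
      have hc : c = 0 := by
        by_contra hc
        refine H (-(c⁻¹ * a)) ?_
        have h2 : v = c⁻¹ • (c • v) := by rw [smul_smul, inv_mul_cancel₀ hc, one_smul]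
        rw [h2, eq_neg_of_add_eq_zero_right h1, smul_neg, smul_smul, neg_smul]
      refine ⟨?_, hc⟩
      rw [hc, zero_smul, add_zero] at h1
      exact (smul_eq_zero.1 h1).resolve_right hu₀'
    · intro h0
      apply hu₀'
      apply b.repr.injective
      ext i
      simpa using congrFun h0 i
  obtain ⟨θ₀, hθ₀⟩ : ∃ θ₀ : E →L[ℝ] ℝ, θ₀ u₀ ≠ 0 := by
    obtain ⟨f, -, hf⟩ := exists_dual_vector ℝ u₀ (norm_ne_zero_iff.2 hu₀')
    exact ⟨f, by rw [hf]; simpa using hu₀'⟩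
  set θ : E →L[ℝ] ℝ := (θ₀ u₀)⁻¹ • θ₀ with hθ
  have hθu : θ u₀ = 1 := by simp [hθ, hθ₀]
  have hinv : (regularization G θ p).IsInvertible := by
    refine isInvertible_of_forall_eq_zero fun v hv ↦ ?_
    have h1 := DFunLike.congr_fun hv u₀
    rw [IsAdapted.regularization_apply, hsymm, hu₀, hθu] at h1
    have h2 : θ v = 0 := by simpa using h1
    obtain ⟨c, rfl⟩ := hker v fun w ↦ by
      have h3 := DFunLike.congr_fun hv w
      rw [IsAdapted.regularization_apply, h2] at h3
      simpa using h3
    rw [map_smul, hθu] at h2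
    simp only [smul_eq_mul, mul_one] at h2
    rw [h2, zero_smul]
  have hreg : ∀ y ∈ Ω, ContDiffAt ℝ ∞ (regularization G θ) y := fun y hy ↦
    (hG.contDiffAt (hΩ.mem_nhds hy)).add contDiffAt_const
  have hσ : ∀ y ∈ Ω, (regularization G θ y).IsInvertible →
      ContDiffAt ℝ ∞ (definingFun G θ) y := fun y hy hi ↦
    contDiffAt_const.sub (θ.contDiff.contDiffAt.comp y
      ((ContDiffAt.bilin_inverse (hreg y hy) hi).clm_apply contDiffAt_const))
  have hev := IsInvertible.eventually (hreg p hp).continuousAt hinv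
  have hσp : definingFun G θ p = 0 := by
    have hu : radicalField G θ p = u₀ := by
      have : regularization G θ p u₀ = θ := by
        ext w
        rw [IsAdapted.regularization_apply, hu₀, hθu, zero_add, one_mul]
      have h2 := IsInvertible.inverse_apply_apply hinv u₀
      rwa [this] at h2
    rw [definingFun, hu, hθu, sub_self]
  -- As the Gram determinant is σ times that of the regularisation and σ vanishes at `p`, its
  -- differential there is a multiple of dσ.
  have hdσ : fderiv ℝ (definingFun G θ) p ≠ 0 := by
    intro h0
    apply hd
    have h1 : (fun y ↦ gramDet b (G y)) =ᶠ[𝓝 p]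
        fun y ↦ gramDet b (regularization G θ y) * definingFun G θ y := by
      filter_upwards [hev] with y hy using gramDet_eq b (hsymm y) hy
    have h2 : DifferentiableAt ℝ (fun y ↦ gramDet b (regularization G θ y)) p :=
      differentiableAt_det (hentry _ (hreg p hp))
    rw [h1.fderiv_eq, fderiv_fun_mul h2
      ((hσ p hp hinv).differentiableAt (by simp)), h0, hσp]
    simp
  have hev2 : ∀ᶠ y in 𝓝 p, fderiv ℝ (definingFun G θ) y ≠ 0 :=
    ((hσ p hp hinv).fderiv_right (m := ∞) (by simp)).continuousAt.eventually_ne hdσ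
  obtain ⟨W, hW, hWo, hpW⟩ := mem_nhds_iff.1 ((hev.and hev2).and (hΩ.mem_nhds hp))
  exact ⟨θ, W, fun y hy ↦ (hW hy).2, hpW, hWo, hG.mono fun y hy ↦ (hW hy).2, hsymm,
    fun y hy ↦ (hW hy).1.1, fun y hy ↦ (hW hy).1.2⟩

end Determinant

/-! ### Vector fields, brackets and derivatives in a chart. -/

noncomputable section Coordinates

set_option linter.unusedSectionVars false

variable {m : ℕ} {M : Type*} [TopologicalSpace M]
  [ChartedSpace (EuclideanSpace ℝ (Fin m)) M] [IsManifold (𝓡 m) ∞ M]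

/-- The coordinate frame: the derivative of the inverse of the chart `e`. -/
def chartFrame (e : OpenPartialHomeomorph M (EuclideanSpace ℝ (Fin m)))
    (y : EuclideanSpace ℝ (Fin m)) : EuclideanSpace ℝ (Fin m) →L[ℝ] EuclideanSpace ℝ (Fin m) :=
  mfderiv (𝓡 m) (𝓡 m) e.symm y

/-- The vector of the coordinates of a tangent vector. -/
def chartCoords (e : OpenPartialHomeomorph M (EuclideanSpace ℝ (Fin m))) (q : M) :
    EuclideanSpace ℝ (Fin m) →L[ℝ] EuclideanSpace ℝ (Fin m) :=
  mfderiv (𝓡 m) (𝓡 m) e q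

/-- The coordinate expression of a vector field. -/
def coordField (e : OpenPartialHomeomorph M (EuclideanSpace ℝ (Fin m)))
    (A : (p : M) → TangentSpace (𝓡 m) p) (y : EuclideanSpace ℝ (Fin m)) :
    EuclideanSpace ℝ (Fin m) :=
  mpullback (𝓡 m) (𝓡 m) e.symm A y

/-- The vector field with a given coordinate expression. -/
def liftField (e : OpenPartialHomeomorph M (EuclideanSpace ℝ (Fin m)))
    (V : EuclideanSpace ℝ (Fin m) → EuclideanSpace ℝ (Fin m)) (q : M) : TangentSpace (𝓡 m) q :=
  mpullback (𝓡 m) (𝓡 m) e V q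

/-- The coordinate expression of a field of bilinear forms. -/
def SymmTensorField.coordForm (g : SymmTensorField m M)
    (e : OpenPartialHomeomorph M (EuclideanSpace ℝ (Fin m))) (y : EuclideanSpace ℝ (Fin m)) :
    EuclideanSpace ℝ (Fin m) →L[ℝ] EuclideanSpace ℝ (Fin m) →L[ℝ] ℝ :=
  ContinuousLinearMap.bilinearComp (E := EuclideanSpace ℝ (Fin m))
    (F := EuclideanSpace ℝ (Fin m)) (g.form (e.symm y)) (chartFrame e y) (chartFrame e y)

variable {g : SymmTensorField m M} {e : OpenPartialHomeomorph M (EuclideanSpace ℝ (Fin m))}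

theorem SymmTensorField.coordForm_apply (y v w : EuclideanSpace ℝ (Fin m)) :
    g.coordForm e y v w = g.form (e.symm y) (chartFrame e y v) (chartFrame e y w) :=
  rfl

theorem SymmTensorField.coordForm_symm (y v w : EuclideanSpace ℝ (Fin m)) :
    g.coordForm e y v w = g.coordForm e y w v :=
  g.symm _ _ _

theorem SymmTensorField.coordDet_eq (y : EuclideanSpace ℝ (Fin m)) :
    g.coordDet e y = gramDet (EuclideanSpace.basisFun (Fin m) ℝ).toBasis (g.coordForm e y) := by
  simp only [SymmTensorField.coordDet, gramDet, SymmTensorField.coordForm_apply, chartFrame,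
    OrthonormalBasis.coe_toBasis, EuclideanSpace.basisFun_apply]
  rfl

section Chart

variable (he : e ∈ IsManifold.maximalAtlas (𝓡 m) ∞ M) {q : M} (hq : q ∈ e.source)
include he

theorem mdifferentiable_of_mem_maximalAtlas : e.MDifferentiable (𝓡 m) (𝓡 m) :=
  ⟨(contMDiffOn_of_mem_maximalAtlas he).mdifferentiableOn (by simp),
    (contMDiffOn_symm_of_mem_maximalAtlas he).mdifferentiableOn (by simp)⟩

include hq

theorem chartFrame_chartCoords (v : EuclideanSpace ℝ (Fin m)) :
    chartFrame e (e q) (chartCoords e q v) = v :=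
  DFunLike.congr_fun ((mdifferentiable_of_mem_maximalAtlas he).symm_comp_deriv hq) v

theorem chartCoords_chartFrame (v : EuclideanSpace ℝ (Fin m)) :
    chartCoords e q (chartFrame e (e q) v) = v := by
  have := DFunLike.congr_fun
    ((mdifferentiable_of_mem_maximalAtlas he).comp_symm_deriv (e.map_source hq)) v
  rw [e.left_inv hq] at this
  exact this

theorem isInvertible_mfderiv_chart : (mfderiv (𝓡 m) (𝓡 m) e q).IsInvertible :=
  ⟨(mdifferentiable_of_mem_maximalAtlas he).mfderiv hq, rfl⟩

theorem isInvertible_mfderiv_chart_symm :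
    (mfderiv (𝓡 m) (𝓡 m) e.symm (e q)).IsInvertible :=
  ⟨(mdifferentiable_of_mem_maximalAtlas he).symm.mfderiv (e.map_source hq), rfl⟩

theorem coordField_apply (A : (p : M) → TangentSpace (𝓡 m) p) :
    coordField e A (e q) = chartCoords e q (A q) := by
  obtain ⟨f, hf⟩ := isInvertible_mfderiv_chart_symm he hq
  have h1 : coordField e A (e q) = f.symm (A (e.symm (e q))) := by
    simp only [coordField, mpullback_apply]
    rw [← hf, ContinuousLinearMap.inverse_equiv]
    rfl
  rw [h1]
  apply f.injective
  rw [f.apply_symm_apply, e.left_inv hq]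
  have h2 : mfderiv (𝓡 m) (𝓡 m) e.symm (e q) (chartCoords e q (A q)) = A q :=
    chartFrame_chartCoords he hq (A q)
  rw [← hf] at h2
  exact h2.symm

theorem chartFrame_coordField (A : (p : M) → TangentSpace (𝓡 m) p) :
    chartFrame e (e q) (coordField e A (e q)) = A q := by
  rw [coordField_apply he hq]
  exact chartFrame_chartCoords he hq (A q)

theorem liftField_apply (V : EuclideanSpace ℝ (Fin m) → EuclideanSpace ℝ (Fin m)) :
    liftField e V q = chartFrame e (e q) (V (e q)) := by
  obtain ⟨f, hf⟩ := isInvertible_mfderiv_chart he hq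
  have h1 (W : (x : EuclideanSpace ℝ (Fin m)) → TangentSpace (𝓡 m) x) :
      mpullback (𝓡 m) (𝓡 m) e W q = f.symm (W (e q)) := by
    simp only [mpullback_apply]
    rw [← hf, ContinuousLinearMap.inverse_equiv]
    rfl
  have h2 : mfderiv (𝓡 m) (𝓡 m) e q (chartFrame e (e q) (V (e q))) = V (e q) :=
    chartCoords_chartFrame he hq (V (e q))
  rw [← hf] at h2
  exact (h1 V).trans ((f.symm_apply_eq).2 h2.symm)

theorem coordField_liftField (V : EuclideanSpace ℝ (Fin m) → EuclideanSpace ℝ (Fin m)) :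
    coordField e (liftField e V) (e q) = V (e q) := by
  rw [coordField_apply he hq, liftField_apply he hq, chartCoords_chartFrame he hq]

theorem SymmTensorField.pair_eq (A B : (p : M) → TangentSpace (𝓡 m) p) :
    g.pair A B q = g.coordForm e (e q) (coordField e A (e q)) (coordField e B (e q)) := by
  rw [coordForm_apply, chartFrame_coordField he hq, chartFrame_coordField he hq, pair,
    e.left_inv hq]

theorem SmoothFieldAt.contDiffAt {A : (p : M) → TangentSpace (𝓡 m) p} (hA : SmoothFieldAt A q) :
    ContDiffAt ℝ ∞ (coordField e A) (e q) := by
  refine (contMDiffAt_vectorSpace_iff_contDiffAt (V := coordField e A)).1 ?_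
  rw [SmoothFieldAt, ← e.left_inv hq] at hA
  exact ContMDiffAt.mpullback_vectorField_preimage (n := ∞) hA
    (contMDiffAt_symm_of_mem_maximalAtlas he (e.map_source hq))
    (isInvertible_mfderiv_chart_symm he hq) (by simp)

theorem smoothFieldAt_liftField {V : EuclideanSpace ℝ (Fin m) → EuclideanSpace ℝ (Fin m)}
    (hV : ContDiffAt ℝ ∞ V (e q)) : SmoothFieldAt (liftField e V) q := by
  exact ContMDiffAt.mpullback_vectorField_preimage (n := ∞)
    ((contMDiffAt_vectorSpace_iff_contDiffAt (V := V)).2 hV)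
    (contMDiffAt_of_mem_maximalAtlas he hq)
    (isInvertible_mfderiv_chart he hq) (by simp)

theorem coordField_mlieBracket {A B : (p : M) → TangentSpace (𝓡 m) p} (hA : SmoothFieldAt A q)
    (hB : SmoothFieldAt B q) : coordField e (mlieBracket (𝓡 m) A B) (e q) =
      lieBracket ℝ (coordField e A) (coordField e B) (e q) := by
  have h (V W : (x : EuclideanSpace ℝ (Fin m)) → TangentSpace (𝓡 m) x) :
      mlieBracket (𝓡 m) V W (e q) = lieBracket ℝ V W (e q) := by
    rw [← mlieBracketWithin_univ, mlieBracketWithin_eq_lieBracketWithin]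
    exact congrFun (lieBracketWithin_univ (𝕜 := ℝ) (V := V) (W := W)) (e q)
  have h2 : (2 : WithTop ℕ∞) ≤ ∞ := WithTop.coe_le_coe.2 (le_top : (2 : ℕ∞) ≤ ⊤)
  have : IsManifold (𝓡 m) (minSmoothness ℝ 2) M :=
    IsManifold.of_le (n := ∞) (by simpa using h2)
  rw [SmoothFieldAt, ← e.left_inv hq] at hA hB
  refine Eq.trans ?_ (h (coordField e A) (coordField e B))
  exact mpullback_mlieBracket (n := ∞) (hA.mdifferentiableAt (by simp))
    (hB.mdifferentiableAt (by simp)) (contMDiffAt_symm_of_mem_maximalAtlas he (e.map_source hq))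
    (by simpa using h2)

theorem mvfderiv_eq {f : M → ℝ} (hf : MDifferentiableAt (𝓡 m) 𝓘(ℝ) f q)
    (v : TangentSpace (𝓡 m) q) :
    mvfderiv (𝓡 m) f q v = fderiv ℝ (f ∘ e.symm) (e q) (chartCoords e q v) := by
  have hd := mdifferentiable_of_mem_maximalAtlas he
  have hfs : MDifferentiableAt (𝓡 m) 𝓘(ℝ) (f ∘ e.symm) (e q) := by
    rw [← e.left_inv hq] at hf
    exact hf.comp (e q) (hd.mdifferentiableAt_symm (e.map_source hq))
  have h1 : f =ᶠ[𝓝 q] (f ∘ e.symm) ∘ e := by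
    filter_upwards [e.open_source.mem_nhds hq] with x hx
    simp [e.left_inv hx]
  have h2 : mfderiv (𝓡 m) 𝓘(ℝ) f q =
      (mfderiv (𝓡 m) 𝓘(ℝ) (f ∘ e.symm) (e q)).comp (mfderiv (𝓡 m) (𝓡 m) e q) := by
    rw [h1.mfderiv_eq]
    exact mfderiv_comp q hfs (hd.mdifferentiableAt hq)
  have h3 : mvfderiv (𝓡 m) f q v = mfderiv (𝓡 m) 𝓘(ℝ) f q v := rfl
  rw [h3, h2, mfderiv_eq_fderiv]
  rfl

end Chart

end Coordinates

/-! ### Dual connection, Levi-Civita connection and curvature in a chart. -/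

noncomputable section Transfer

variable {m : ℕ} {M : Type*} [TopologicalSpace M]
  [ChartedSpace (EuclideanSpace ℝ (Fin m)) M] [IsManifold (𝓡 m) ∞ M]

variable {g : SymmTensorField m M} {e : OpenPartialHomeomorph M (EuclideanSpace ℝ (Fin m))}

theorem SmoothFieldOn.smoothFieldAt {A : (p : M) → TangentSpace (𝓡 m) p} {U : Set M}
    (hA : SmoothFieldOn A U) (hU : IsOpen U) {q : M} (hq : q ∈ U) : SmoothFieldAt A q :=
  ContMDiffOn.contMDiffAt hA (hU.mem_nhds hq)

theorem SymmTensorField.contMDiffAt_pair (g : SymmTensorField m M) {q : M}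
    {A B : (p : M) → TangentSpace (𝓡 m) p}
    (hA : SmoothFieldAt A q) (hB : SmoothFieldAt B q) :
    ContMDiffAt (𝓡 m) 𝓘(ℝ) ∞ (g.pair A B) q := by
  have := ContMDiffAt.clm_bundle_apply₂ (F₁ := EuclideanSpace ℝ (Fin m))
    (E₁ := fun p : M ↦ TangentSpace (𝓡 m) p) (F₂ := EuclideanSpace ℝ (Fin m))
    (E₂ := fun p : M ↦ TangentSpace (𝓡 m) p) (F₃ := ℝ) (E₃ := fun _ : M ↦ ℝ)
    (b := fun p : M ↦ p) (ψ := g.form) (v := A) (w := B) (g.contMDiff q) hA hB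
  rw [contMDiffAt_totalSpace] at this
  exact this.2

section Chart

variable (he : e ∈ IsManifold.maximalAtlas (𝓡 m) ∞ M) {q : M} (hq : q ∈ e.source)
include he

theorem SymmTensorField.contDiffOn_coordForm : ContDiffOn ℝ ∞ (g.coordForm e) e.target := by
  rw [contDiffOn_clm_apply]
  intro v
  rw [contDiffOn_clm_apply]
  intro w y hy
  have hq := e.map_target hy
  have hc (v : EuclideanSpace ℝ (Fin m)) : SmoothFieldAt (liftField e fun _ ↦ v) (e.symm y) :=
    smoothFieldAt_liftField he hq contDiffAt_const
  have h1 := (g.contMDiffAt_pair (hc v) (hc w)).comp y (contMDiffAt_symm_of_mem_maximalAtlas he hy)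
  have h2 : (fun z ↦ g.coordForm e z v w) =ᶠ[𝓝 y]
      (g.pair (liftField e fun _ ↦ v) (liftField e fun _ ↦ w)) ∘ e.symm := by
    filter_upwards [e.open_target.mem_nhds hy] with z hz
    have hz' := e.map_target hz
    rw [Function.comp_apply, g.pair_eq he hz', coordField_liftField he hz',
      coordField_liftField he hz', e.right_inv hz]
  exact (contMDiffAt_iff_contDiffAt.1 h1 |>.congr_of_eventuallyEq h2).contDiffWithinAt

include hq

theorem SymmTensorField.eventually_contDiffAt_coordForm :
    ∀ᶠ y in 𝓝 (e q), ContDiffAt ℝ ∞ (g.coordForm e) y := by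
  filter_upwards [e.open_target.mem_nhds (e.map_source hq)] with y hy
  exact (contDiffOn_coordForm he).contDiffAt (e.open_target.mem_nhds hy)

theorem SymmTensorField.differentiableAt_coordForm :
    DifferentiableAt ℝ (g.coordForm e) (e q) :=
  (eventually_contDiffAt_coordForm he hq).self_of_nhds.differentiableAt (by simp)

theorem SymmTensorField.mvfderiv_pair {A B C : (p : M) → TangentSpace (𝓡 m) p}
    (hA : SmoothFieldAt A q) (hB : SmoothFieldAt B q) :
    mvfderiv (𝓡 m) (g.pair A B) q (C q) =
      fderiv ℝ (fun y ↦ g.coordForm e y (coordField e A y) (coordField e B y)) (e q)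
        (coordField e C (e q)) := by
  rw [mvfderiv_eq he hq ((g.contMDiffAt_pair hA hB).mdifferentiableAt (by simp)),
    coordField_apply he hq C]
  congr 1
  apply Filter.EventuallyEq.fderiv_eq
  filter_upwards [e.open_target.mem_nhds (e.map_source hq)] with y hy
  rw [Function.comp_apply, g.pair_eq he (e.map_target hy), e.right_inv hy]

/-- The dual connection in coordinates. -/
theorem SymmTensorField.dualConn_eq {A B C : (p : M) → TangentSpace (𝓡 m) p}
    (hA : SmoothFieldAt A q) (hB : SmoothFieldAt B q) (hC : SmoothFieldAt C q) :
    g.dualConn A B C q =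
      g.coordForm e (e q) (fderiv ℝ (coordField e B) (e q) (coordField e A (e q)))
        (coordField e C (e q)) +
      christoffel (g.coordForm e) (e q) (coordField e A (e q)) (coordField e B (e q))
        (coordField e C (e q)) := by
  have hd {X : (p : M) → TangentSpace (𝓡 m) p} (hX : SmoothFieldAt X q) :
      DifferentiableAt ℝ (coordField e X) (e q) :=
    (SmoothFieldAt.contDiffAt he hq hX).differentiableAt (by simp)
  rw [← koszul_eq coordForm_symm (differentiableAt_coordForm he hq) (hd hA) (hd hB) (hd hC),
    dualConn, mvfderiv_pair he hq hB hC, mvfderiv_pair he hq hC hA, mvfderiv_pair he hq hA hB,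
    g.pair_eq he hq, g.pair_eq he hq, g.pair_eq he hq, coordField_mlieBracket he hq hA hB,
    coordField_mlieBracket he hq hB hC, coordField_mlieBracket he hq hC hA]

/-- The coordinate connection satisfies the defining property of the chosen vector. Testing against
fields with constant coordinates and using non-degeneracy shows that no other vector does. -/
theorem SymmTensorField.leviCivita_eq (hinv : (g.coordForm e (e q)).IsInvertible)
    {A B : (p : M) → TangentSpace (𝓡 m) p} (hA : SmoothFieldAt A q) (hB : SmoothFieldAt B q) :
    g.leviCivita A B q =
      liftField e (flatConn (g.coordForm e) (coordField e A) (coordField e B)) q := by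
  have hex : ∃ v : TangentSpace (𝓡 m) q, ∀ C : (q : M) → TangentSpace (𝓡 m) q,
      SmoothFieldAt C q → g.form q v (C q) = g.dualConn A B C q := by
    refine ⟨liftField e (flatConn (g.coordForm e) (coordField e A) (coordField e B)) q,
      fun C hC ↦ ?_⟩
    rw [dualConn_eq he hq hA hB hC, ← bilin_flatConn hinv]
    change g.pair (liftField e (flatConn (g.coordForm e) (coordField e A) (coordField e B))) C q = _
    rw [g.pair_eq he hq, coordField_liftField he hq]
  have h1 := Classical.epsilon_spec hex
  have h2 (c : EuclideanSpace ℝ (Fin m)) :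
      g.coordForm e (e q) (coordField e (g.leviCivita A B) (e q)) c =
        g.coordForm e (e q)
          (flatConn (g.coordForm e) (coordField e A) (coordField e B) (e q)) c := by
    have hC : SmoothFieldAt (liftField e fun _ ↦ c) q :=
      smoothFieldAt_liftField he hq contDiffAt_const
    have h3 := h1 _ hC
    rw [dualConn_eq he hq hA hB hC, ← bilin_flatConn hinv, coordField_liftField he hq] at h3
    rw [← h3]
    change _ = g.pair (g.leviCivita A B) (liftField e fun _ ↦ c) q
    rw [g.pair_eq he hq, coordField_liftField he hq]
  have h4 : coordField e (g.leviCivita A B) (e q) =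
      flatConn (g.coordForm e) (coordField e A) (coordField e B) (e q) := by
    rw [← IsInvertible.inverse_apply_apply hinv (coordField e (g.leviCivita A B) (e q)),
      ← IsInvertible.inverse_apply_apply hinv (flatConn _ _ _ _)]
    congr 1
    ext c
    exact h2 c
  rw [liftField_apply he hq, ← h4]
  exact (chartFrame_coordField he hq _).symm

/-- Second covariant derivatives differentiate a first one, so agreement with the coordinate
connection is needed on a neighbourhood and not only at `q`. -/
theorem SymmTensorField.smoothFieldAt_leviCivita (hinv : (g.coordForm e (e q)).IsInvertible)
    {A B : (p : M) → TangentSpace (𝓡 m) p} (hA : ∀ᶠ x in 𝓝 q, SmoothFieldAt A x)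
    (hB : ∀ᶠ x in 𝓝 q, SmoothFieldAt B x) :
    (∀ᶠ y in 𝓝 (e q), coordField e (g.leviCivita A B) y =
      flatConn (g.coordForm e) (coordField e A) (coordField e B) y) ∧
    SmoothFieldAt (g.leviCivita A B) q := by
  have hcont : Tendsto e (𝓝 q) (𝓝 (e q)) := e.continuousAt hq
  have hev : ∀ᶠ x in 𝓝 q, x ∈ e.source ∧ g.leviCivita A B x =
      liftField e (flatConn (g.coordForm e) (coordField e A) (coordField e B)) x := by
    have h1 := hcont.eventually (IsInvertible.eventually
      (differentiableAt_coordForm he hq).continuousAt hinv)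
    filter_upwards [hA, hB, h1, e.open_source.mem_nhds hq] with x hxA hxB hx hxs
    exact ⟨hxs, leviCivita_eq he hxs hx hxA hxB⟩
  constructor
  · have hs : Tendsto e.symm (𝓝 (e q)) (𝓝 q) := by
      have := e.symm.continuousAt (e.map_source hq)
      rwa [ContinuousAt, e.left_inv hq] at this
    filter_upwards [hs.eventually hev, e.open_target.mem_nhds (e.map_source hq)] with y hy hyt
    have h2 := coordField_apply he hy.1 (g.leviCivita A B)
    have h3 := coordField_liftField he hy.1
      (flatConn (g.coordForm e) (coordField e A) (coordField e B))
    rw [coordField_apply he hy.1, ← hy.2, ← h2, e.right_inv hyt] at h3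
    exact h3
  · have h5 : SmoothFieldAt
        (liftField e (flatConn (g.coordForm e) (coordField e A) (coordField e B))) q :=
      smoothFieldAt_liftField he hq (ContDiffAt.flatConn (eventually_contDiffAt_coordForm he hq)
        hinv (SmoothFieldAt.contDiffAt he hq hA.self_of_nhds)
        (SmoothFieldAt.contDiffAt he hq hB.self_of_nhds))
    refine ContMDiffAt.congr_of_eventuallyEq h5 ?_
    filter_upwards [hev] with x hx
    rw [hx.2]

theorem coordField_sub (A B : (p : M) → TangentSpace (𝓡 m) p) :
    coordField e (fun x ↦ A x - B x) (e q) = coordField e A (e q) - coordField e B (e q) := by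
  simp only [coordField_apply he hq]
  exact map_sub (chartCoords e q) _ _

theorem coordField_smul (f : M → ℝ) (A : (p : M) → TangentSpace (𝓡 m) p) :
    coordField e (fun x ↦ f x • A x) (e q) = f q • coordField e A (e q) := by
  simp only [coordField_apply he hq]
  exact map_smul (chartCoords e q) _ _

theorem smoothFieldAt_mlieBracket {A B : (p : M) → TangentSpace (𝓡 m) p}
    (hA : ∀ᶠ x in 𝓝 q, SmoothFieldAt A x) (hB : ∀ᶠ x in 𝓝 q, SmoothFieldAt B x) :
    SmoothFieldAt (mlieBracket (𝓡 m) A B) q := by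
  have hA' := SmoothFieldAt.contDiffAt he hq hA.self_of_nhds
  have hB' := SmoothFieldAt.contDiffAt he hq hB.self_of_nhds
  have h1 : ContDiffAt ℝ ∞ (lieBracket ℝ (coordField e A) (coordField e B)) (e q) :=
    ((hB'.fderiv_right (m := ∞) (by simp)).clm_apply hA').sub
      ((hA'.fderiv_right (m := ∞) (by simp)).clm_apply hB')
  refine ContMDiffAt.congr_of_eventuallyEq (smoothFieldAt_liftField he hq h1) ?_
  filter_upwards [hA, hB, e.open_source.mem_nhds hq] with x hxA hxB hx
  have h2 := chartFrame_coordField he hx (mlieBracket (𝓡 m) A B)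
  rw [coordField_mlieBracket he hx hxA hxB] at h2
  congr 1
  rw [liftField_apply he hx, h2]

theorem SymmTensorField.coordField_leviCivita (hinv : (g.coordForm e (e q)).IsInvertible)
    {A B : (p : M) → TangentSpace (𝓡 m) p} (hA : SmoothFieldAt A q) (hB : SmoothFieldAt B q) :
    coordField e (g.leviCivita A B) (e q) =
      flatConn (g.coordForm e) (coordField e A) (coordField e B) (e q) := by
  rw [coordField_apply he hq, leviCivita_eq he hq hinv hA hB, ← coordField_apply he hq,
    coordField_liftField he hq]

/-- The curvature in coordinates. -/
theorem SymmTensorField.curvature_eq (hinv : (g.coordForm e (e q)).IsInvertible)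
    {A B C : (p : M) → TangentSpace (𝓡 m) p} (hA : ∀ᶠ x in 𝓝 q, SmoothFieldAt A x)
    (hB : ∀ᶠ x in 𝓝 q, SmoothFieldAt B x) (hC : ∀ᶠ x in 𝓝 q, SmoothFieldAt C x)
    (D : (p : M) → TangentSpace (𝓡 m) p) :
    g.curvature A B C D q = flatCurvature (g.coordForm e) (e q) (coordField e A (e q))
      (coordField e B (e q)) (coordField e C (e q)) (coordField e D (e q)) := by
  have h2 {X : (p : M) → TangentSpace (𝓡 m) p} (hX : ∀ᶠ x in 𝓝 q, SmoothFieldAt X x)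
      {Y : (p : M) → TangentSpace (𝓡 m) p} (hY : ∀ᶠ x in 𝓝 q, SmoothFieldAt Y x) :
      coordField e (g.leviCivita X (g.leviCivita Y C)) (e q) =
        flatConn (g.coordForm e) (coordField e X)
          (flatConn (g.coordForm e) (coordField e Y) (coordField e C)) (e q) := by
    obtain ⟨h3, h4⟩ := smoothFieldAt_leviCivita he hq hinv hY hC
    rw [coordField_leviCivita he hq hinv hX.self_of_nhds h4, flatConn, flatConn,
      Filter.EventuallyEq.fderiv_eq h3, h3.self_of_nhds]
  have h5 : coordField e (g.leviCivita (mlieBracket (𝓡 m) A B) C) (e q) =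
      flatConn (g.coordForm e) (lieBracket ℝ (coordField e A) (coordField e B))
        (coordField e C) (e q) := by
    rw [coordField_leviCivita he hq hinv (smoothFieldAt_mlieBracket he hq hA hB)
      hC.self_of_nhds, flatConn, flatConn,
      coordField_mlieBracket he hq hA.self_of_nhds hB.self_of_nhds]
  rw [← bilin_curvature coordForm_symm (eventually_contDiffAt_coordForm he hq) hinv
    (SmoothFieldAt.contDiffAt he hq hA.self_of_nhds)
    (SmoothFieldAt.contDiffAt he hq hB.self_of_nhds)
    (SmoothFieldAt.contDiffAt he hq hC.self_of_nhds), ← h2 hA hB, ← h2 hB hA, ← h5,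
    ← coordField_sub he hq, ← coordField_sub he hq, ← g.pair_eq he hq]
  rfl

end Chart

end Transfer

/-! ### The singular set, its tangent vectors and main pairs in an adapted chart. -/

noncomputable section LocalModel

variable {m : ℕ} {M : Type*} [TopologicalSpace M]
  [ChartedSpace (EuclideanSpace ℝ (Fin m)) M] [IsManifold (𝓡 m) ∞ M]

/-- In the chart `e`, the tensor field `g` is adapted to the covector `θ` on the open set `W` of
coordinates. -/
structure SymmTensorField.IsModel (g : SymmTensorField m M)
    (e : OpenPartialHomeomorph M (EuclideanSpace ℝ (Fin m)))
    (θ : EuclideanSpace ℝ (Fin m) →L[ℝ] ℝ) (W : Set (EuclideanSpace ℝ (Fin m))) : Prop where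
  chart : e ∈ IsManifold.maximalAtlas (𝓡 m) ∞ M
  subset_target : W ⊆ e.target
  adapted : IsAdapted (g.coordForm e) θ W

variable {g : SymmTensorField m M} {e : OpenPartialHomeomorph M (EuclideanSpace ℝ (Fin m))}
  {θ : EuclideanSpace ℝ (Fin m) →L[ℝ] ℝ} {W : Set (EuclideanSpace ℝ (Fin m))}

theorem SymmTensorField.form_eq (he : e ∈ IsManifold.maximalAtlas (𝓡 m) ∞ M) {q : M}
    (hq : q ∈ e.source) (v w : TangentSpace (𝓡 m) q) :
    g.form q v w = g.coordForm e (e q) (chartCoords e q v) (chartCoords e q w) := by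
  let A : (p : M) → TangentSpace (𝓡 m) p := fun _ ↦ (v : EuclideanSpace ℝ (Fin m))
  let B : (p : M) → TangentSpace (𝓡 m) p := fun _ ↦ (w : EuclideanSpace ℝ (Fin m))
  have := g.pair_eq he hq A B
  rw [coordField_apply he hq, coordField_apply he hq] at this
  exact this

theorem SymmTensorField.mem_radical_iff (he : e ∈ IsManifold.maximalAtlas (𝓡 m) ∞ M) {q : M}
    (hq : q ∈ e.source) (v : TangentSpace (𝓡 m) q) :
    v ∈ g.radical q ↔ ∀ w, g.coordForm e (e q) (chartCoords e q v) w = 0 := by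
  constructor
  · intro hv w
    have h1 : g.coordForm e (e q) (chartCoords e q v)
        (chartCoords e q (chartFrame e (e q) w)) = 0 :=
      (form_eq he hq v (chartFrame e (e q) w)).symm.trans (hv (chartFrame e (e q) w))
    rwa [chartCoords_chartFrame he hq w] at h1
  · intro h w
    rw [form_eq he hq]
    exact h _

theorem SymmTensorField.mem_singularSet_iff_exists
    (he : e ∈ IsManifold.maximalAtlas (𝓡 m) ∞ M) {q : M} (hq : q ∈ e.source) :
    q ∈ g.singularSet ↔ ∃ v, (∀ w, g.coordForm e (e q) v w = 0) ∧ v ≠ 0 := by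
  constructor
  · rintro ⟨v, hv, hv0⟩
    refine ⟨chartCoords e q v, (mem_radical_iff he hq v).1 hv, fun h0 ↦ hv0 ?_⟩
    have := chartFrame_chartCoords he hq v
    rw [h0, map_zero] at this
    exact this.symm
  · rintro ⟨v, hv, hv0⟩
    refine ⟨chartFrame e (e q) v, (mem_radical_iff he hq _).2 fun w ↦ ?_, fun h0 ↦ hv0 ?_⟩
    · have := chartCoords_chartFrame he hq v
      rw [this]
      exact hv w
    · have := chartCoords_chartFrame he hq v
      rw [← this]
      exact (congrArg (chartCoords e q) h0).trans (map_zero _)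

theorem SymmTensorField.isInvertible_coordForm (he : e ∈ IsManifold.maximalAtlas (𝓡 m) ∞ M)
    {q : M} (hq : q ∈ e.source) (hqs : q ∉ g.singularSet) :
    (g.coordForm e (e q)).IsInvertible := by
  refine isInvertible_of_forall_eq_zero fun v hv ↦ ?_
  by_contra hv0
  exact hqs ((mem_singularSet_iff_exists he hq).2 ⟨v, fun w ↦ by rw [hv]; rfl, hv0⟩)

theorem SymmTensorField.isClosed_singularSet (g : SymmTensorField m M) :
    IsClosed g.singularSet := by
  rw [← isOpen_compl_iff, isOpen_iff_mem_nhds]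
  intro q hq
  have he := IsManifold.chart_mem_maximalAtlas (I := 𝓡 m) (n := ∞) q
  have hqe := mem_chart_source (EuclideanSpace ℝ (Fin m)) q
  have h1 := IsInvertible.eventually (differentiableAt_coordForm he hqe).continuousAt
    (isInvertible_coordForm he hqe hq)
  have hcont : Tendsto (chartAt (EuclideanSpace ℝ (Fin m)) q) (𝓝 q) (𝓝 _) :=
    (chartAt (EuclideanSpace ℝ (Fin m)) q).continuousAt hqe
  filter_upwards [hcont.eventually h1, (chartAt _ q).open_source.mem_nhds hqe] with x hx hxs hxS
  obtain ⟨v, hv, hv0⟩ := (mem_singularSet_iff_exists he hxs).1 hxS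
  apply hv0
  rw [← IsInvertible.inverse_apply_apply hx v]
  have : g.coordForm (chartAt (EuclideanSpace ℝ (Fin m)) q)
      ((chartAt (EuclideanSpace ℝ (Fin m)) q) x) v = 0 := by
    ext w
    exact hv w
  rw [this, map_zero]

theorem SymmTensorField.dualConn_radical (he : e ∈ IsManifold.maximalAtlas (𝓡 m) ∞ M) {q : M}
    (hq : q ∈ e.source) {A B R : (p : M) → TangentSpace (𝓡 m) p} (hA : SmoothFieldAt A q)
    (hB : SmoothFieldAt B q) (hR : SmoothFieldAt R q) (hr : R q ∈ g.radical q) :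
    g.dualConn A B R q = christoffel (g.coordForm e) (e q) (coordField e A (e q))
      (coordField e B (e q)) (coordField e R (e q)) := by
  rw [dualConn_eq he hq hA hB hR, coordForm_symm, coordField_apply he hq R,
    (mem_radical_iff he hq _).1 hr, zero_add]

namespace SymmTensorField.IsModel

variable (h : g.IsModel e θ W) {q : M} (hq : q ∈ e.source) (hqW : e q ∈ W)
include h hq hqW

theorem mem_singularSet_iff : q ∈ g.singularSet ↔ definingFun (g.coordForm e) θ (e q) = 0 := by
  rw [mem_singularSet_iff_exists h.chart hq, h.adapted.degenerate_iff hqW]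

/-- In one direction the test function is σ itself in the chart; in the other, functions vanishing
on a regular hypersurface have no derivative along ker dσ. -/
theorem isTangent_iff (hqs : q ∈ g.singularSet) (v : TangentSpace (𝓡 m) q) :
    g.IsTangent q v ↔ fderiv ℝ (definingFun (g.coordForm e) θ) (e q) (chartCoords e q v) = 0 := by
  have hσ := (h.mem_singularSet_iff hq hqW).1 hqs
  have hcont : Tendsto e (𝓝 q) (𝓝 (e q)) := e.continuousAt hq
  have hs : Tendsto e.symm (𝓝 (e q)) (𝓝 q) := by
    have := e.symm.continuousAt (e.map_source hq)
    rwa [ContinuousAt, e.left_inv hq] at this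
  have hnear : ∀ᶠ x in 𝓝 q, x ∈ e.source ∧ e x ∈ W :=
    (e.open_source.eventually_mem hq).and (hcont.eventually (h.adapted.isOpen.mem_nhds hqW))
  constructor
  · intro ht
    have hsm : ContMDiffAt (𝓡 m) 𝓘(ℝ) ∞ (definingFun (g.coordForm e) θ ∘ e) q :=
      (contMDiffAt_iff_contDiffAt.2 (h.adapted.contDiffAt_definingFun hqW)).comp q
        (contMDiffAt_of_mem_maximalAtlas h.chart hq)
    have h1 := ht _ hsm (by
      rw [eventually_nhdsWithin_iff]
      filter_upwards [hnear] with x hx hxs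
      exact (h.mem_singularSet_iff hx.1 hx.2).1 hxs)
    rw [mvfderiv_eq h.chart hq (hsm.mdifferentiableAt (by simp))] at h1
    rw [← h1]
    congr 1
    apply Filter.EventuallyEq.fderiv_eq
    filter_upwards [e.open_target.mem_nhds (e.map_source hq)] with y hy
    simp [e.right_inv hy]
  · intro hv f hf hf0
    rw [mvfderiv_eq h.chart hq (hf.mdifferentiableAt (by simp))]
    refine fderiv_eq_zero_of_eventually_eq_zero h.adapted.isOpen h.adapted.contDiffOn_definingFun
      hqW hσ (h.adapted.fderiv_ne_zero _ hqW) ?_ ?_ hv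
    · have h1 : ContMDiffAt (𝓡 m) 𝓘(ℝ) ∞ (f ∘ e.symm) (e q) := by
        rw [← e.left_inv hq] at hf
        exact hf.comp (e q) (contMDiffAt_symm_of_mem_maximalAtlas h.chart (e.map_source hq))
      exact (contMDiffAt_iff_contDiffAt.1 h1).differentiableAt (by simp)
    · rw [eventually_nhdsWithin_iff] at hf0
      filter_upwards [hs.eventually hf0, h.adapted.isOpen.mem_nhds hqW] with y hy hyW hy0
      have hyt := h.subset_target hyW
      refine hy ((h.mem_singularSet_iff (e.map_target hyt) ?_).2 ?_) <;>
      rwa [e.right_inv hyt]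

/-- If Σ contained a neighbourhood of `q`, σ would vanish locally, against dσ ≠ 0. This density is
what makes limits along the complement of Σ meaningful. -/
theorem neBot : (𝓝[g.singularSetᶜ] q).NeBot := by
  rw [← mem_closure_iff_nhdsWithin_neBot, closure_compl, mem_compl_iff, mem_interior_iff_mem_nhds]
  intro hnhds
  have hs : Tendsto e.symm (𝓝 (e q)) (𝓝 q) := by
    have := e.symm.continuousAt (e.map_source hq)
    rwa [ContinuousAt, e.left_inv hq] at this
  apply h.adapted.fderiv_ne_zero _ hqW
  have h1 : definingFun (g.coordForm e) θ =ᶠ[𝓝 (e q)] fun _ ↦ 0 := by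
    filter_upwards [hs.eventually hnhds, h.adapted.isOpen.mem_nhds hqW] with y hy hyW
    have hyt := h.subset_target hyW
    have := (h.mem_singularSet_iff (e.map_target hyt) (by rwa [e.right_inv hyt])).1 hy
    rwa [e.right_inv hyt] at this
  rw [h1.fderiv_eq, fderiv_fun_const]
  rfl

/-- Main pairs in coordinates. -/
theorem isMainPairAt {V : Set M} {N R : (p : M) → TangentSpace (𝓡 m) p} (hNR : g.IsMainPair V N R)
    (hqV : q ∈ V) (hqs : q ∈ g.singularSet) :
    IsMainPairAt (g.coordForm e) θ (e q) (coordField e N (e q)) (coordField e R (e q)) := by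
  have hN := hNR.smooth_normal.smoothFieldAt hNR.isOpen hqV
  have hR := hNR.smooth_radical.smoothFieldAt hNR.isOpen hqV
  have hr := hNR.radical_mem q ⟨hqV, hqs⟩
  refine ⟨fun v hv ↦ ?_, ?_, ?_, ?_, ?_⟩
  · have h1 := chartCoords_chartFrame h.chart hq v
    have h2 := hNR.normal_orthogonal q ⟨hqV, hqs⟩ (chartFrame e (e q) v)
      ((h.isTangent_iff hq hqW hqs _).2 (by
        have : fderiv ℝ (definingFun (g.coordForm e) θ) (e q)
          (chartCoords e q (chartFrame e (e q) v)) = 0 := by rw [h1]; exact hv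
        exact this))
    have h3 : g.coordForm e (e q) (chartCoords e q (N q))
        (chartCoords e q (chartFrame e (e q) v)) = 0 :=
      (form_eq h.chart hq (N q) (chartFrame e (e q) v)).symm.trans h2
    rw [coordField_apply h.chart hq]
    rwa [h1] at h3
  · rw [← g.pair_eq h.chart hq]
    exact hNR.normal_unitary q ⟨hqV, hqs⟩
  · rw [← dualConn_radical h.chart hq hN hN hR hr]
    exact hNR.normal_isotropic q ⟨hqV, hqs⟩
  · rw [coordField_apply h.chart hq]
    exact (mem_radical_iff h.chart hq _).1 hr
  · rw [← dualConn_radical h.chart hq hR hN hR hr]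
    have := hNR.radical_unitary q ⟨hqV, hqs⟩
    rw [formH] at this
    linarith

end SymmTensorField.IsModel

/-- A positive semidefinite transverse field with tangent radical has main pairs. -/
theorem SymmTensorField.IsModel.exists_isMainPair (h : g.IsModel e θ W)
    (hpos : ∀ y ∈ W, definingFun (g.coordForm e) θ y = 0 → ∀ v, 0 ≤ g.coordForm e y v v)
    (ht : ∀ y ∈ W, definingFun (g.coordForm e) θ y = 0 →
      fderiv ℝ (definingFun (g.coordForm e) θ) y (radicalField (g.coordForm e) θ y) = 0)
    {p : M} (hp : p ∈ e.source) (hpW : e p ∈ W) (hps : p ∈ g.singularSet) :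
    ∃ (V : Set M) (N R : (p : M) → TangentSpace (𝓡 m) p), p ∈ V ∧ g.IsMainPair V N R := by
  obtain ⟨V, hVW, hVo, hpV, N, R, hN, hR, hNR⟩ :=
    h.adapted.exists_isMainPairAt hpW ((h.mem_singularSet_iff hp hpW).1 hps) hpos ht
  have hsN : ∀ q ∈ e.source ∩ e ⁻¹' V, SmoothFieldAt (liftField e N) q := fun q hq ↦
    smoothFieldAt_liftField h.chart hq.1 (hN.contDiffAt (hVo.mem_nhds hq.2))
  have hsR : ∀ q ∈ e.source ∩ e ⁻¹' V, SmoothFieldAt (liftField e R) q := fun q hq ↦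
    smoothFieldAt_liftField h.chart hq.1 (hR.contDiffAt (hVo.mem_nhds hq.2))
  have hP : ∀ q ∈ (e.source ∩ e ⁻¹' V) ∩ g.singularSet,
      IsMainPairAt (g.coordForm e) θ (e q) (N (e q)) (R (e q)) := fun q hq ↦
    hNR _ hq.1.2 ((h.mem_singularSet_iff hq.1.1 (hVW hq.1.2)).1 hq.2)
  have hr : ∀ q ∈ (e.source ∩ e ⁻¹' V) ∩ g.singularSet, liftField e R q ∈ g.radical q := by
    intro q hq
    rw [mem_radical_iff h.chart hq.1.1, ← coordField_apply h.chart hq.1.1,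
      coordField_liftField h.chart hq.1.1]
    exact (hP q hq).radical
  refine ⟨e.source ∩ e ⁻¹' V, liftField e N, liftField e R, ⟨hp, hpV⟩,
    e.isOpen_inter_preimage hVo, fun q hq ↦ (hsN q hq).contMDiffWithinAt,
    fun q hq ↦ (hsR q hq).contMDiffWithinAt, ?_, ?_, ?_, hr, ?_⟩
  · intro q hq v hv
    rw [form_eq h.chart hq.1.1, ← coordField_apply h.chart hq.1.1,
      coordField_liftField h.chart hq.1.1]
    exact (hP q hq).orthogonal _ ((h.isTangent_iff hq.1.1 (hVW hq.1.2) hq.2 v).1 hv)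
  · intro q hq
    rw [g.pair_eq h.chart hq.1.1, coordField_liftField h.chart hq.1.1]
    exact (hP q hq).unitary
  · intro q hq
    rw [formII, dualConn_radical h.chart hq.1.1 (hsN q hq.1) (hsN q hq.1) (hsR q hq.1) (hr q hq),
      coordField_liftField h.chart hq.1.1, coordField_liftField h.chart hq.1.1]
    exact (hP q hq).isotropic
  · intro q hq
    rw [formH, dualConn_radical h.chart hq.1.1 (hsR q hq.1) (hsN q hq.1) (hsR q hq.1) (hr q hq),
      coordField_liftField h.chart hq.1.1, coordField_liftField h.chart hq.1.1,
      (hP q hq).radical_unitary]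

theorem SymmTensorField.IsTransverseSingular.exists_isModel (hg : g.IsTransverseSingular)
    (he : e ∈ IsManifold.maximalAtlas (𝓡 m) ∞ M) {p : M} (hp : p ∈ e.source)
    (hps : p ∈ g.singularSet) : ∃ θ W, g.IsModel e θ W ∧ e p ∈ W := by
  obtain ⟨u, hu, hu0⟩ := (mem_singularSet_iff_exists he hp).1 hps
  have hd := hg.2 e he p ⟨hp, hps⟩
  have hdet : g.coordDet e = fun y ↦
      gramDet (EuclideanSpace.basisFun (Fin m) ℝ).toBasis (g.coordForm e y) := by
    funext y
    exact coordDet_eq y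
  rw [hdet] at hd
  obtain ⟨θ, W, hWt, hpW, hA⟩ := exists_isAdapted _ coordForm_symm e.open_target
    (contDiffOn_coordForm he) (e.map_source hp) hu hu0 hd
  exact ⟨θ, W, ⟨he, hWt, hA⟩, hpW⟩

theorem SymmTensorField.IsModel.radicalField_tangent (h : g.IsModel e θ W)
    (hg : g.HasTangentRadical) {y : EuclideanSpace ℝ (Fin m)} (hy : y ∈ W)
    (hσ : definingFun (g.coordForm e) θ y = 0) :
    fderiv ℝ (definingFun (g.coordForm e) θ) y (radicalField (g.coordForm e) θ y) = 0 := by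
  have hyt := h.subset_target hy
  obtain ⟨q, hq, rfl⟩ : ∃ q ∈ e.source, e q = y :=
    ⟨e.symm y, e.map_target hyt, e.right_inv hyt⟩
  have hqs := (h.mem_singularSet_iff hq hy).2 hσ
  have h1 := chartCoords_chartFrame h.chart hq (radicalField (g.coordForm e) θ (e q))
  have h2 := (h.isTangent_iff hq hy hqs _).1 (hg q hqs
    (chartFrame e (e q) (radicalField (g.coordForm e) θ (e q))) (by
      refine (mem_radical_iff h.chart hq _).2 ?_
      intro w
      have : g.coordForm e (e q) (radicalField (g.coordForm e) θ (e q)) w = 0 := by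
        rw [h.adapted.apply_radicalField hy, hσ, zero_mul]
      rw [← h1] at this
      exact this))
  rw [← h1]
  exact h2

/-- Points of Σ are limits of points where `g` is positive definite, and non-negativity passes to
the limit. -/
theorem SymmTensorField.IsModel.nonneg (h : g.IsModel e θ W)
    (hg : g.ChangesRiemannToLorentz) {y : EuclideanSpace ℝ (Fin m)} (hy : y ∈ W)
    (hσ : definingFun (g.coordForm e) θ y = 0) (v : EuclideanSpace ℝ (Fin m)) :
    0 ≤ g.coordForm e y v v := by
  have hyt := h.subset_target hy
  obtain ⟨q, hq, rfl⟩ : ∃ q ∈ e.source, e q = y :=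
    ⟨e.symm y, e.map_target hyt, e.right_inv hyt⟩
  have hqs := (h.mem_singularSet_iff hq hy).2 hσ
  by_contra! hneg
  have hcont : ContinuousAt (fun x ↦ g.coordForm e (e x) v v) q := by
    have h1 : ContinuousAt (fun z ↦ g.coordForm e z v v) (e q) :=
      (((eventually_contDiffAt_coordForm h.chart hq).self_of_nhds.clm_apply
        contDiffAt_const).clm_apply contDiffAt_const).continuousAt
    exact ContinuousAt.comp (f := e) h1 (e.continuousAt hq)
  have hev := (hcont.eventually_lt_const hneg).and (e.open_source.eventually_mem hq)
  obtain ⟨x, ⟨hx, hxs⟩, hxR⟩ := mem_closure_iff_nhds.1 (hg.2 q hqs).1 _ hev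
  have hv0 : v ≠ 0 := by
    rintro rfl
    simp at hneg
  have h1 := chartCoords_chartFrame h.chart hxs v
  have h2 := hxR (chartFrame e (e x) v) (fun h0 ↦ hv0 (by
    rw [← h1]
    exact (congrArg (chartCoords e x) h0).trans (map_zero _)))
  have h3 : 0 < g.coordForm e (e x) (chartCoords e x (chartFrame e (e x) v))
      (chartCoords e x (chartFrame e (e x) v)) :=
    h2.trans_eq (form_eq h.chart hxs (chartFrame e (e x) v) (chartFrame e (e x) v))
  rw [h1] at h3
  exact lt_asymm hx h3

end LocalModel

/-! ### Smoothness off the singular set, and gluing of local extensions. -/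

noncomputable section Smoothness

variable {m : ℕ} {M : Type*} [TopologicalSpace M]
  [ChartedSpace (EuclideanSpace ℝ (Fin m)) M] [IsManifold (𝓡 m) ∞ M]

variable {g : SymmTensorField m M} {e : OpenPartialHomeomorph M (EuclideanSpace ℝ (Fin m))}

theorem contDiffAt_flatCurvature {E : Type*} [NormedAddCommGroup E] [NormedSpace ℝ E]
    [FiniteDimensional ℝ E] {G : E → E →L[ℝ] E →L[ℝ] ℝ} {y : E}
    (hG : ∀ᶠ z in 𝓝 y, ContDiffAt ℝ ∞ G z) (h : (G y).IsInvertible) {A B C D : E → E}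
    (hA : ContDiffAt ℝ ∞ A y) (hB : ContDiffAt ℝ ∞ B y) (hC : ContDiffAt ℝ ∞ C y)
    (hD : ContDiffAt ℝ ∞ D y) :
    ContDiffAt ℝ ∞ (fun z ↦ flatCurvature G z (A z) (B z) (C z) (D z)) y := by
  obtain ⟨Ω, hΩ, hΩo, hy⟩ := mem_nhds_iff.1 hG
  have hc : ContDiffAt ℝ ∞ (christoffel G) y := (contDiffOn_christoffel hΩo fun z hz ↦
    ContDiffAt.contDiffWithinAt (hΩ hz : ContDiffAt ℝ ∞ G z)).contDiffAt (hΩo.mem_nhds hy)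
  have hdc : ContDiffAt ℝ ∞ (fderiv ℝ (christoffel G)) y := hc.fderiv_right (m := ∞) (by simp)
  have hi := ContDiffAt.bilin_inverse hG.self_of_nhds h
  have hd4 {X Y : E → E} (hX : ContDiffAt ℝ ∞ X y) (hY : ContDiffAt ℝ ∞ Y y) :
      ContDiffAt ℝ ∞ (fun z ↦ fderiv ℝ (christoffel G) z (X z) (Y z) (C z) (D z)) y :=
    (((hdc.clm_apply hX).clm_apply hY).clm_apply hC).clm_apply hD
  have hq {X Y : E → E} (hX : ContDiffAt ℝ ∞ X y) (hY : ContDiffAt ℝ ∞ Y y) :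
      ContDiffAt ℝ ∞ (fun z ↦ christoffel G z (X z) (D z)
        ((G z).inverse (christoffel G z (Y z) (C z)))) y :=
    ((hc.clm_apply hX).clm_apply hD).clm_apply (hi.clm_apply ((hc.clm_apply hY).clm_apply hC))
  exact (((hd4 hA hB).sub (hd4 hB hA)).add (hq hB hA)).sub (hq hA hB)

omit [IsManifold (𝓡 m) ∞ M] in
theorem contMDiffAt_of_eventually_eq_comp_chart (he : e ∈ IsManifold.maximalAtlas (𝓡 m) ∞ M)
    {q : M} (hq : q ∈ e.source) {f : M → ℝ} {F : EuclideanSpace ℝ (Fin m) → ℝ}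
    (hF : ContDiffAt ℝ ∞ F (e q)) (hf : ∀ᶠ x in 𝓝 q, f x = F (e x)) :
    ContMDiffAt (𝓡 m) 𝓘(ℝ) ∞ f q := by
  have h1 : ContMDiffAt (𝓡 m) 𝓘(ℝ) ∞ (F ∘ e) q :=
    (contMDiffAt_iff_contDiffAt.2 hF).comp q (contMDiffAt_of_mem_maximalAtlas he hq)
  exact h1.congr_of_eventuallyEq hf

theorem SmoothFieldOn.eventually {A : (p : M) → TangentSpace (𝓡 m) p} {U : Set M}
    (hA : SmoothFieldOn A U) (hU : IsOpen U) {q : M} (hq : q ∈ U) :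
    ∀ᶠ x in 𝓝 q, SmoothFieldAt A x := by
  filter_upwards [hU.mem_nhds hq] with x hx using hA.smoothFieldAt hU hx

theorem SymmTensorField.contMDiffAt_curvature {q : M} (hq : q ∉ g.singularSet)
    {A B C D : (p : M) → TangentSpace (𝓡 m) p} (hA : ∀ᶠ x in 𝓝 q, SmoothFieldAt A x)
    (hB : ∀ᶠ x in 𝓝 q, SmoothFieldAt B x) (hC : ∀ᶠ x in 𝓝 q, SmoothFieldAt C x)
    (hD : ∀ᶠ x in 𝓝 q, SmoothFieldAt D x) :
    ContMDiffAt (𝓡 m) 𝓘(ℝ) ∞ (g.curvature A B C D) q := by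
  have he := IsManifold.chart_mem_maximalAtlas (I := 𝓡 m) (n := ∞) q
  have hqe := mem_chart_source (EuclideanSpace ℝ (Fin m)) q
  refine contMDiffAt_of_eventually_eq_comp_chart he hqe
    (contDiffAt_flatCurvature (eventually_contDiffAt_coordForm (g := g) he hqe)
      (isInvertible_coordForm he hqe hq) (hA.self_of_nhds.contDiffAt he hqe)
      (hB.self_of_nhds.contDiffAt he hqe) (hC.self_of_nhds.contDiffAt he hqe)
      (hD.self_of_nhds.contDiffAt he hqe)) ?_
  filter_upwards [hA.eventually_nhds, hB.eventually_nhds, hC.eventually_nhds,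
    (chartAt (EuclideanSpace ℝ (Fin m)) q).open_source.mem_nhds hqe,
    g.isClosed_singularSet.isOpen_compl.mem_nhds hq] with x hxA hxB hxC hx hxs
  exact curvature_eq he hx (isInvertible_coordForm he hx hxs) hxA hxB hxC D

theorem SymmTensorField.planeGram_det (A B : (p : M) → TangentSpace (𝓡 m) p) (x : M) :
    (g.planeGram A B x).det = g.pair A A x * g.pair B B x - g.pair A B x * g.pair B A x := by
  rw [planeGram, Matrix.det_fin_two_of]

theorem SymmTensorField.contMDiffAt_planeGram_det {q : M} {A B : (p : M) → TangentSpace (𝓡 m) p}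
    (hA : SmoothFieldAt A q) (hB : SmoothFieldAt B q) :
    ContMDiffAt (𝓡 m) 𝓘(ℝ) ∞ (fun x ↦ (g.planeGram A B x).det) q := by
  simp only [planeGram_det]
  exact ((g.contMDiffAt_pair hA hA).mul (g.contMDiffAt_pair hB hB)).sub
    ((g.contMDiffAt_pair hA hB).mul (g.contMDiffAt_pair hB hA))

theorem Matrix.rank_eq_card_iff_det_ne_zero {K n : Type*} [Field K] [Fintype n] [DecidableEq n]
    (P : Matrix n n K) : P.rank = Fintype.card n ↔ P.det ≠ 0 := by
  constructor
  · intro h hd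
    obtain ⟨v, hv0, hv⟩ := Matrix.exists_mulVec_eq_zero_iff.2 hd
    have h1 := P.mulVecLin.finrank_range_add_finrank_ker
    rw [← Matrix.rank, h, Module.finrank_fintype_fun_eq_card] at h1
    have h2 : Module.finrank K (LinearMap.ker P.mulVecLin) = 0 := by omega
    have h3 : v ∈ LinearMap.ker P.mulVecLin := hv
    rw [Submodule.finrank_eq_zero.1 h2, Submodule.mem_bot] at h3
    exact hv0 h3
  · intro h
    exact Matrix.rank_of_isUnit P ((Matrix.isUnit_iff_isUnit_det P).2 (isUnit_iff_ne_zero.2 h))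

/-- A function which locally agrees with smooth functions off the singular set extends smoothly. -/
theorem SymmTensorField.extendsSmoothly_of_local {f : M → ℝ} {U : Set M}
    (hne : ∀ p, (𝓝[g.singularSetᶜ] p).NeBot)
    (h : ∀ p ∈ U, ∃ L : M → ℝ, ContMDiffAt (𝓡 m) 𝓘(ℝ) ∞ L p ∧
      ∀ᶠ x in 𝓝 p, x ∉ g.singularSet → f x = L x) : g.ExtendsSmoothly f U := by
  -- The extension is defined by limits along the dense complement, so it agrees with every
  -- continuous local candidate and no gluing choices are needed.
  have key : ∀ {x : M} {L : M → ℝ}, ContinuousAt L x →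
      (∀ᶠ z in 𝓝 x, z ∉ g.singularSet → f z = L z) →
      limUnder (𝓝[g.singularSetᶜ] x) f = L x := by
    intro x L hL hf
    have := hne x
    refine Tendsto.limUnder_eq ((hL.tendsto.mono_left nhdsWithin_le_nhds).congr' ?_)
    exact eventually_nhdsWithin_iff.2 (hf.mono fun z hz hzs ↦ (hz hzs).symm)
  refine ⟨fun x ↦ limUnder (𝓝[g.singularSetᶜ] x) f, fun p hp ↦ ?_, fun q hq ↦ ?_⟩
  · obtain ⟨L, hL, hf⟩ := h p hp
    refine (hL.congr_of_eventuallyEq ?_).contMDiffWithinAt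
    -- Being `C^∞` at one point does not spread to a single neighbourhood, but `C^1` does; only
    -- continuity near `p` is needed.
    have h1 : ∀ᶠ x in 𝓝 p, ContMDiffAt (𝓡 m) 𝓘(ℝ) 1 L x :=
      (contMDiffAt_iff_contMDiffAt_nhds (by simp)).1
        (ContMDiffAt.of_le hL (WithTop.coe_le_coe.2 (le_top : (1 : ℕ∞) ≤ ⊤)))
    filter_upwards [h1, hf.eventually_nhds] with x hx hfx using key hx.continuousAt hfx
  · obtain ⟨L, hL, hf⟩ := h q hq.1
    exact (key hL.continuousAt hf).trans (hf.self_of_nhds hq.2).symm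

end Smoothness

/-! ### The tensor Υ in an adapted chart carrying a main pair. -/

noncomputable section PairModel

variable {m : ℕ} {M : Type*} [TopologicalSpace M]
  [ChartedSpace (EuclideanSpace ℝ (Fin m)) M] [IsManifold (𝓡 m) ∞ M]

/-- A local model on which a main pair is defined and `⟨R, R⟩ = σ k`, where `σ` is the defining
function of the singular set. -/
structure SymmTensorField.IsPairModel (g : SymmTensorField m M)
    (e : OpenPartialHomeomorph M (EuclideanSpace ℝ (Fin m)))
    (θ : EuclideanSpace ℝ (Fin m) →L[ℝ] ℝ) (W : Set (EuclideanSpace ℝ (Fin m))) (V : Set M)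
    (N R : (p : M) → TangentSpace (𝓡 m) p) (k : EuclideanSpace ℝ (Fin m) → ℝ) : Prop
    extends g.IsModel e θ W where
  isMainPair : g.IsMainPair V N R
  mem_of_mem : ∀ x ∈ e.source, e x ∈ W → x ∈ V
  contDiffOn : ContDiffOn ℝ ∞ k W
  norm_eq : ∀ y ∈ W, g.coordForm e y (coordField e R y) (coordField e R y) =
    definingFun (g.coordForm e) θ y * k y
  factor_eq : ∀ y ∈ W, definingFun (g.coordForm e) θ y = 0 → k y = θ (coordField e R y) ^ 2
  tangent : ∀ y ∈ W, definingFun (g.coordForm e) θ y = 0 →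
    fderiv ℝ (definingFun (g.coordForm e) θ) y (radicalField (g.coordForm e) θ y) = 0
  nonneg : ∀ y ∈ W, definingFun (g.coordForm e) θ y = 0 → ∀ v, 0 ≤ g.coordForm e y v v

variable {g : SymmTensorField m M}

theorem SymmTensorField.IsTransverseRiemannLorentzTangent.exists_isPairModel
    (hg : g.IsTransverseRiemannLorentzTangent) {V : Set M} {N R : (p : M) → TangentSpace (𝓡 m) p}
    (hNR : g.IsMainPair V N R) {p : M} (hp : p ∈ V) (hps : p ∈ g.singularSet) :
    ∃ e θ W k, g.IsPairModel e θ W V N R k ∧ p ∈ e.source ∧ e p ∈ W := by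
  set e := chartAt (EuclideanSpace ℝ (Fin m)) p
  have he : e ∈ IsManifold.maximalAtlas (𝓡 m) ∞ M := IsManifold.chart_mem_maximalAtlas p
  have hpe : p ∈ e.source := mem_chart_source _ p
  obtain ⟨θ, W, h, hpW⟩ := hg.transverse.exists_isModel he hpe hps
  have hVo : IsOpen (e.target ∩ e.symm ⁻¹' V) := e.symm.isOpen_inter_preimage hNR.isOpen
  have hR : ContDiffOn ℝ ∞ (coordField e R) (e.target ∩ e.symm ⁻¹' V) := by
    intro y hy
    have := (hNR.smooth_radical.smoothFieldAt hNR.isOpen hy.2).contDiffAt he (e.map_target hy.1)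
    rw [e.right_inv hy.1] at this
    exact this.contDiffWithinAt
  have hr : ∀ z ∈ (e.target ∩ e.symm ⁻¹' V) ∩ W, definingFun (g.coordForm e) θ z = 0 →
      ∀ w, g.coordForm e z (coordField e R z) w = 0 := by
    rintro z ⟨⟨hzt, hzV⟩, hzW⟩ hz0
    obtain ⟨x, hx, rfl⟩ : ∃ x ∈ e.source, e x = z := ⟨e.symm z, e.map_target hzt, e.right_inv hzt⟩
    rw [mem_preimage, e.left_inv hx] at hzV
    exact (h.isMainPairAt hx hzW hNR hzV ((h.mem_singularSet_iff hx hzW).2 hz0)).radical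
  obtain ⟨W', hW', hW'o, hpW', k, hk, hRk, hkθ⟩ := h.adapted.exists_norm_eq_mul hVo hR hr
    (y := e p) ⟨⟨e.map_source hpe, by rwa [mem_preimage, e.left_inv hpe]⟩, hpW⟩
  have hsub : W' ⊆ W := fun z hz ↦ (hW' hz).2
  refine ⟨e, θ, W', k, ⟨⟨he, hsub.trans h.subset_target, ?_⟩, hNR, ?_, hk, hRk, hkθ, ?_, ?_⟩,
    hpe, hpW'⟩
  · exact ⟨hW'o, h.adapted.smooth.mono hsub, h.adapted.symm,
      fun z hz ↦ h.adapted.isInvertible z (hsub hz),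
      fun z hz ↦ h.adapted.fderiv_ne_zero z (hsub hz)⟩
  · intro x hx hxW
    have := (hW' hxW).1.2
    rwa [mem_preimage, e.left_inv hx] at this
  · exact fun y hy hy0 ↦ h.radicalField_tangent hg.tangentRadical (hsub hy) hy0
  · exact fun y hy hy0 ↦ h.nonneg hg.signature (hsub hy) hy0

namespace SymmTensorField.IsPairModel

variable {e : OpenPartialHomeomorph M (EuclideanSpace ℝ (Fin m))}
  {θ : EuclideanSpace ℝ (Fin m) →L[ℝ] ℝ} {W : Set (EuclideanSpace ℝ (Fin m))} {V : Set M}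
  {N R : (p : M) → TangentSpace (𝓡 m) p} {k : EuclideanSpace ℝ (Fin m) → ℝ}
  (h : g.IsPairModel e θ W V N R k) {q : M} (hq : q ∈ e.source) (hqW : e q ∈ W)
include h hq hqW

theorem eventually_mem : ∀ᶠ x in 𝓝 q, x ∈ e.source ∧ e x ∈ W :=
  (e.open_source.eventually_mem hq).and
    ((e.continuousAt hq).eventually (h.adapted.isOpen.mem_nhds hqW))

theorem isMainPairAt (hqs : q ∈ g.singularSet) :
    IsMainPairAt (g.coordForm e) θ (e q) (coordField e N (e q)) (coordField e R (e q)) :=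
  h.toIsModel.isMainPairAt hq hqW h.isMainPair (h.mem_of_mem q hq hqW) hqs

theorem pair_radical_eq :
    g.pair R R q = definingFun (g.coordForm e) θ (e q) * k (e q) := by
  rw [g.pair_eq h.chart hq, h.norm_eq _ hqW]

section Fields

variable {A B C D : (p : M) → TangentSpace (𝓡 m) p} (hA : ∀ᶠ x in 𝓝 q, SmoothFieldAt A x)
  (hB : ∀ᶠ x in 𝓝 q, SmoothFieldAt B x) (hC : ∀ᶠ x in 𝓝 q, SmoothFieldAt C x)

include hA hB hC

theorem pair_mul_curvature_eq (hqs : q ∉ g.singularSet) :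
    g.pair R R q * g.curvature A B C D q = upsilonExtension (g.coordForm e) θ k (e q)
      (coordField e A (e q)) (coordField e B (e q)) (coordField e C (e q))
      (coordField e D (e q)) := by
  rw [h.adapted.upsilonExtension_of_ne_zero hqW
    (fun h0 ↦ hqs ((h.mem_singularSet_iff hq hqW).2 h0)), h.pair_radical_eq hq hqW,
    curvature_eq h.chart hq (isInvertible_coordForm h.chart hq hqs) hA hB hC]

variable (hD : SmoothFieldAt D q)
include hD

theorem contDiffAt_upsilonExtension :
    ContDiffAt ℝ ∞ (fun z ↦ upsilonExtension (g.coordForm e) θ k z (coordField e A z)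
      (coordField e B z) (coordField e C z) (coordField e D z)) (e q) :=
  h.adapted.contDiffAt_upsilonExtension hqW
    (h.contDiffOn.contDiffAt (h.adapted.isOpen.mem_nhds hqW))
    (hA.self_of_nhds.contDiffAt h.chart hq) (hB.self_of_nhds.contDiffAt h.chart hq)
    (hC.self_of_nhds.contDiffAt h.chart hq) (hD.contDiffAt h.chart hq)

theorem tendsto_pair_mul_curvature :
    Tendsto (fun x ↦ g.pair R R x * g.curvature A B C D x) (𝓝[g.singularSetᶜ] q)
      (𝓝 (upsilonExtension (g.coordForm e) θ k (e q) (coordField e A (e q))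
        (coordField e B (e q)) (coordField e C (e q)) (coordField e D (e q)))) := by
  have h1 := (h.contDiffAt_upsilonExtension hq hqW hA hB hC hD).continuousAt.tendsto.comp
    ((e.continuousAt hq).tendsto.mono_left (nhdsWithin_le_nhds (s := g.singularSetᶜ)))
  refine h1.congr' ?_
  rw [Filter.EventuallyEq, eventually_nhdsWithin_iff]
  filter_upwards [h.eventually_mem hq hqW, hA.eventually_nhds, hB.eventually_nhds,
    hC.eventually_nhds] with x hx hxA hxB hxC hxs
  exact (h.pair_mul_curvature_eq hx.1 hx.2 hxA hxB hxC hxs).symm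

theorem upsilon_eq : g.upsilon R A B C D q = upsilonExtension (g.coordForm e) θ k (e q)
    (coordField e A (e q)) (coordField e B (e q)) (coordField e C (e q))
    (coordField e D (e q)) := by
  have := h.neBot hq hqW
  exact (h.tendsto_pair_mul_curvature hq hqW hA hB hC hD).limUnder_eq

/-- On Σ only the residue of the curvature survives. It is the Gauss-type expression in II, so for
`C = A` and `D = B` it is the determinant of II on the plane. -/
theorem upsilon_eq_of_mem (hqs : q ∈ g.singularSet) : g.upsilon R A B C D q =
    christoffel (g.coordForm e) (e q) (coordField e A (e q)) (coordField e C (e q))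
        (coordField e R (e q)) *
      christoffel (g.coordForm e) (e q) (coordField e B (e q)) (coordField e D (e q))
        (coordField e R (e q)) -
    christoffel (g.coordForm e) (e q) (coordField e B (e q)) (coordField e C (e q))
        (coordField e R (e q)) *
      christoffel (g.coordForm e) (e q) (coordField e A (e q)) (coordField e D (e q))
        (coordField e R (e q)) := by
  have hσ := (h.mem_singularSet_iff hq hqW).1 hqs
  rw [h.upsilon_eq hq hqW hA hB hC hD, h.adapted.upsilonExtension_of_eq_zero hqW hσ
    (h.isMainPairAt hq hqW hqs).radical (h.factor_eq _ hqW hσ)]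

end Fields

end SymmTensorField.IsPairModel

end PairModel

/-! ### Extension of sectional curvature, and Υ in the II-flat case. -/

noncomputable section MainResults

variable {m : ℕ} {M : Type*} [TopologicalSpace M]
  [ChartedSpace (EuclideanSpace ℝ (Fin m)) M] [IsManifold (𝓡 m) ∞ M]

variable {g : SymmTensorField m M}

namespace SymmTensorField

theorem IsRankTwoPlane.det_ne_zero {U : Set M}
    {A B : (p : M) → TangentSpace (𝓡 m) p} (hAB : g.IsRankTwoPlane U A B) {x : M} (hx : x ∈ U) :
    (g.planeGram A B x).det ≠ 0 := by
  rw [← Matrix.rank_eq_card_iff_det_ne_zero, hAB.rank_eq x hx, Fintype.card_fin]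

namespace IsTransverseRiemannLorentzTangent

variable (hg : g.IsTransverseRiemannLorentzTangent)
include hg

theorem exists_isMainPair {p : M} (hp : p ∈ g.singularSet) :
    ∃ (V : Set M) (N R : (p : M) → TangentSpace (𝓡 m) p), p ∈ V ∧ g.IsMainPair V N R := by
  have he := IsManifold.chart_mem_maximalAtlas (I := 𝓡 m) (n := ∞) p
  have hpe := mem_chart_source (EuclideanSpace ℝ (Fin m)) p
  obtain ⟨θ, W, h, hpW⟩ := hg.transverse.exists_isModel he hpe hp
  exact h.exists_isMainPair (fun y hy hy0 ↦ h.nonneg hg.signature hy hy0)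
    (fun y hy hy0 ↦ h.radicalField_tangent hg.tangentRadical hy hy0) hpe hpW hp

theorem neBot (p : M) : (𝓝[g.singularSetᶜ] p).NeBot := by
  by_cases hp : p ∈ g.singularSet
  · obtain ⟨V, N, R, hpV, hNR⟩ := hg.exists_isMainPair hp
    obtain ⟨e, θ, W, k, h, hpe, hpW⟩ := hg.exists_isPairModel hNR hpV hp
    exact h.neBot hpe hpW
  · rw [nhdsWithin_eq_nhds.2 (g.isClosed_singularSet.isOpen_compl.mem_nhds hp)]
    infer_instance

/-- The function `upsilon` is a smooth extension across the singular set. -/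
theorem contMDiffOn_upsilon {V : Set M} {N R : (p : M) → TangentSpace (𝓡 m) p}
    (hNR : g.IsMainPair V N R) {A B C D : (p : M) → TangentSpace (𝓡 m) p}
    (hA : SmoothFieldOn A V) (hB : SmoothFieldOn B V) (hC : SmoothFieldOn C V)
    (hD : SmoothFieldOn D V) :
    ContMDiffOn (𝓡 m) 𝓘(ℝ) ∞ (g.upsilon R A B C D) V ∧
      ∀ q ∈ V \ g.singularSet,
        g.upsilon R A B C D q = g.pair R R q * g.curvature A B C D q := by
  have hsm : ∀ q ∈ V \ g.singularSet,
      ContMDiffAt (𝓡 m) 𝓘(ℝ) ∞ (fun x ↦ g.pair R R x * g.curvature A B C D x) q := by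
    intro q hq
    have hR := hNR.smooth_radical.smoothFieldAt hNR.isOpen hq.1
    exact (g.contMDiffAt_pair hR hR).mul (contMDiffAt_curvature hq.2
      (hA.eventually hNR.isOpen hq.1) (hB.eventually hNR.isOpen hq.1)
      (hC.eventually hNR.isOpen hq.1) (hD.eventually hNR.isOpen hq.1))
  have heq : ∀ q ∈ V \ g.singularSet,
      g.upsilon R A B C D q = g.pair R R q * g.curvature A B C D q := by
    intro q hq
    have := hg.neBot q
    exact ((hsm q hq).continuousAt.tendsto.mono_left nhdsWithin_le_nhds).limUnder_eq
  refine ⟨fun p hp ↦ ContMDiffAt.contMDiffWithinAt ?_, heq⟩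
  by_cases hps : p ∈ g.singularSet
  · obtain ⟨e, θ, W, k, h, hpe, hpW⟩ := hg.exists_isPairModel hNR hp hps
    refine contMDiffAt_of_eventually_eq_comp_chart h.chart hpe
      (h.contDiffAt_upsilonExtension hpe hpW (hA.eventually hNR.isOpen hp)
        (hB.eventually hNR.isOpen hp) (hC.eventually hNR.isOpen hp)
        (hD.smoothFieldAt hNR.isOpen hp)) ?_
    filter_upwards [h.eventually_mem hpe hpW, hNR.isOpen.mem_nhds hp] with x hx hxV
    exact h.upsilon_eq hx.1 hx.2 (hA.eventually hNR.isOpen hxV) (hB.eventually hNR.isOpen hxV)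
      (hC.eventually hNR.isOpen hxV) (hD.smoothFieldAt hNR.isOpen hxV)
  · refine (hsm p ⟨hp, hps⟩).congr_of_eventuallyEq ?_
    filter_upwards [hNR.isOpen.mem_nhds hp, g.isClosed_singularSet.isOpen_compl.mem_nhds hps]
      with x hx hxs using heq x ⟨hx, hxs⟩

/-- Off Σ, `⟨R, R⟩` times the curvature equals `⟨R, R⟩` times the Gram determinant times the
extension of K. The first factor tends to 0 on Σ while the others stay bounded. -/
theorem upsilonVanishes_of_extendsSmoothly {U : Set M} {A B : (p : M) → TangentSpace (𝓡 m) p}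
    (hAB : g.IsRankTwoPlane U A B) (hK : g.ExtendsSmoothly (g.sectionalCurvature A B) U) :
    g.UpsilonVanishes U A B := by
  obtain ⟨F, hF, hFK⟩ := hK
  intro p hp V N R hNR hpV
  have hR := hNR.smooth_radical.smoothFieldAt hNR.isOpen hpV
  have hA := hAB.smooth_left.smoothFieldAt hAB.isOpen hp.1
  have hB := hAB.smooth_right.smoothFieldAt hAB.isOpen hp.1
  have h1 : ContinuousAt (fun x ↦ g.pair R R x * ((g.planeGram A B x).det * F x)) p :=
    (g.contMDiffAt_pair hR hR).continuousAt.mul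
      ((contMDiffAt_planeGram_det hA hB).continuousAt.mul
        (hF.contMDiffAt (hAB.isOpen.mem_nhds hp.1)).continuousAt)
  have h2 : Tendsto (fun x ↦ g.pair R R x * g.curvature A B A B x) (𝓝[g.singularSetᶜ] p)
      (𝓝 (g.pair R R p * ((g.planeGram A B p).det * F p))) := by
    refine (h1.tendsto.mono_left nhdsWithin_le_nhds).congr' ?_
    rw [Filter.EventuallyEq, eventually_nhdsWithin_iff]
    filter_upwards [hAB.isOpen.mem_nhds hp.1] with x hx hxs
    rw [hFK x ⟨hx, hxs⟩, sectionalCurvature, mul_div_cancel₀ _ (hAB.det_ne_zero hx)]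
  have h3 : g.pair R R p = 0 := hNR.radical_mem p ⟨hpV, hp.2⟩ (R p)
  have := hg.neBot p
  rw [h3, zero_mul] at h2
  exact h2.limUnder_eq

/-- Hadamard's lemma writes the extension of `σ k` times the curvature as `σ Z`. Cancelling σ off Σ,
the curvature is `Z / k`, smooth because `k = θ(R)² ≠ 0` on Σ. -/
theorem extendsSmoothly_of_upsilonVanishes {U : Set M} {A B : (p : M) → TangentSpace (𝓡 m) p}
    (hAB : g.IsRankTwoPlane U A B) (hΥ : g.UpsilonVanishes U A B) :
    g.ExtendsSmoothly (g.sectionalCurvature A B) U := by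
  refine extendsSmoothly_of_local hg.neBot fun p hp ↦ ?_
  have hA {x : M} (hx : x ∈ U) := hAB.smooth_left.eventually hAB.isOpen hx
  have hB {x : M} (hx : x ∈ U) := hAB.smooth_right.eventually hAB.isOpen hx
  have hdet := contMDiffAt_planeGram_det (g := g) (hA hp).self_of_nhds (hB hp).self_of_nhds
  by_cases hps : p ∈ g.singularSet
  · obtain ⟨V, N, R, hpV, hNR⟩ := hg.exists_isMainPair hps
    obtain ⟨e, θ, W, k, h, hpe, hpW⟩ := hg.exists_isPairModel hNR hpV hps
    have hΩo : IsOpen (W ∩ (e.target ∩ e.symm ⁻¹' U)) :=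
      h.adapted.isOpen.inter (e.symm.isOpen_inter_preimage hAB.isOpen)
    have hpΩ : e p ∈ W ∩ (e.target ∩ e.symm ⁻¹' U) :=
      ⟨hpW, e.map_source hpe, by rwa [mem_preimage, e.left_inv hpe]⟩
    have hlift : ∀ y ∈ W ∩ (e.target ∩ e.symm ⁻¹' U), ∃ x ∈ e.source, e x = y ∧ x ∈ U :=
      fun y hy ↦ ⟨e.symm y, e.map_target hy.2.1, e.right_inv hy.2.1, hy.2.2⟩
    obtain ⟨W', hW', hW'o, hpW', Z, hZ, hΥZ⟩ := exists_eq_mul_of_eq_zero hΩo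
      (f := fun z ↦ upsilonExtension (g.coordForm e) θ k z (coordField e A z)
        (coordField e B z) (coordField e A z) (coordField e B z))
      (fun y hy ↦ by
        obtain ⟨x, hx, rfl, hxU⟩ := hlift y hy
        exact (h.contDiffAt_upsilonExtension hx hy.1 (hA hxU) (hB hxU) (hA hxU)
          (hB hxU).self_of_nhds).contDiffWithinAt)
      (h.adapted.contDiffOn_definingFun.mono inter_subset_left) hpΩ
      (h.adapted.fderiv_ne_zero _ hpW) (fun y hy hy0 ↦ by
        obtain ⟨x, hx, rfl, hxU⟩ := hlift y hy
        rw [← h.upsilon_eq hx hy.1 (hA hxU) (hB hxU) (hA hxU) (hB hxU).self_of_nhds]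
        exact hΥ x ⟨hxU, (h.mem_singularSet_iff hx hy.1).2 hy0⟩ V N R hNR
          (h.mem_of_mem x hx hy.1))
    have hσ := (h.mem_singularSet_iff hpe hpW).1 hps
    have hk0 : k (e p) ≠ 0 := by
      rw [h.factor_eq _ hpW hσ]
      exact pow_ne_zero 2 ((h.isMainPairAt hpe hpW hps).theta_ne_zero h.adapted hpW hσ)
    have hkc : ContDiffAt ℝ ∞ k (e p) := h.contDiffOn.contDiffAt (h.adapted.isOpen.mem_nhds hpW)
    have hZk : ContMDiffAt (𝓡 m) 𝓘(ℝ) ∞ (fun x ↦ Z (e x) / k (e x)) p :=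
      contMDiffAt_of_eventually_eq_comp_chart h.chart hpe
        ((hZ.contDiffAt (hW'o.mem_nhds hpW')).div hkc hk0) (Eventually.of_forall fun _ ↦ rfl)
    refine ⟨fun x ↦ Z (e x) / k (e x) / (g.planeGram A B x).det,
      hZk.div₀ hdet (hAB.det_ne_zero hp), ?_⟩
    filter_upwards [h.eventually_mem hpe hpW, hAB.isOpen.mem_nhds hp,
      (e.continuousAt hpe).eventually (hW'o.mem_nhds hpW'),
      (e.continuousAt hpe).eventually (hkc.continuousAt.eventually_ne hk0)]
      with x hx hxU hxW' hxk hxs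
    have h1 := h.pair_mul_curvature_eq (D := B) hx.1 hx.2 (hA hxU) (hB hxU) (hA hxU) hxs
    have h2 := hΥZ (e x) hxW'
    have hσx : definingFun (g.coordForm e) θ (e x) ≠ 0 :=
      fun h0 ↦ hxs ((h.mem_singularSet_iff hx.1 hx.2).2 h0)
    rw [h.pair_radical_eq hx.1 hx.2, mul_assoc] at h1
    have h3 := mul_left_cancel₀ hσx (h1.trans h2)
    rw [sectionalCurvature, ← h3, mul_div_cancel_left₀ _ hxk]
  · exact ⟨g.sectionalCurvature A B, (contMDiffAt_curvature hps (hA hp) (hB hp) (hA hp)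
      (hB hp)).div₀ hdet (hAB.det_ne_zero hp), Eventually.of_forall fun _ _ ↦ rfl⟩

end IsTransverseRiemannLorentzTangent

namespace IsModel

variable {e : OpenPartialHomeomorph M (EuclideanSpace ℝ (Fin m))}
  {θ : EuclideanSpace ℝ (Fin m) →L[ℝ] ℝ} {W : Set (EuclideanSpace ℝ (Fin m))} {V : Set M}
  {N R : (p : M) → TangentSpace (𝓡 m) p}
  (h : g.IsModel e θ W) {q : M} (hq : q ∈ e.source) (hqW : e q ∈ W)
  (hNR : g.IsMainPair V N R) (hqV : q ∈ V) (hqs : q ∈ g.singularSet)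
include h hq hqW hNR hqV hqs

/-- The correction by `ν(A) N` contributes nothing, since `N` is II-isotropic. -/
theorem rho_eq {A : (p : M) → TangentSpace (𝓡 m) p} (hA : SmoothFieldAt A q) :
    g.rho N R A q = christoffel (g.coordForm e) (e q) (coordField e A (e q))
      (coordField e N (e q)) (coordField e R (e q)) := by
  have hN := hNR.smooth_normal.smoothFieldAt hNR.isOpen hqV
  have hR := hNR.smooth_radical.smoothFieldAt hNR.isOpen hqV
  have hX : SmoothFieldAt (fun x ↦ A x - g.nu N A x • N x) q :=
    ContMDiffAt.sub_section hA (ContMDiffAt.smul_section (g.contMDiffAt_pair hA hN) hN)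
  rw [rho, formH, neg_neg, dualConn_radical h.chart hq hX hN hR (hNR.radical_mem q ⟨hqV, hqs⟩),
    coordField_sub h.chart hq, coordField_smul h.chart hq, map_sub, map_smul,
    sub_apply, sub_apply, smul_apply, smul_apply, (h.isMainPairAt hq hqW hNR hqV hqs).isotropic,
    smul_zero, sub_zero]

theorem nuRhoDet_eq {A B : (p : M) → TangentSpace (𝓡 m) p} (hA : SmoothFieldAt A q)
    (hB : SmoothFieldAt B q) :
    g.nuRhoDet N R A B q =
      g.coordForm e (e q) (coordField e A (e q)) (coordField e N (e q)) *
        christoffel (g.coordForm e) (e q) (coordField e B (e q)) (coordField e N (e q))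
          (coordField e R (e q)) -
      g.coordForm e (e q) (coordField e B (e q)) (coordField e N (e q)) *
        christoffel (g.coordForm e) (e q) (coordField e A (e q)) (coordField e N (e q))
          (coordField e R (e q)) := by
  rw [nuRhoDet, Matrix.det_fin_two_of, h.rho_eq hq hqW hNR hqV hqs hA,
    h.rho_eq hq hqW hNR hqV hqs hB, nu, nu, g.pair_eq h.chart hq, g.pair_eq h.chart hq]

theorem isScreenAt_iff {X : (p : M) → TangentSpace (𝓡 m) p} (hX : SmoothFieldAt X q) :
    g.IsScreenAt N R X q ↔
      fderiv ℝ (definingFun (g.coordForm e) θ) (e q) (coordField e X (e q)) = 0 ∧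
      christoffel (g.coordForm e) (e q) (coordField e X (e q)) (coordField e N (e q))
        (coordField e R (e q)) = 0 := by
  have hN := hNR.smooth_normal.smoothFieldAt hNR.isOpen hqV
  have hR := hNR.smooth_radical.smoothFieldAt hNR.isOpen hqV
  rw [IsScreenAt, h.isTangent_iff hq hqW hqs, formH, neg_eq_zero,
    dualConn_radical h.chart hq hX hN hR (hNR.radical_mem q ⟨hqV, hqs⟩),
    coordField_apply h.chart hq X]

omit hqW in
theorem formII_eq {X Y : (p : M) → TangentSpace (𝓡 m) p} (hX : SmoothFieldAt X q)
    (hY : SmoothFieldAt Y q) :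
    g.formII R X Y q = christoffel (g.coordForm e) (e q) (coordField e X (e q))
      (coordField e Y (e q)) (coordField e R (e q)) :=
  dualConn_radical h.chart hq hX hY (hNR.smooth_radical.smoothFieldAt hNR.isOpen hqV)
    (hNR.radical_mem q ⟨hqV, hqs⟩)

end IsModel

namespace IsTransverseRiemannLorentzTangent

variable (hg : g.IsTransverseRiemannLorentzTangent)
include hg

/-- In the `II`-flat case, the curvature form on a plane is minus the square of the
`(ν, ρ)`-determinant. -/
theorem upsilon_eq_neg_nuRhoDet_sq (hII : g.IsIIFlat) {V : Set M}
    {N R : (p : M) → TangentSpace (𝓡 m) p} (hNR : g.IsMainPair V N R) {p : M} (hp : p ∈ V)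
    (hps : p ∈ g.singularSet) {A B : (p : M) → TangentSpace (𝓡 m) p}
    (hA : ∀ᶠ x in 𝓝 p, SmoothFieldAt A x) (hB : ∀ᶠ x in 𝓝 p, SmoothFieldAt B x) :
    g.upsilon R A B A B p = -(g.nuRhoDet N R A B p) ^ 2 := by
  obtain ⟨e, θ, W, k, h, hpe, hpW⟩ := hg.exists_isPairModel hNR hp hps
  have hσ := (h.mem_singularSet_iff hpe hpW).1 hps
  have hflat : ∀ v w, fderiv ℝ (definingFun (g.coordForm e) θ) (e p) v = 0 →
      christoffel (g.coordForm e) (e p) v (coordField e N (e p)) (coordField e R (e p)) = 0 →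
      fderiv ℝ (definingFun (g.coordForm e) θ) (e p) w = 0 →
      christoffel (g.coordForm e) (e p) w (coordField e N (e p)) (coordField e R (e p)) = 0 →
      christoffel (g.coordForm e) (e p) v w (coordField e R (e p)) = 0 := by
    intro v w hv hv' hw hw'
    have hs (u : EuclideanSpace ℝ (Fin m)) : SmoothFieldAt (liftField e fun _ ↦ u) p :=
      smoothFieldAt_liftField h.chart hpe contDiffAt_const
    have h1 := hII p hps V N R hNR hp _ _ (hs v) (hs w)
      ((h.isScreenAt_iff hpe hpW hNR hp hps (hs v)).2 (by
        rw [coordField_liftField h.chart hpe]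
        exact ⟨hv, hv'⟩))
      ((h.isScreenAt_iff hpe hpW hNR hp hps (hs w)).2 (by
        rw [coordField_liftField h.chart hpe]
        exact ⟨hw, hw'⟩))
    rwa [h.formII_eq hpe hNR hp hps (hs v) (hs w), coordField_liftField h.chart hpe,
      coordField_liftField h.chart hpe] at h1
  rw [h.upsilon_eq_of_mem hpe hpW hA hB hA hB.self_of_nhds hps,
    h.nuRhoDet_eq hpe hpW hNR hp hps hA.self_of_nhds hB.self_of_nhds]
  exact (h.isMainPairAt hpe hpW hps).upsilon_eq_neg_sq h.adapted hpW hσ (h.tangent _ hpW hσ)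
    hflat _ _

theorem upsilonVanishes_iff_nuRhoDetVanishes (hII : g.IsIIFlat) {U : Set M}
    {A B : (p : M) → TangentSpace (𝓡 m) p} (hAB : g.IsRankTwoPlane U A B) :
    g.UpsilonVanishes U A B ↔ g.NuRhoDetVanishes U A B := by
  refine forall₂_congr fun p hp ↦ forall₅_congr fun V N R hNR hpV ↦ ?_
  rw [hg.upsilon_eq_neg_nuRhoDet_sq hII hNR hpV hp.2 (hAB.smooth_left.eventually hAB.isOpen hp.1)
    (hAB.smooth_right.eventually hAB.isOpen hp.1)]
  simp

end IsTransverseRiemannLorentzTangent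

end SymmTensorField

end MainResults

/-! ### From vanishing of Υ to II-flatness. -/

noncomputable section Flatness

namespace IsMainPairAt

variable {E : Type*} [NormedAddCommGroup E] [NormedSpace ℝ E] {G : E → E →L[ℝ] E →L[ℝ] ℝ}
  {θ : E →L[ℝ] ℝ} {W : Set E} {y n r : E} [FiniteDimensional ℝ E] (H : IsMainPairAt G θ y n r)
  (h : IsAdapted G θ W) (hy : y ∈ W) (hσ : definingFun G θ y = 0)
include H h hy hσ

/-- Screen vectors are not isotropic where `G` is positive semidefinite. -/
theorem screen_pos (hpos : ∀ v, 0 ≤ G y v v) {v : E} (hv0 : v ≠ 0)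
    (hv : christoffel G y v n r = 0) : 0 < G y v v := by
  refine lt_of_le_of_ne (hpos v) fun h0 ↦ hv0 ?_
  -- An isotropic vector of a semidefinite form is radical. A radical vector is a multiple of `r`,
  -- and the screen condition makes the coefficient zero.
  have hrad : ∀ w, G y v w = 0 := by
    intro w
    have h1 (t : ℝ) : 0 ≤ 2 * t * G y v w + G y w w := by
      have := hpos (t • v + w)
      simp only [map_add, map_smul, add_apply, smul_apply, smul_eq_mul, ← h0, h.symm y w v] at this
      linarith
    by_contra hne
    have h2 := h1 (-(G y w w + 1) / (2 * G y v w))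
    have h3 : 2 * (-(G y w w + 1) / (2 * G y v w)) * G y v w = -(G y w w + 1) := by
      field_simp
    linarith
  have h4 := H.eq_smul_of_radical h hy hσ hrad
  rw [h4, map_smul, smul_apply, smul_apply, H.radical_unitary, smul_eq_mul, mul_one] at hv
  rw [h4, hv, zero_smul]

end IsMainPairAt

variable {m : ℕ} {M : Type*} [TopologicalSpace M]
  [ChartedSpace (EuclideanSpace ℝ (Fin m)) M] [IsManifold (𝓡 m) ∞ M]

namespace SymmTensorField

variable {g : SymmTensorField m M}

/-- Apply the hypothesis to the plane of `N + R` and a screen field through `v`. With `N` alone II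
would be isotropic, and with `R` alone the plane would be degenerate; the sum has II-square 2 and is
II-orthogonal to `v`, so Υ equals `2 II(v, v)`. -/
theorem IsPairModel.christoffel_screen_eq_zero
    {e : OpenPartialHomeomorph M (EuclideanSpace ℝ (Fin m))}
    {θ : EuclideanSpace ℝ (Fin m) →L[ℝ] ℝ} {W : Set (EuclideanSpace ℝ (Fin m))} {V : Set M}
    {N R : (p : M) → TangentSpace (𝓡 m) p} {k : EuclideanSpace ℝ (Fin m) → ℝ}
    (h : g.IsPairModel e θ W V N R k) {p : M} (hp : p ∈ e.source) (hpW : e p ∈ W)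
    (hps : p ∈ g.singularSet)
    (hΥ : ∀ (U : Set M) (A B : (p : M) → TangentSpace (𝓡 m) p), g.IsRankTwoPlane U A B →
      g.NuRhoDetVanishes U A B → g.UpsilonVanishes U A B)
    {v : EuclideanSpace ℝ (Fin m)}
    (hv : fderiv ℝ (definingFun (g.coordForm e) θ) (e p) v = 0)
    (hv' : christoffel (g.coordForm e) (e p) v (coordField e N (e p)) (coordField e R (e p)) = 0) :
    christoffel (g.coordForm e) (e p) v v (coordField e R (e p)) = 0 := by
  by_cases hv0 : v = 0
  · simp [hv0]
  set G := g.coordForm e with hG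
  set n := coordField e N with hn
  set r := coordField e R with hr
  have hNR := h.isMainPair
  have hns {x : M} (hx : x ∈ e.source) (hxW : e x ∈ W) : ContDiffAt ℝ ∞ n (e x) :=
    (hNR.smooth_normal.smoothFieldAt hNR.isOpen (h.mem_of_mem x hx hxW)).contDiffAt h.chart hx
  have hrs {x : M} (hx : x ∈ e.source) (hxW : e x ∈ W) : ContDiffAt ℝ ∞ r (e x) :=
    (hNR.smooth_radical.smoothFieldAt hNR.isOpen (h.mem_of_mem x hx hxW)).contDiffAt h.chart hx
  let a : EuclideanSpace ℝ (Fin m) → EuclideanSpace ℝ (Fin m) := fun z ↦ n z + r z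
  -- The hypothesis asks for a vanishing determinant along all of `U ∩ Σ`, so `v` is extended by a
  -- field whose ν- and ρ-components are zero at every nearby point of Σ.
  let b : EuclideanSpace ℝ (Fin m) → EuclideanSpace ℝ (Fin m) := fun z ↦
    v - G z v (n z) • n z - christoffel G z v (n z) (r z) • r z
  have ha {x : M} (hx : x ∈ e.source) (hxW : e x ∈ W) : SmoothFieldAt (liftField e a) x :=
    smoothFieldAt_liftField h.chart hx ((hns hx hxW).add (hrs hx hxW))
  have hb {x : M} (hx : x ∈ e.source) (hxW : e x ∈ W) : SmoothFieldAt (liftField e b) x := by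
    have hW := h.adapted.isOpen.mem_nhds hxW
    have hGs : ContDiffAt ℝ ∞ G (e x) := h.adapted.smooth.contDiffAt hW
    have hcs : ContDiffAt ℝ ∞ (christoffel G) (e x) :=
      (contDiffOn_christoffel h.adapted.isOpen h.adapted.smooth).contDiffAt hW
    exact smoothFieldAt_liftField h.chart hx ((contDiffAt_const.sub
      (((hGs.clm_apply contDiffAt_const).clm_apply (hns hx hxW)).smul (hns hx hxW))).sub
      ((((hcs.clm_apply contDiffAt_const).clm_apply (hns hx hxW)).clm_apply (hrs hx hxW)).smul
        (hrs hx hxW)))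
  have hσ := (h.mem_singularSet_iff hp hpW).1 hps
  have ht := h.tangent _ hpW hσ
  have H := h.isMainPairAt hp hpW hps
  rw [← hG, ← hn, ← hr] at H
  have hvn : G (e p) v (n (e p)) = 0 := (H.bilin_normal_eq_zero_iff h.adapted hpW hσ v).2 hv
  have hbp : b (e p) = v := by simp only [b, hvn, hv', zero_smul, sub_zero]
  have hdetp : (g.planeGram (liftField e a) (liftField e b) p).det = G (e p) v v := by
    rw [planeGram_det, g.pair_eq h.chart hp, g.pair_eq h.chart hp, g.pair_eq h.chart hp,
      g.pair_eq h.chart hp, coordField_liftField h.chart hp, coordField_liftField h.chart hp, hbp,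
      ← hG]
    simp only [a, map_add, add_apply, H.unitary, H.radical, H.bilin_radical h.adapted hpW hσ,
      hvn]
    ring
  have hdetp0 : (g.planeGram (liftField e a) (liftField e b) p).det ≠ 0 := by
    rw [hdetp]
    exact (H.screen_pos h.adapted hpW hσ (h.nonneg _ hpW hσ) hv0 hv').ne'
  obtain ⟨U, hU, hUo, hpU⟩ := mem_nhds_iff.1 ((h.eventually_mem hp hpW).and
    ((contMDiffAt_planeGram_det (g := g) (ha hp hpW) (hb hp hpW)).continuousAt.eventually_ne
      hdetp0))
  have hplane : g.IsRankTwoPlane U (liftField e a) (liftField e b) := by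
    refine ⟨hUo, fun x hx ↦ (ha (hU hx).1.1 (hU hx).1.2).contMDiffWithinAt,
      fun x hx ↦ (hb (hU hx).1.1 (hU hx).1.2).contMDiffWithinAt, fun x hx ↦ ?_⟩
    have := (Matrix.rank_eq_card_iff_det_ne_zero _).2 (hU hx).2
    rwa [Fintype.card_fin] at this
  have hvan : g.NuRhoDetVanishes U (liftField e a) (liftField e b) := by
    rintro x ⟨hxU, hxs⟩ V' N' R' hNR' hxV'
    obtain ⟨⟨hx, hxW⟩, -⟩ := hU hxU
    have hσx := (h.mem_singularSet_iff hx hxW).1 hxs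
    have Hx := h.isMainPairAt hx hxW hxs
    -- The determinant must vanish for every main pair; another pair has the same normal and a
    -- multiple of the same radical vector.
    obtain ⟨hN', f, hR'⟩ := Hx.unique h.adapted hxW hσx (h.tangent _ hxW hσx)
      (h.toIsModel.isMainPairAt hx hxW hNR' hxV' hxs)
    rw [← hG, ← hn, ← hr] at Hx
    rw [h.nuRhoDet_eq hx hxW hNR' hxV' hxs (ha hx hxW) (hb hx hxW), hN', hR',
      coordField_liftField h.chart hx, coordField_liftField h.chart hx, ← hG, ← hn, ← hr]
    have h1 : G (e x) (b (e x)) (n (e x)) = 0 := by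
      simp only [b, map_sub, map_smul, sub_apply, smul_apply, smul_eq_mul, Hx.unitary, Hx.radical]
      ring
    have h2 : christoffel G (e x) (b (e x)) (n (e x)) (r (e x)) = 0 := by
      simp only [b, map_sub, map_smul, sub_apply, smul_apply, smul_eq_mul, Hx.isotropic,
        Hx.radical_unitary]
      ring
    rw [h1, map_smul, h2]
    simp
  have hev : ∀ᶠ x in 𝓝 p, SmoothFieldAt (liftField e a) x ∧ SmoothFieldAt (liftField e b) x := by
    filter_upwards [h.eventually_mem hp hpW] with x hx using ⟨ha hx.1 hx.2, hb hx.1 hx.2⟩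
  have hu := hΥ U _ _ hplane hvan p ⟨hpU, hps⟩ V N R hNR (h.mem_of_mem p hp hpW)
  rw [h.upsilon_eq_of_mem hp hpW (hev.mono fun _ h ↦ h.1) (hev.mono fun _ h ↦ h.2)
    (hev.mono fun _ h ↦ h.1) (hb hp hpW) hps, coordField_liftField h.chart hp,
    coordField_liftField h.chart hp, hbp, ← hG, ← hr] at hu
  have h3 : christoffel G (e p) v (a (e p)) (r (e p)) = 0 := by
    simp only [a, map_add, add_apply, hv', H.christoffel_radical h.adapted hpW hσ v]
    rw [hv]
    ring
  have h4 : christoffel G (e p) (a (e p)) (a (e p)) (r (e p)) = 2 := by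
    simp only [a, map_add, add_apply, H.isotropic, H.radical_unitary,
      H.christoffel_normal h.adapted hpW hσ, H.christoffel_radical_radical h.adapted hpW hσ ht]
    norm_num
  rw [h3, h4] at hu
  linarith

/-- Polarisation: the quadratic form of II vanishes on the screen, which is a linear subspace, and
II is symmetric. -/
theorem IsTransverseRiemannLorentzTangent.isIIFlat_of_forall_upsilonVanishes
    (hg : g.IsTransverseRiemannLorentzTangent)
    (hΥ : ∀ (U : Set M) (A B : (p : M) → TangentSpace (𝓡 m) p), g.IsRankTwoPlane U A B →
      g.NuRhoDetVanishes U A B → g.UpsilonVanishes U A B) : g.IsIIFlat := by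
  intro p hps V N R hNR hpV X Y hX hY hXs hYs
  obtain ⟨e, θ, W, k, h, hp, hpW⟩ := hg.exists_isPairModel hNR hpV hps
  rw [h.isScreenAt_iff hp hpW hNR hpV hps hX] at hXs
  rw [h.isScreenAt_iff hp hpW hNR hpV hps hY] at hYs
  rw [h.formII_eq hp hNR hpV hps hX hY]
  have h1 := h.christoffel_screen_eq_zero hp hpW hps hΥ hXs.1 hXs.2
  have h2 := h.christoffel_screen_eq_zero hp hpW hps hΥ hYs.1 hYs.2
  have h3 := h.christoffel_screen_eq_zero hp hpW hps hΥ
    (v := coordField e X (e p) + coordField e Y (e p)) (by rw [map_add, hXs.1, hYs.1, add_zero])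
    (by rw [map_add, add_apply, add_apply, hXs.2, hYs.2, add_zero])
  have h4 := christoffel_symm h.adapted.symm (h.adapted.differentiableAt hpW)
    (coordField e Y (e p)) (coordField e X (e p))
  simp only [map_add, add_apply, h1, h2, h4] at h3
  linarith

end SymmTensorField

end Flatness

theorem mainTheorem6 {m : ℕ} (hm : 2 < m) {M : Type*} [TopologicalSpace M] [T2Space M]
    [SecondCountableTopology M] [ConnectedSpace M]
    [ChartedSpace (EuclideanSpace ℝ (Fin m)) M] [IsManifold (𝓡 m) ∞ M]
    (g : SymmTensorField m M) (hg : g.IsTransverseRiemannLorentzTangent) :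
    -- `N` and `R` exist locally, and `Υ` is a well-defined smooth object across `Σ`
    (∀ p ∈ g.singularSet, ∃ (V : Set M) (N R : (p : M) → TangentSpace (𝓡 m) p),
      p ∈ V ∧ g.IsMainPair V N R) ∧
    (∀ (V : Set M) (N R : (p : M) → TangentSpace (𝓡 m) p), g.IsMainPair V N R →
      ∀ A B C D : (p : M) → TangentSpace (𝓡 m) p,
        SmoothFieldOn A V → SmoothFieldOn B V → SmoothFieldOn C V → SmoothFieldOn D V →
        ContMDiffOn (𝓡 m) 𝓘(ℝ) ∞ (g.upsilon R A B C D) V ∧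
          ∀ q ∈ V \ g.singularSet,
            g.upsilon R A B C D q = g.pair R R q * g.curvature A B C D q) ∧
    -- (a)
    (∀ (U : Set M) (A B : (p : M) → TangentSpace (𝓡 m) p), g.IsRankTwoPlane U A B →
      (g.ExtendsSmoothly (g.sectionalCurvature A B) U ↔ g.UpsilonVanishes U A B)) ∧
    -- (b), (1) ⇔ (2)
    ((∀ (U : Set M) (A B : (p : M) → TangentSpace (𝓡 m) p), g.IsRankTwoPlane U A B →
        g.NuRhoDetVanishes U A B → g.UpsilonVanishes U A B) ↔ g.IsIIFlat) ∧
    -- (b), (2) ⇒ (3)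
    (g.IsIIFlat →
      ∀ (U : Set M) (A B : (p : M) → TangentSpace (𝓡 m) p), g.IsRankTwoPlane U A B →
        g.UpsilonVanishes U A B → g.NuRhoDetVanishes U A B) := by
  refine ⟨fun p hp ↦ hg.exists_isMainPair hp,
    fun V N R hNR A B C D hA hB hC hD ↦ hg.contMDiffOn_upsilon hNR hA hB hC hD,
    fun U A B hAB ↦ ⟨hg.upsilonVanishes_of_extendsSmoothly hAB,
      hg.extendsSmoothly_of_upsilonVanishes hAB⟩,
    ⟨hg.isIIFlat_of_forall_upsilonVanishes, fun hII U A B hAB ↦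
      (hg.upsilonVanishes_iff_nuRhoDetVanishes hII hAB).2⟩,
    fun hII U A B hAB ↦ (hg.upsilonVanishes_iff_nuRhoDetVanishes hII hAB).1⟩
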